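/- Let $k$ be a number field of degree $d$ over $\mathbb{Q}$ with ring of integers $\mathfrak{o}$, let $n\ge 0$ be an integer, and let $\mathrm{Val}(k)$ be the set of places of $k$. For $\nu\in\mathrm{Val}(k)$ let $\|\cdot\|_\nu$ be the normalised absolute value of $k_\nu$ (the usual one if $\nu$ is real, its square if $\nu$ is complex, and $\|x\|_{\mathfrak p}=\mathrm{N}\mathfrak{p}^{-v_{\mathfrak p}(x)}$ for a prime $\mathfrak p$), put $H_\nu(\mathbf{x})=\max_i\|x_i\|_\nu$ on $k_\nu^{n+1}$, and let $H(x)=\prod_{\nu\in\mathrm{Val}(k)}H_\nu(x)$ be the height on $\mathbb{P}^n(k)$. Let $\mu_\nu$ be the product measure on $k_\nu^{n+1}$ induced by the usual Haar measure on $k_\nu$ (Lebesgue measure if $\nu$ is real, twice Lebesgue measure if $\nu$ is complex, and normalised by $\mu_{\mathfrak p}(\mathfrak{o}_{\mathfrak p})=1$ for a prime $\mathfrak p$). Let $k_\infty=\mathfrak{o}\otimes_{\mathbb Z}\mathbb{R}\cong\prod_{\nu\mid\infty}k_\nu$ and let $\mu_\infty$ be Haar measure on $k_\infty^{n+1}$.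 For a field $F$ and $\Omega\subset\mathbb{P}^n(F)$ let $\Omega^{\mathrm{aff}}\subset F^{n+1}\setminus\{0\}$ be the preimage of $\Omega$ (the affine cone of $\Omega$), and write $\partial$ for topological boundary. For each $\nu\in\mathrm{Val}(k)$ let $\Omega_\nu\subset\mathbb{P}^n(k_\nu)$ be a subset such that $\mu_\nu(\partial\Omega_\nu^{\mathrm{aff}})=0$ and $\mu_\nu(\Omega_\nu^{\mathrm{aff}})>0$. Suppose also that $$\lim_{M\to\infty}\limsup_{B\to\infty}\frac{\#\{\mathbf{x}\in\mathfrak{o}^{n+1}\cap B\Psi:\ \exists\ \text{a prime } \mathfrak{p}\text{ of } k \text{ with }\mathrm{N}\mathfrak{p}>M\text{ and }\mathbf{x}\notin\Omega_{\mathfrak p}^{\mathrm{aff}}\}}{B^{d(n+1)}}=0$$ for all bounded subsets $\Psi\subset k_\infty^{n+1}$ of positive measure with $\mu_\infty(\partial\Psi)=0$. Then the limit $$\lim_{B\to\infty}\frac{\#\{x\in\mathbb{P}^n(k):H(x)\le B,\ x\in\Omega_\nu\text{ for all }\nu\in\mathrm{Val}(k)\}}{\#\{x\in\mathbb{P}^n(k):H(x)\le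 B\}}$$ exists, is non-zero and equals $$\prod_{\nu\mid\infty}\frac{\mu_\nu(\{\mathbf{x}\in\Omega_\nu^{\mathrm{aff}}:H_\nu(\mathbf{x})\le 1\})}{\mu_\nu(\{\mathbf{x}\in k_\nu^{n+1}:H_\nu(\mathbf{x})\le 1\})}\ \prod_{\mathfrak p}\mu_{\mathfrak p}(\Omega_{\mathfrak p}^{\mathrm{aff}}\cap\mathfrak{o}_{\mathfrak p}^{n+1}),$$ where the product over all primes $\mathfrak p$ of $k$ converges. -/

import Mathlib

open Set Filter Topology MeasureTheory NumberField IsDedekindDomain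
open scoped Pointwise ENNReal LinearAlgebra.Projectivization

noncomputable section

namespace EkedahlSieve

variable (K : Type*) [Field K] [NumberField K]

/-! ### Projective space and affine cones -/

/-- The set `ℙⁿ(F)` of `F`-rational points of projective `n`-space. -/
abbrev PSpace (F : Type*) [Field F] (n : ℕ) : Type _ := ℙ F (Fin (n + 1) → F)

/-- The affine cone of `Ω ⊆ ℙⁿ(F)`: the preimage of `Ω` in `F^(n+1) ∖ {0}`. -/
def affineCone {F : Type*} [Field F] {n : ℕ} (Ω : Set (PSpace F n)) : Set (Fin (n + 1) → F) :=
  {x | ∃ hx : x ≠ 0, Projectivization.mk F x hx ∈ Ω}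

/-- The coordinatewise inclusion `k^(n+1) → F^(n+1)` for a field extension `F / k`. -/
def coordMap {k : Type*} [Field k] (F : Type*) [Field F] [Algebra k F] (n : ℕ) :
    (Fin (n + 1) → k) →ₛₗ[algebraMap k F] (Fin (n + 1) → F) where
  toFun x i := algebraMap k F (x i)
  map_add' x y := by ext i; simp
  map_smul' c x := by ext i; simp

theorem coordMap_injective {k : Type*} [Field k] (F : Type*) [Field F] [Algebra k F] (n : ℕ) :
    Function.Injective (coordMap (k := k) F n) := fun _ _ h =>
  funext fun i => (algebraMap k F).injective (congrFun h i)

/-- The natural map `ℙⁿ(k) → ℙⁿ(F)` for a field extension `F / k`. -/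
def toPSpace {k : Type*} [Field k] (F : Type*) [Field F] [Algebra k F] {n : ℕ} :
    PSpace k n → PSpace F n :=
  Projectivization.map (coordMap F n) (coordMap_injective F n)

/-! ### Haar measures on the completions -/

instance (v : InfinitePlace K) : MeasurableSpace v.Completion := borel _

instance (v : InfinitePlace K) : BorelSpace v.Completion := ⟨rfl⟩

instance (v : HeightOneSpectrum (𝓞 K)) : MeasurableSpace (v.adicCompletion K) := borel _

instance (v : HeightOneSpectrum (𝓞 K)) : BorelSpace (v.adicCompletion K) := ⟨rfl⟩

open scoped Classical in
/-- The usual Haar measure on `k_ν` for an archimedean place `ν`: Lebesgue measure if `ν` is real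
and twice Lebesgue measure if `ν` is complex. -/
def archHaar (v : InfinitePlace K) : Measure v.Completion :=
  if hv : v.IsReal then
    (volume : Measure ℝ).map (InfinitePlace.Completion.isometryEquivRealOfIsReal hv).symm
  else
    (2 : ℝ≥0∞) • (volume : Measure ℂ).map
      (InfinitePlace.Completion.isometryEquivComplexOfIsComplex
        (InfinitePlace.not_isReal_iff_isComplex.1 hv)).symm

section Compactness

variable {K} (v : HeightOneSpectrum (𝓞 K))

theorem exists_integer_sub_lt_one (x : v.adicCompletion K) (hx : Valued.v x ≤ 1) :
    ∃ r : 𝓞 K, Valued.v (x - algebraMap K (v.adicCompletion K) (algebraMap (𝓞 K) K r)) < 1 := by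
  have h1 : IsOpen {y : v.adicCompletion K | Valued.v y < 1} := by
    have := Valued.isOpen_ball (v.adicCompletion K)
      (1 : MonoidWithZeroHom.ValueGroup₀ (.ofClass (Valued.v (R := v.adicCompletion K))))
    simpa using this
  have hop : IsOpen {y : v.adicCompletion K | Valued.v (x - y) < 1} :=
    h1.preimage (continuous_const.sub continuous_id)
  obtain ⟨k, hk⟩ := (v.denseRange_algebraMap K).exists_mem_open hop ⟨x, by simp⟩
  have hk' : Valued.v (x - algebraMap K (v.adicCompletion K) k) < 1 := hk
  have hkv : Valued.v (algebraMap K (v.adicCompletion K) k) = v.valuation K k :=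
    HeightOneSpectrum.valuedAdicCompletion_eq_valuation' v k
  have hk1 : v.valuation K k ≤ 1 := by
    rw [← hkv]
    have h2 := Valuation.map_sub Valued.v x (x - algebraMap K (v.adicCompletion K) k)
    rw [sub_sub_cancel] at h2
    exact h2.trans (max_le hx hk'.le)
  obtain ⟨r, hr⟩ := v.exists_valuation_sub_lt_of_integer hk1 1
  refine ⟨r, ?_⟩
  have hr' : Valued.v (algebraMap K (v.adicCompletion K) (k - algebraMap (𝓞 K) K r)) < 1 := by
    have h3 : Valued.v (algebraMap K (v.adicCompletion K) (k - algebraMap (𝓞 K) K r)) =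
      v.valuation K (k - algebraMap (𝓞 K) K r) :=
      HeightOneSpectrum.valuedAdicCompletion_eq_valuation' v _
    rw [h3, Valuation.map_sub_swap]
    simpa using hr
  have h4 : x - algebraMap K (v.adicCompletion K) (algebraMap (𝓞 K) K r) =
      (x - algebraMap K (v.adicCompletion K) k) +
        algebraMap K (v.adicCompletion K) (k - algebraMap (𝓞 K) K r) := by
    rw [map_sub]; ring
  rw [h4]
  exact (Valuation.map_add _ _ _).trans_lt (max_lt hk' hr')

theorem finite_residueField :
    Finite (IsLocalRing.ResidueField (v.adicCompletionIntegers K)) := by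
  let f : 𝓞 K →+* IsLocalRing.ResidueField (v.adicCompletionIntegers K) :=
    (IsLocalRing.residue _).comp (algebraMap (𝓞 K) (v.adicCompletionIntegers K))
  have hmem : ∀ a : v.adicCompletionIntegers K,
      IsLocalRing.residue _ a = 0 ↔ Valued.v (a : v.adicCompletion K) < 1 := fun a => by
    rw [IsLocalRing.residue_eq_zero_iff]
    exact Valuation.mem_maximalIdeal_iff (v := (Valued.v : Valuation (v.adicCompletion K) _))
  have hker : ∀ a ∈ v.asIdeal, f a = 0 := fun a ha => by
    refine (hmem _).2 ?_
    have : Valued.v ((algebraMap (𝓞 K) (v.adicCompletionIntegers K) a :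
        v.adicCompletionIntegers K) : v.adicCompletion K) = v.valuation K (algebraMap (𝓞 K) K a) :=
      HeightOneSpectrum.valuedAdicCompletion_eq_valuation' v _
    rw [this]
    exact (v.valuation_lt_one_iff_mem a).2 ha
  have : Finite (𝓞 K ⧸ v.asIdeal) := v.asIdeal.finiteQuotientOfFreeOfNeBot v.ne_bot
  refine Finite.of_surjective (Ideal.Quotient.lift v.asIdeal f hker) fun y => ?_
  obtain ⟨x, rfl⟩ := IsLocalRing.residue_surjective y
  obtain ⟨r, hr⟩ := exists_integer_sub_lt_one v x.1 x.2
  refine ⟨Ideal.Quotient.mk _ r, ?_⟩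
  rw [Ideal.Quotient.lift_mk, eq_comm, ← sub_eq_zero]
  change IsLocalRing.residue _ x - IsLocalRing.residue _ _ = 0
  rw [← map_sub]
  exact (hmem _).2 hr

theorem isCompact_integers :
    IsCompact (v.adicCompletionIntegers K : Set (v.adicCompletion K)) := by
  rw [isCompact_iff_compactSpace]
  have h1 : CompleteSpace (Valued.integer (v.adicCompletion K)) :=
    (Valued.isClosed_integer (v.adicCompletion K)).completeSpace_coe
  have h2 : IsDiscreteValuationRing (Valued.integer (v.adicCompletion K)) :=
    inferInstanceAs (IsDiscreteValuationRing (v.adicCompletionIntegers K))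
  have h3 := finite_residueField v
  exact Valued.integer.compactSpace_iff_completeSpace_and_isDiscreteValuationRing_and_finite_residueField.2
    ⟨h1, h2, h3⟩

theorem isOpen_integers :
    IsOpen (v.adicCompletionIntegers K : Set (v.adicCompletion K)) :=
  Valued.isOpen_valuationSubring (v.adicCompletion K)

end Compactness

/-- The Haar measure on `k_𝔭`, normalised so that `𝔬_𝔭` has measure `1`. -/
def padicHaar (v : HeightOneSpectrum (𝓞 K)) : Measure (v.adicCompletion K) :=
  Measure.addHaarMeasure
    { carrier := (v.adicCompletionIntegers K : Set (v.adicCompletion K))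
      isCompact' := isCompact_integers v
      interior_nonempty' := by
        rw [(isOpen_integers v).interior_eq]
        exact ⟨0, zero_mem _⟩ }

/-- The product measure `μ_ν` on `k_ν^(n+1)`, for an archimedean place `ν`. -/
def archMeasure (n : ℕ) (v : InfinitePlace K) : Measure (Fin (n + 1) → v.Completion) :=
  Measure.pi fun _ => archHaar K v

/-- The product measure `μ_𝔭` on `k_𝔭^(n+1)`. -/
def padicMeasure (n : ℕ) (v : HeightOneSpectrum (𝓞 K)) :
    Measure (Fin (n + 1) → v.adicCompletion K) :=
  Measure.pi fun _ => padicHaar K v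

/-! ### Heights and local densities -/

variable {K} {n : ℕ}

/-- The local height `H_ν(x) = max_i ‖x_i‖_ν` at an archimedean place, where `‖·‖_ν` is the usual
absolute value if `ν` is real and its square if `ν` is complex. -/
def archHeight (v : InfinitePlace K) (x : Fin (n + 1) → v.Completion) : ℝ :=
  ⨆ i, ‖x i‖ ^ v.mult

/-- The density of `Ω ⊆ ℙⁿ(k_ν)` at an archimedean place `ν`. -/
def archDensity (v : InfinitePlace K) (Ω : Set (PSpace v.Completion n)) : ℝ :=
  (archMeasure K n v).real {x | x ∈ affineCone Ω ∧ archHeight v x ≤ 1} /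
    (archMeasure K n v).real {x | archHeight v x ≤ 1}

/-- The density of `Ω ⊆ ℙⁿ(k_𝔭)`: the measure of the set of integral points of its affine cone. -/
def padicDensity (v : HeightOneSpectrum (𝓞 K)) (Ω : Set (PSpace (v.adicCompletion K) n)) : ℝ :=
  (padicMeasure K n v).real
    {x | x ∈ affineCone Ω ∧ ∀ i, x i ∈ v.adicCompletionIntegers K}

/-- The set of `x ∈ ℙⁿ(k)` of height `H(x) ≤ B`, where `H` is the exponential height relative to
`k` (the product of the local heights `max_i ‖x_i‖_ν` over all places `ν` of `k`). -/
def boundedHeight (K : Type*) [Field K] [NumberField K] (n : ℕ) (B : ℝ) : Set (PSpace K n) :=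
  {x | Projectivization.mulHeight x ≤ B}

/-- The set of `x ∈ ℙⁿ(k)` of height `H(x) ≤ B` whose image in `ℙⁿ(k_ν)` lies in `Ω_ν` for every
place `ν` of `k`. -/
def sievedPoints (Ωinf : ∀ v : InfinitePlace K, Set (PSpace v.Completion n))
    (Ωfin : ∀ v : HeightOneSpectrum (𝓞 K), Set (PSpace (v.adicCompletion K) n)) (B : ℝ) :
    Set (PSpace K n) :=
  {x | x ∈ boundedHeight K n B ∧
    (∀ v : InfinitePlace K, toPSpace v.Completion x ∈ Ωinf v) ∧
    ∀ v : HeightOneSpectrum (𝓞 K), toPSpace (v.adicCompletion K) x ∈ Ωfin v}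

/-! ### The tail condition -/

/-- The set of `x ∈ 𝔬^(n+1)` which lie in `B Ψ ⊆ k_∞^(n+1)` and for which there is a prime `𝔭` of
norm greater than `M` such that `x` is not in the affine cone of `Ω_𝔭`. Here `k_∞` is
`ℝ^(r₁) × ℂ^(r₂)`, in which `k` is embedded through its real and complex places. -/
def tailPoints (Ωfin : ∀ v : HeightOneSpectrum (𝓞 K), Set (PSpace (v.adicCompletion K) n))
    (Ψ : Set (Fin (n + 1) → mixedEmbedding.mixedSpace K)) (M : ℕ) (B : ℝ) :
    Set (Fin (n + 1) → 𝓞 K) :=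
  {x | (fun i => mixedEmbedding K (x i : K)) ∈ B • Ψ ∧
    ∃ v : HeightOneSpectrum (𝓞 K), M < Ideal.absNorm v.asIdeal ∧
      (fun i => algebraMap K (v.adicCompletion K) (x i : K)) ∉ affineCone (Ωfin v)}

open scoped Classical in
/-- The tail condition: for every bounded subset `Ψ` of `k_∞^(n+1)` of positive measure whose
boundary has measure zero, the upper density of the set of `x ∈ 𝔬^(n+1) ∩ B Ψ` that fail the
condition at some prime of norm `> M` tends to `0` as `M → ∞`. -/
def TailCondition
    (Ωfin : ∀ v : HeightOneSpectrum (𝓞 K), Set (PSpace (v.adicCompletion K) n)) : Prop :=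
  ∀ Ψ : Set (Fin (n + 1) → mixedEmbedding.mixedSpace K),
    Bornology.IsBounded Ψ → 0 < volume Ψ → volume (frontier Ψ) = 0 →
      Tendsto
        (fun M : ℕ => limsup
          (fun B : ℝ => ((tailPoints Ωfin Ψ M B).encard : ℝ≥0∞) /
            ENNReal.ofReal (B ^ (Module.finrank ℚ K * (n + 1)))) atTop)
        atTop (𝓝 0)

end EkedahlSieve

end

/-! For `n > 0`, write a point of `ℙⁿ(k)` as an integral vector whose coordinates generate an
integral ideal `J` fixed once for each ideal class; such a vector is unique up to units. By the
product formula the archimedean part of its height is `H(x) · N J`. Restricting its vector of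
archimedean norms to a fundamental cone for the units leaves one vector for each root of unity.
Counting points of height at most `B` thus becomes, class by class, counting integral vectors in a
dilate `T • Φ` of a bounded region, where `T ^ d = B · N J`. At every prime there is one local
condition: the vector lies in the given cone and generates exactly the local part of `J`.

This count is a sieve. For finitely many primes, the integral vectors are jointly equidistributed in
the rescaled `k_∞^(n+1)` and in the product of the `𝔬_𝔭^(n+1)` (`IsDenseEmbedding.tendsto_ncard`). A
small tail lets the set of primes grow to all of them (`tendsto_ncard_infinite`), and it also keeps
the infinite product away from zero (`tprod_padicMeasure_pos`). The cones have a small tail by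
hypothesis. The condition of generating `J` has one because `∑ N𝔭^(-(n+1))` converges for `n > 0`
(`exists_primitive_tail_le`).

The local densities split off by homogeneity. At a prime, scaling by a uniformizer shows that the
cone occupies the same proportion of every shell (`padicMeasure_real_primitiveCone`). At infinity,
the region without the cones depends only on the norms, and a cone occupies the same proportion of
every ball (`volume_real_archRegion`). Hence every class acquires the same factor, the asserted
product. Taking all the sets to be the whole space gives the denominator, with the same constant
`heightConst`, which cancels. For `n = 0` projective space is a single point and the limit is
immediate. -/

noncomputable section
namespace EkedahlSieve

/-! ### Counting the points of a tiling in a dilated region -/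

section TileCount

open Module

theorem segment_inter_frontier_nonempty {E : Type*} [NormedAddCommGroup E] [NormedSpace ℝ E]
    {s : Set E} {x y : E} (hx : x ∈ s) (hy : y ∉ s) : (segment ℝ x y ∩ frontier s).Nonempty := by
  by_contra h
  rw [not_nonempty_iff_eq_empty] at h
  have hpre : IsPreconnected (segment ℝ x y) := (convex_segment x y).isPreconnected
  have hsub : segment ℝ x y ⊆ interior s ∪ interior sᶜ := fun z hz => by
    have hzf : z ∉ frontier s := fun hzf =>
      (h.subset ⟨hz, hzf⟩ : z ∈ (∅ : Set E))
    rw [frontier_eq_closure_inter_closure, mem_inter_iff, not_and_or] at hzf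
    rw [interior_compl, mem_union, mem_compl_iff]
    rcases hzf with hzf | hzf
    · exact Or.inr hzf
    · left
      rwa [closure_compl, notMem_compl_iff] at hzf
  have hxi : x ∈ interior s := by
    rcases hsub (left_mem_segment ℝ x y) with h1 | h1
    · exact h1
    · exact absurd hx (interior_subset h1)
  have := hpre.subset_left_of_subset_union isOpen_interior isOpen_interior
    (disjoint_compl_right.mono interior_subset interior_subset) hsub
    ⟨x, left_mem_segment ℝ x y, hxi⟩
  exact hy (interior_subset (this (right_mem_segment ℝ x y)))

/-- The segment from `x` to `y` must cross the frontier, by connectedness, at a point no farther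
from `x` than `y` is. This confines all counting errors to a neighbourhood of the boundary. -/
theorem mem_cthickening_frontier {E : Type*} [NormedAddCommGroup E] [NormedSpace ℝ E]
    {s : Set E} {x y : E} {r : ℝ} (hxy : dist x y ≤ r) (h : (x ∈ s ∧ y ∉ s) ∨ (x ∉ s ∧ y ∈ s)) :
    x ∈ Metric.cthickening r (frontier s) := by
  have : (segment ℝ x y ∩ frontier s).Nonempty := by
    rcases h with ⟨hx, hy⟩ | ⟨hx, hy⟩
    · exact segment_inter_frontier_nonempty hx hy
    · rw [segment_symm]
      exact segment_inter_frontier_nonempty hy hx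
  obtain ⟨z, hz, hzf⟩ := this
  refine Metric.mem_cthickening_of_dist_le x z r _ hzf (le_trans ?_ hxy)
  rw [dist_comm x y]
  have := (convex_closedBall x (dist y x)).segment_subset
    (Metric.mem_closedBall_self dist_nonneg) (Metric.mem_closedBall.2 le_rfl) hz
  rwa [dist_comm]

variable {E : Type*} [NormedAddCommGroup E] [NormedSpace ℝ E] [FiniteDimensional ℝ E]
  [MeasurableSpace E] [BorelSpace E] (μ : Measure E) [μ.IsAddHaarMeasure]

/-- A family of points `p i` with tiles `D i` of bounded size that tile the space. -/
structure IsTiling {ι : Type*} (p : ι → E) (D : ι → Set E) (R : ℝ) (c : ℝ≥0∞) : Prop where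
  measurable : ∀ i, MeasurableSet (D i)
  disjoint : Pairwise (Function.onFun Disjoint D)
  cover : ∀ x, ∃ i, x ∈ D i
  dist_le : ∀ i, ∀ x ∈ D i, dist x (p i) ≤ R
  measure_eq : ∀ i, μ (D i) = c
  ne_zero : c ≠ 0
  ne_top : c ≠ ∞

variable {μ} {ι : Type*} [Countable ι] {p : ι → E} {D : ι → Set E} {R : ℝ} {c : ℝ≥0∞}
  {Ψ : Set E}

theorem IsTiling.measure_iUnion (h : IsTiling μ p D R c) {T : ℝ} (hT : 0 < T) (N : Set ι) :
    μ (⋃ i ∈ N, T⁻¹ • D i) =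
      (N.encard : ℝ≥0∞) * (c * ENNReal.ofReal (T⁻¹ ^ finrank ℝ E)) := by
  rw [measure_biUnion N.to_countable]
  · have : ∀ i : N, μ (T⁻¹ • D i) = c * ENNReal.ofReal (T⁻¹ ^ finrank ℝ E) := fun i => by
      rw [Measure.addHaar_smul_of_nonneg _ (by positivity), h.measure_eq, mul_comm]
    simp_rw [this]
    rw [ENNReal.tsum_const]
    rfl
  · intro i _ j _ hij
    have := h.disjoint hij
    change Disjoint (D i) (D j) at this
    change Disjoint (T⁻¹ • D i) (T⁻¹ • D j)
    exact (Set.disjoint_image_iff (smul_right_injective E (inv_ne_zero hT.ne'))).2 this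
  · exact fun i _ => (h.measurable i).const_smul₀ _

/-- The tiles of the points in question are disjoint, have equal positive measure and lie in one
bounded set, so there cannot be infinitely many. -/
theorem IsTiling.finite (h : IsTiling μ p D R c) (hΨ : Bornology.IsBounded Ψ) {T : ℝ} :
    {i | p i ∈ T • Ψ}.Finite := by
  have hb : Bornology.IsBounded (Metric.cthickening R (T • Ψ)) := (hΨ.smul₀ T).cthickening
  have h1 : μ (⋃ i ∈ {i | p i ∈ T • Ψ}, (1 : ℝ)⁻¹ • D i) < ∞ := by
    refine (measure_mono ?_).trans_lt hb.measure_lt_top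
    simp only [inv_one, one_smul]
    refine iUnion₂_subset fun i hi x hx => ?_
    exact Metric.mem_cthickening_of_dist_le x (p i) R _ hi (h.dist_le i x hx)
  rw [h.measure_iUnion one_pos] at h1
  simp only [inv_one, one_pow, ENNReal.ofReal_one, mul_one] at h1
  by_contra hinf
  rw [Set.not_finite] at hinf
  rw [hinf.encard_eq, ENat.toENNReal_top, ENNReal.top_mul h.ne_zero] at h1
  exact lt_irrefl _ h1

/-- The number of points of a tiling in `T • Ψ` is asymptotic to the volume. -/
theorem IsTiling.tendsto_ncard (h : IsTiling μ p D R c) (hΨ : Bornology.IsBounded Ψ)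
    (hΨ' : μ (frontier Ψ) = 0) :
    Tendsto (fun T : ℝ => ({i | p i ∈ T • Ψ}.ncard : ℝ) / T ^ finrank ℝ E) atTop
      (𝓝 (μ.real Ψ / c.toReal)) := by
  have hc : 0 < c.toReal := ENNReal.toReal_pos h.ne_zero h.ne_top
  -- After scaling by `T⁻¹` each tile lies within `R / T` of its point. The union of the tiles whose
  -- points lie in `T • Ψ` therefore differs from `Ψ` only inside `F T`, and the measure of `F T`
  -- tends to that of the closed null set `frontier Ψ`.
  set F : ℝ → Set E := fun T => Metric.cthickening (R / T) (frontier Ψ) with hF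
  have hbF : ∀ T, Bornology.IsBounded (F T) := fun T =>
    (hΨ.closure.subset frontier_subset_closure).cthickening
  have hlim : Tendsto (fun T => μ.real (F T)) atTop (𝓝 0) := by
    have h1 : Tendsto (fun r => μ (Metric.cthickening r (frontier Ψ))) (𝓝 0) (𝓝 0) := by
      rw [← hΨ']
      exact tendsto_measure_cthickening_of_isClosed
        ⟨1, one_pos, ((hΨ.closure.subset frontier_subset_closure).cthickening).measure_lt_top.ne⟩
        isClosed_frontier
    have h2 : Tendsto (fun T : ℝ => R / T) atTop (𝓝 0) := tendsto_const_nhds.div_atTop tendsto_id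
    have h3 := h1.comp h2
    have := (ENNReal.tendsto_toReal ENNReal.zero_ne_top).comp h3
    rwa [ENNReal.toReal_zero] at this
  have key : ∀ᶠ T : ℝ in atTop,
      |({i | p i ∈ T • Ψ}.ncard : ℝ) / T ^ finrank ℝ E - μ.real Ψ / c.toReal| ≤
        μ.real (F T) / c.toReal := by
    filter_upwards [eventually_gt_atTop 0] with T hT
    set N := {i | p i ∈ T • Ψ}
    have hN : N.Finite := h.finite hΨ
    set S := ⋃ i ∈ N, T⁻¹ • D i with hS
    have hmem : ∀ i, p i ∈ T • Ψ ↔ T⁻¹ • p i ∈ Ψ := fun i => mem_smul_set_iff_inv_smul_mem₀ hT.ne' _ _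
    have hdist : ∀ i, ∀ y ∈ D i, dist (T⁻¹ • y) (T⁻¹ • p i) ≤ R / T := fun i y hy => by
      rw [dist_smul₀, norm_inv, Real.norm_of_nonneg hT.le, inv_mul_eq_div]
      gcongr
      exact h.dist_le i y hy
    have hsub1 : S ⊆ Ψ ∪ F T := by
      refine iUnion₂_subset fun i hi => ?_
      rintro _ ⟨y, hy, rfl⟩
      by_cases hyΨ : T⁻¹ • y ∈ Ψ
      · exact Or.inl hyΨ
      · exact Or.inr (mem_cthickening_frontier (hdist i y hy) (Or.inr ⟨hyΨ, (hmem i).1 hi⟩))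
    have hsub2 : Ψ ⊆ S ∪ F T := fun x hx => by
      obtain ⟨i, hi⟩ := h.cover (T • x)
      have hd := hdist i _ hi
      rw [inv_smul_smul₀ hT.ne'] at hd
      by_cases hiΨ : p i ∈ T • Ψ
      · exact Or.inl (mem_biUnion hiΨ ((mem_inv_smul_set_iff₀ hT.ne' _ _).2 hi))
      · exact Or.inr (mem_cthickening_frontier hd (Or.inl ⟨hx, fun h' => hiΨ ((hmem i).2 h')⟩))
    have hSr : μ.real S = (N.ncard : ℝ) / T ^ finrank ℝ E * c.toReal := by
      rw [Measure.real, hS, h.measure_iUnion hT, ENNReal.toReal_mul, ENNReal.toReal_mul,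
        ENNReal.toReal_ofReal (by positivity), ← hN.cast_ncard_eq]
      simp
      field_simp
    have hSfin : μ S ≠ ∞ := ((measure_mono hsub1).trans_lt
      (hΨ.union (hbF T)).measure_lt_top).ne
    have e1 : μ.real S ≤ μ.real Ψ + μ.real (F T) :=
      (measureReal_mono hsub1 (hΨ.union (hbF T)).measure_lt_top.ne).trans (measureReal_union_le _ _)
    have e2 : μ.real Ψ ≤ μ.real S + μ.real (F T) :=
      (measureReal_mono hsub2 (measure_union_lt_top hSfin.lt_top (hbF T).measure_lt_top).ne).trans
        (measureReal_union_le _ _)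
    rw [hSr] at e1 e2
    rw [abs_le]
    constructor
    · rw [neg_le_sub_iff_le_add, div_le_iff₀ hc, add_mul, div_mul_cancel₀ _ hc.ne']
      exact e2
    · rw [sub_le_iff_le_add, ← add_div, le_div_iff₀ hc]
      linarith
  rw [← tendsto_sub_nhds_zero_iff]
  refine squeeze_zero_norm' key ?_
  simpa using hlim.div_const c.toReal

end TileCount

end EkedahlSieve
end

noncomputable section
namespace EkedahlSieve

/-! ### Joint equidistribution of a lattice at infinity and in a profinite-type group -/

section Density

set_option linter.unusedSectionVars false

open Module

variable {E : Type*} [NormedAddCommGroup E] [NormedSpace ℝ E] [FiniteDimensional ℝ E]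
  [MeasurableSpace E] [BorelSpace E] {μ : Measure E} [μ.IsAddHaarMeasure]
  {A : Type*} [AddCommGroup A] [Countable A]

variable (μ) in
/-- `D` is a bounded fundamental domain for the translations by `j a`, `a : A`. -/
structure IsFundamentalTile (j : A →+ E) (D : Set E) : Prop where
  measurable : MeasurableSet D
  existsUnique : ∀ x, ∃! a, x - j a ∈ D
  bounded : Bornology.IsBounded D
  ne_zero : μ D ≠ 0

variable {j : A →+ E} {D : Set E} {Ψ : Set E}

/-- Gluing the translates of `D` by coset representatives of `L` gives a fundamental domain for `L`.
Its translates by the elements of a single coset tile the space, so that coset has density `1 / [A :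
L]` times that of `A`. -/
theorem IsFundamentalTile.isTiling_coset (h : IsFundamentalTile μ j D) (L : AddSubgroup A)
    [Finite (A ⧸ L)] (a₀ : A) :
    ∃ R, IsTiling μ (fun a : {a : A // a - a₀ ∈ L} => j a)
      (fun a => ⋃ q : A ⧸ L, {x | x - j (a + q.out) ∈ D}) R (Nat.card (A ⧸ L) * μ D) := by
  obtain ⟨R, hR⟩ := h.bounded.exists_norm_le
  have := Fintype.ofFinite (A ⧸ L)
  have hpiece : ∀ b : A, MeasurableSet {x : E | x - j b ∈ D} := fun b =>
    h.measurable.preimage (measurable_id.sub_const _)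
  have hvol : ∀ b : A, μ {x : E | x - j b ∈ D} = μ D := fun b => by
    have := measure_preimage_add_right μ (-j b) D
    simp only [sub_eq_add_neg]
    exact this
  have hdisj : ∀ b c : A, b ≠ c → Disjoint {x : E | x - j b ∈ D} {x : E | x - j c ∈ D} := by
    intro b c hbc
    rw [Set.disjoint_left]
    exact fun x hb hc => hbc ((h.existsUnique x).unique hb hc)
  have hinj : ∀ (a b : {a : A // a - a₀ ∈ L}) (q r : A ⧸ L),
      (a : A) + q.out = b + r.out → a = b ∧ q = r := by
    intro a b q r hab
    have hq : q = r := by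
      have e : (q.out : A) - r.out = b - a := by
        rw [sub_eq_sub_iff_add_eq_add, add_comm, hab]
      have : (b : A) - a ∈ L := by
        have := L.sub_mem b.2 a.2
        rwa [sub_sub_sub_cancel_right] at this
      rw [← e] at this
      rw [← q.out_eq', ← r.out_eq', eq_comm]
      refine QuotientAddGroup.eq.2 ?_
      rwa [neg_add_eq_sub]
    refine ⟨?_, hq⟩
    subst hq
    exact Subtype.ext (add_right_cancel hab)
  -- The sum over all representatives is a crude bound for the displacement of any one of the glued
  -- copies of `D`.
  refine ⟨R + ∑ q : A ⧸ L, ‖j q.out‖, ?_, ?_, ?_, ?_, ?_, ?_, ?_⟩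
  · exact fun a => MeasurableSet.iUnion fun q => hpiece _
  · intro a b hab
    simp only [Function.onFun, disjoint_iUnion_left, disjoint_iUnion_right]
    exact fun q r => hdisj _ _ fun e => hab (hinj _ _ _ _ e).1
  · intro x
    obtain ⟨b, hb, -⟩ := h.existsUnique x
    -- With this choice `b - q.out` is congruent to `a₀` modulo `L`, so it indexes a tile, and the
    -- piece of that tile attached to `q` is the translate of `D` by `j b`.
    set q : A ⧸ L := ((b - a₀ : A) : A ⧸ L) with hq
    refine ⟨⟨b - q.out, ?_⟩, mem_iUnion.2 ⟨q, ?_⟩⟩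
    · have : -q.out + (b - a₀) ∈ L := QuotientAddGroup.eq.1 (by rw [QuotientAddGroup.out_eq'])
      convert this using 1
      abel
    · simpa using hb
  · intro a x hx
    obtain ⟨q, hq⟩ := mem_iUnion.1 hx
    rw [dist_eq_norm]
    have e : x - j a = (x - j (a + q.out)) + j q.out := by rw [map_add]; abel
    rw [e]
    exact (norm_add_le _ _).trans (add_le_add (hR _ hq)
      (Finset.single_le_sum (f := fun q : A ⧸ L => ‖j q.out‖) (fun _ _ => norm_nonneg _)
        (Finset.mem_univ q)))
  · intro a
    rw [measure_iUnion (fun q r hqr => hdisj _ _ fun e => hqr (hinj _ _ _ _ e).2) fun _ => hpiece _]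
    simp_rw [hvol, tsum_fintype, Finset.sum_const, Finset.card_univ, nsmul_eq_mul,
      Nat.card_eq_fintype_card]
  · exact mul_ne_zero (by simp) h.ne_zero
  · exact ENNReal.mul_ne_top (by simp) h.bounded.measure_lt_top.ne

theorem IsFundamentalTile.finite (h : IsFundamentalTile μ j D) (hΨ : Bornology.IsBounded Ψ) (T : ℝ) :
    {a | j a ∈ T • Ψ}.Finite := by
  have : Subsingleton (A ⧸ (⊤ : AddSubgroup A)) := QuotientAddGroup.subsingleton_quotient_top
  have : Finite (A ⧸ (⊤ : AddSubgroup A)) := inferInstance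
  obtain ⟨R, hR⟩ := h.isTiling_coset ⊤ 0
  have := (hR.finite hΨ (T := T)).image Subtype.val
  refine this.subset fun a ha => ⟨⟨a, trivial⟩, ha, rfl⟩

theorem IsFundamentalTile.tendsto_coset (h : IsFundamentalTile μ j D) (hΨ : Bornology.IsBounded Ψ)
    (hΨ' : μ (frontier Ψ) = 0) (L : AddSubgroup A) [Finite (A ⧸ L)] (a₀ : A) :
    Tendsto (fun T : ℝ => ({a | a - a₀ ∈ L ∧ j a ∈ T • Ψ}.ncard : ℝ) / T ^ finrank ℝ E) atTop
      (𝓝 (μ.real Ψ / μ.real D / Nat.card (A ⧸ L))) := by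
  obtain ⟨R, hR⟩ := h.isTiling_coset L a₀
  have := hR.tendsto_ncard hΨ hΨ'
  rw [ENNReal.toReal_mul, ENNReal.toReal_natCast, mul_comm, ← div_div] at this
  refine this.congr fun T => ?_
  rw [← Set.ncard_image_of_injective _ Subtype.val_injective]
  congr 3
  ext a
  simp [and_comm]

theorem IsFundamentalTile.tendsto (h : IsFundamentalTile μ j D) (hΨ : Bornology.IsBounded Ψ)
    (hΨ' : μ (frontier Ψ) = 0) :
    Tendsto (fun T : ℝ => ({a | j a ∈ T • Ψ}.ncard : ℝ) / T ^ finrank ℝ E) atTop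
      (𝓝 (μ.real Ψ / μ.real D)) := by
  have : Subsingleton (A ⧸ (⊤ : AddSubgroup A)) := QuotientAddGroup.subsingleton_quotient_top
  have : Finite (A ⧸ (⊤ : AddSubgroup A)) := inferInstance
  have := h.tendsto_coset hΨ hΨ' ⊤ 0
  simpa using this

/-- A homomorphism with dense image into an open subgroup `G` of measure `1`, with a countable
basis of neighbourhoods of zero consisting of open subgroups. -/
structure IsDenseEmbedding {X : Type*} [AddCommGroup X] [TopologicalSpace X] [MeasurableSpace X]
    (ν : Measure X) (i : A →+ X) (G : AddSubgroup X) (V : ℕ → AddSubgroup X) : Prop where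
  isOpen : IsOpen (G : Set X)
  measure_eq : ν G = 1
  antitone : Antitone V
  le : ∀ m, V m ≤ G
  isOpen_basis : ∀ m, IsOpen (V m : Set X)
  basis : ∀ U ∈ 𝓝 (0 : X), ∃ m, (V m : Set X) ⊆ U
  mem : ∀ a, i a ∈ G
  dense : ∀ g ∈ G, ∀ m, ∃ a, i a - g ∈ V m

variable {X : Type*} [AddCommGroup X] [TopologicalSpace X] [IsTopologicalAddGroup X]
  [MeasurableSpace X] [BorelSpace X] {ν : Measure X} [ν.IsAddLeftInvariant] [ν.IsOpenPosMeasure]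
  {i : A →+ X} {G : AddSubgroup X} {V : ℕ → AddSubgroup X}

namespace IsDenseEmbedding

theorem exists_mem_cell (hi : IsDenseEmbedding ν i G V) (m : ℕ) {x : X} (hx : x ∈ G) :
    ∃ q : A ⧸ (V m).comap i, x - i q.out ∈ V m := by
  obtain ⟨a, ha⟩ := hi.dense x hx m
  refine ⟨(a : A ⧸ (V m).comap i), ?_⟩
  have h1 : -(a : A ⧸ (V m).comap i).out + a ∈ (V m).comap i :=
    QuotientAddGroup.eq.1 (by rw [QuotientAddGroup.out_eq'])
  rw [AddSubgroup.mem_comap, map_add, map_neg] at h1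
  have := (V m).sub_mem h1 ha
  convert this using 1
  abel

theorem cell_unique (m : ℕ) {x : X} {q r : A ⧸ (V m).comap i}
    (hq : x - i q.out ∈ V m) (hr : x - i r.out ∈ V m) : q = r := by
  rw [← q.out_eq', ← r.out_eq']
  refine QuotientAddGroup.eq.2 ?_
  rw [AddSubgroup.mem_comap, map_add, map_neg]
  have := (V m).sub_mem hq hr
  convert this using 1
  abel

theorem measure_cell (m : ℕ) (g : X) : ν {x | x - g ∈ V m} = ν (V m) := by
  have := measure_preimage_add ν (-g) (V m : Set X)
  simp only [neg_add_eq_sub] at this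
  exact this

theorem measurableSet_cell (hi : IsDenseEmbedding ν i G V) (m : ℕ) (g : X) :
    MeasurableSet {x | x - g ∈ V m} :=
  ((hi.isOpen_basis m).preimage (continuous_id.sub continuous_const)).measurableSet

/-- `G`, of measure `1`, is the disjoint union of the translates of `V m` indexed by the quotient.
These have equal positive measure, so the index is finite and is the inverse of that measure. -/
theorem finite_quotient_and_card (hi : IsDenseEmbedding ν i G V) (m : ℕ) :
    Finite (A ⧸ (V m).comap i) ∧ (Nat.card (A ⧸ (V m).comap i) : ℝ≥0∞) * ν (V m) = 1 := by
  have hG : (G : Set X) = ⋃ q : A ⧸ (V m).comap i, {x | x - i q.out ∈ V m} := by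
    ext x
    simp only [mem_iUnion]
    refine ⟨fun hx => hi.exists_mem_cell m hx, fun ⟨q, hq⟩ => ?_⟩
    have := G.add_mem (hi.le m hq) (hi.mem q.out)
    rwa [sub_add_cancel] at this
  have hpos : ν (V m : Set X) ≠ 0 :=
    ((hi.isOpen_basis m).measure_pos ν ⟨0, (V m).zero_mem⟩).ne'
  have hcount : Countable (A ⧸ (V m).comap i) := Quotient.countable
  have h1 := hi.measure_eq
  have hdisj : Pairwise (Function.onFun Disjoint fun q : A ⧸ (V m).comap i =>
      {x | x - i q.out ∈ V m}) := fun q r hqr =>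
    Set.disjoint_left.2 fun x hq hr => hqr (cell_unique m hq hr)
  rw [hG, measure_iUnion hdisj fun q => hi.measurableSet_cell m _] at h1
  simp_rw [measure_cell] at h1
  rw [ENNReal.tsum_const] at h1
  have hfin : Finite (A ⧸ (V m).comap i) := by
    by_contra hinf
    rw [not_finite_iff_infinite] at hinf
    rw [ENat.card_eq_top_of_infinite, ENat.toENNReal_top, ENNReal.top_mul hpos] at h1
    exact ENNReal.top_ne_one h1
  refine ⟨hfin, ?_⟩
  rwa [ENat.card_eq_coe_natCard, ENat.toENNReal_coe] at h1

/-- An open set is exhausted from within by finite unions of cosets of `V m`. The elements of `A`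
mapping into one such coset form a coset of a subgroup of finite index, whose density is known.
Bounds from below suffice: upper bounds come from passing to the complement. -/
theorem eventually_lower_bound (hi : IsDenseEmbedding ν i G V) (h : IsFundamentalTile μ j D)
    (hΨ : Bornology.IsBounded Ψ) (hΨ' : μ (frontier Ψ) = 0) {U : Set X} (hU : IsOpen U)
    (hUG : U ⊆ G) {ε : ℝ} (hε : 0 < ε) :
    ∀ᶠ T : ℝ in atTop, μ.real Ψ / μ.real D * ν.real U - ε ≤
      ({a | i a ∈ U ∧ j a ∈ T • Ψ}.ncard : ℝ) / T ^ finrank ℝ E := by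
  classical
  set κ := μ.real Ψ / μ.real D with hκ
  have hκ0 : 0 ≤ κ := by positivity
  -- The union of the cosets of `V m` contained in `U`. It increases to `U`, because `U` is open and
  -- the `V m` form a basis at zero.
  set W : ℕ → Set X := fun m => {x | ∀ y, y - x ∈ V m → y ∈ U} with hW
  have hWmono : Monotone W := fun m m' hmm x hx y hy => hx y (hi.antitone hmm hy)
  have hWU : ∀ m, W m ⊆ U := fun m x hx => hx x (by rw [sub_self]; exact (V m).zero_mem)
  have hWunion : ⋃ m, W m = U := by
    refine Subset.antisymm (iUnion_subset hWU) fun x hx => ?_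
    have : (fun y => y + x) ⁻¹' U ∈ 𝓝 (0 : X) :=
      (hU.preimage (continuous_id.add continuous_const)).mem_nhds (by simpa using hx)
    obtain ⟨m, hm⟩ := hi.basis _ this
    refine mem_iUnion.2 ⟨m, fun y hy => ?_⟩
    simpa using hm hy
  have hUfin : ν U ≠ ∞ := ((measure_mono hUG).trans_lt (by rw [hi.measure_eq]; exact ENNReal.one_lt_top)).ne
  have hlim : Tendsto (fun m => κ * ν.real (W m)) atTop (𝓝 (κ * ν.real U)) := by
    have h1 := tendsto_measure_iUnion_atTop (μ := ν) hWmono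
    rw [hWunion] at h1
    exact ((ENNReal.tendsto_toReal hUfin).comp h1).const_mul κ
  obtain ⟨m, hm⟩ := ((tendsto_order.1 hlim).1 (κ * ν.real U - ε / 2) (by linarith)).exists
  obtain ⟨hfin, hcard⟩ := hi.finite_quotient_and_card m
  have := Fintype.ofFinite (A ⧸ (V m).comap i)
  set F : Finset (A ⧸ (V m).comap i) := Finset.univ.filter fun q => i q.out ∈ W m with hF
  have hVreal : ν.real (V m : Set X) = 1 / (Nat.card (A ⧸ (V m).comap i)) := by
    have := congrArg ENNReal.toReal hcard
    rw [ENNReal.toReal_mul, ENNReal.toReal_natCast, ENNReal.toReal_one] at this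
    rw [eq_div_iff (by simp), mul_comm]
    exact this
  have hWle : ν.real (W m) ≤ F.card * ν.real (V m : Set X) := by
    have hsub : W m ⊆ ⋃ q ∈ F, {x | x - i q.out ∈ V m} := fun x hx => by
      obtain ⟨q, hq⟩ := hi.exists_mem_cell m (hUG (hWU m hx))
      refine mem_biUnion (Finset.mem_filter.2 ⟨Finset.mem_univ q, fun y hy => hx y ?_⟩) hq
      have := (V m).sub_mem hy hq
      convert this using 1
      abel
    have hVfin : ν (V m : Set X) ≠ ∞ :=
      ((measure_mono (hi.le m)).trans_lt (by rw [hi.measure_eq]; exact ENNReal.one_lt_top)).ne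
    have h1 : ν (W m) ≤ ∑ q ∈ F, ν (V m : Set X) := by
      refine (measure_mono hsub).trans ((measure_biUnion_finset_le _ _).trans_eq ?_)
      simp_rw [measure_cell]
    rw [Finset.sum_const, nsmul_eq_mul] at h1
    have := ENNReal.toReal_mono (ENNReal.mul_ne_top (by simp) hVfin) h1
    rwa [ENNReal.toReal_mul, ENNReal.toReal_natCast] at this
  have hsum : Tendsto (fun T : ℝ => ∑ q ∈ F,
      ({a | a - q.out ∈ (V m).comap i ∧ j a ∈ T • Ψ}.ncard : ℝ) / T ^ finrank ℝ E) atTop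
      (𝓝 (∑ q ∈ F, κ / Nat.card (A ⧸ (V m).comap i))) :=
    tendsto_finsetSum _ fun q _ => h.tendsto_coset hΨ hΨ' _ _
  have hval : κ * ν.real U - ε < ∑ q ∈ F, κ / Nat.card (A ⧸ (V m).comap i) := by
    rw [Finset.sum_const, nsmul_eq_mul, ← mul_one_div κ, ← hVreal]
    have := mul_le_mul_of_nonneg_left hWle hκ0
    linarith
  filter_upwards [(tendsto_order.1 hsum).1 _ hval, eventually_gt_atTop 0] with T hT hT0
  refine hT.le.trans ?_
  rw [← Finset.sum_div]
  gcongr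
  have hdisj : (F : Set (A ⧸ (V m).comap i)).PairwiseDisjoint
      fun q => {a | a - q.out ∈ (V m).comap i ∧ j a ∈ T • Ψ} := by
    intro q _ r _ hqr
    refine Set.disjoint_left.2 fun a ha ha' => hqr ?_
    have h1 := ha.1
    have h2 := ha'.1
    rw [AddSubgroup.mem_comap, map_sub] at h1 h2
    exact cell_unique m h1 h2
  have hfinT := h.finite hΨ T
  rw [← Nat.cast_sum, Nat.cast_le]
  have hfinq : ∀ q ∈ F, {a | a - q.out ∈ (V m).comap i ∧ j a ∈ T • Ψ}.Finite :=
    fun q _ => hfinT.subset fun a ha => ha.2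
  have hcardU : (⋃ q ∈ F, {a | a - q.out ∈ (V m).comap i ∧ j a ∈ T • Ψ}).ncard =
      ∑ q ∈ F, {a | a - q.out ∈ (V m).comap i ∧ j a ∈ T • Ψ}.ncard := by
    have := F.finite_toSet.ncard_biUnion (fun q hq => hfinq q hq) hdisj
    rw [finsum_mem_coe_finset] at this
    exact this
  rw [← hcardU]
  refine Set.ncard_le_ncard (iUnion₂_subset fun q hq a ha => ⟨?_, ha.2⟩)
    (hfinT.subset fun a ha => ha.2)
  refine (Finset.mem_filter.1 hq).2 _ ?_
  have := ha.1
  rwa [AddSubgroup.mem_comap, map_sub] at this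

/-- Joint equidistribution of the images of `A` in `E` (after rescaling) and in `G`. -/
theorem tendsto_ncard (hi : IsDenseEmbedding ν i G V) (h : IsFundamentalTile μ j D)
    (hΨ : Bornology.IsBounded Ψ) (hΨ' : μ (frontier Ψ) = 0) {U : Set X}
    (hUG : U ⊆ G) (hU : ν (frontier U) = 0) :
    Tendsto (fun T : ℝ => ({a | i a ∈ U ∧ j a ∈ T • Ψ}.ncard : ℝ) / T ^ finrank ℝ E) atTop
      (𝓝 (μ.real Ψ / μ.real D * ν.real U)) := by
  set κ := μ.real Ψ / μ.real D with hκ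
  have hclosed : IsClosed (G : Set X) := G.isClosed_of_isOpen hi.isOpen
  have hGfin : ν (G : Set X) ≠ ∞ := by simp [hi.measure_eq]
  have hclG : closure U ⊆ G := closure_minimal hUG hclosed
  have hint : ν.real (interior U) = ν.real U := by
    refine measureReal_congr (interior_ae_eq_of_null_frontier hU)
  have hcl : ν.real (closure U) = ν.real U :=
    measureReal_congr (closure_ae_eq_of_null_frontier hU)
  have hcompl : ν.real (G \ closure U) = 1 - ν.real U := by
    rw [measureReal_sdiff hclG isClosed_closure.measurableSet hGfin, hcl, Measure.real, hi.measure_eq, ENNReal.toReal_one]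
  rw [tendsto_order]
  constructor
  · intro b hb
    have hε : 0 < (κ * ν.real U - b) / 2 := by linarith
    filter_upwards [hi.eventually_lower_bound h hΨ hΨ' isOpen_interior
      (interior_subset.trans hUG) hε, eventually_gt_atTop 0] with T hT hT0
    rw [hint] at hT
    refine lt_of_lt_of_le (by linarith : b < κ * ν.real U - (κ * ν.real U - b) / 2) (hT.trans ?_)
    gcongr
    · exact (h.finite hΨ T).subset fun a ha => ha.2
    · exact interior_subset
  · intro b hb
    -- The count over `U` is at most the total count minus the count over `G \ closure U`. Each of
    -- these two estimates may lose a third of the margin.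
    have hε : 0 < (b - κ * ν.real U) / 3 := by linarith
    filter_upwards [hi.eventually_lower_bound h hΨ hΨ' (hi.isOpen.sdiff isClosed_closure)
      sdiff_subset hε, (tendsto_order.1 (h.tendsto hΨ hΨ')).2 (κ + (b - κ * ν.real U) / 3)
      (by linarith), eventually_gt_atTop 0] with T hT hT' hT0
    rw [hcompl] at hT
    have hfin := h.finite hΨ T
    have hle : ({a | i a ∈ U ∧ j a ∈ T • Ψ}.ncard : ℝ) / T ^ finrank ℝ E +
        ({a | i a ∈ (G : Set X) \ closure U ∧ j a ∈ T • Ψ}.ncard : ℝ) / T ^ finrank ℝ E ≤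
        ({a | j a ∈ T • Ψ}.ncard : ℝ) / T ^ finrank ℝ E := by
      rw [← add_div, ← Nat.cast_add]
      gcongr
      rw [← Set.ncard_union_eq (Set.disjoint_left.2 fun a ha ha' =>
        ha'.1.2 (subset_closure ha.1)) (hfin.subset fun a ha => ha.2)
        (hfin.subset fun a ha => ha.2)]
      exact Set.ncard_le_ncard (union_subset (fun a ha => ha.2) fun a ha => ha.2) hfin
    rw [← hκ] at hT
    linarith

end IsDenseEmbedding

end Density

end EkedahlSieve
end

noncomputable section
namespace EkedahlSieve

/-! ### Topology and measure of the completion at a prime -/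

section Local

variable {K : Type*} [Field K] [NumberField K] (v : HeightOneSpectrum (𝓞 K)) (n : ℕ)

theorem exists_valued_le_subset {U : Set (v.adicCompletion K)} (hU : U ∈ 𝓝 0) :
    ∃ m : ℕ, {x : v.adicCompletion K | Valued.v x ≤ WithZero.exp (-(m : ℤ))} ⊆ U := by
  let := HeightOneSpectrum.instNormedFieldValuedAdicCompletion K v
  obtain ⟨ε, hε, hεU⟩ := Metric.mem_nhds_iff.1 hU
  have hq := HeightOneSpectrum.one_lt_absNorm_nnreal v
  obtain ⟨m, hm⟩ := exists_pow_lt_of_lt_one hε (inv_lt_one_of_one_lt₀ (NNReal.coe_lt_coe.2 hq))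
  refine ⟨m, fun x hx => hεU ?_⟩
  rw [mem_ball_zero_iff, FinitePlace.norm_def]
  refine lt_of_le_of_lt (NNReal.coe_le_coe.2
    ((WithZeroMulInt.toNNReal_strictMono hq).monotone hx)) ?_
  rw [WithZeroMulInt.toNNReal_neg_apply _ WithZero.exp_ne_zero]
  have h1 : Multiplicative.toAdd (WithZero.unzero (WithZero.exp_ne_zero (a := -(m : ℤ)))) =
    -(m : ℤ) := rfl
  rw [h1]
  simpa using hm

theorem isOpen_valued_le (m : ℕ) :
    IsOpen {x : v.adicCompletion K | Valued.v x ≤ WithZero.exp (-(m : ℤ))} := by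
  let := HeightOneSpectrum.instNormedFieldValuedAdicCompletion K v
  have hq := HeightOneSpectrum.one_lt_absNorm_nnreal v
  have h := IsUltrametricDist.isOpen_closedBall (0 : v.adicCompletion K)
    (r := WithZeroMulInt.toNNReal (ne_zero_of_lt hq) (WithZero.exp (-(m : ℤ))))
    (NNReal.coe_ne_zero.2 (WithZeroMulInt.toNNReal_ne_zero _ WithZero.exp_ne_zero))
  convert! h using 1
  ext x
  rw [mem_closedBall_zero_iff, FinitePlace.norm_def, NNReal.coe_le_coe,
    (WithZeroMulInt.toNNReal_strictMono hq).le_iff_le]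
  rfl

instance : SecondCountableTopology (v.adicCompletion K) := by
  have h1 : TopologicalSpace.SeparableSpace (v.adicCompletion K) := by
    have hK : Countable K := (Module.finBasis ℚ K).equivFun.injective.countable
    exact ⟨⟨_, Set.countable_range _, v.denseRange_algebraMap K⟩⟩
  have h2 : (uniformity (v.adicCompletion K)).IsCountablyGenerated :=
    @EMetric.instIsCountablyGeneratedUniformity (v.adicCompletion K)
      (HeightOneSpectrum.instNormedFieldValuedAdicCompletion K
        v).toMetricSpace.toPseudoMetricSpace.toPseudoEMetricSpace
  exact UniformSpace.secondCountable_of_separable _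

instance : LocallyCompactSpace (v.adicCompletion K) :=
  (isCompact_integers v).locallyCompactSpace_of_mem_nhds_of_addGroup
    ((isOpen_integers v).mem_nhds (zero_mem (v.adicCompletionIntegers K)))

instance : (padicHaar K v).IsAddHaarMeasure := by
  unfold padicHaar; infer_instance

instance : (padicMeasure K n v).IsAddHaarMeasure := by
  unfold padicMeasure; infer_instance

/-- An element of `K` close to an integral `x` is itself integral at `v` by the ultrametric
inequality, and can then be replaced by an element of `𝓞 K`. -/
theorem exists_integer_sub_le {x : v.adicCompletion K} (hx : Valued.v x ≤ 1) (m : ℕ) :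
    ∃ r : 𝓞 K, Valued.v (algebraMap K (v.adicCompletion K) r - x) ≤ WithZero.exp (-(m : ℤ)) := by
  have hop : {y : v.adicCompletion K | Valued.v (y - x) ≤ WithZero.exp (-(m : ℤ))} ∈ 𝓝 x :=
    ((isOpen_valued_le v m).preimage (continuous_id.sub continuous_const)).mem_nhds (by simp)
  obtain ⟨_, hk, k, rfl⟩ := (mem_closure_iff_nhds.1 (v.denseRange_algebraMap K x)) _ hop
  replace hk : Valued.v (algebraMap K (v.adicCompletion K) k - x) ≤ WithZero.exp (-(m : ℤ)) := hk
  have hkv : ∀ k : K, Valued.v (algebraMap K (v.adicCompletion K) k) = v.valuation K k := fun k =>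
    HeightOneSpectrum.valuedAdicCompletion_eq_valuation' v k
  have hm1 : WithZero.exp (-(m : ℤ)) ≤ 1 := by
    rw [← WithZero.exp_zero, WithZero.exp_le_exp]; simp
  have hk1 : v.valuation K k ≤ 1 := by
    rw [← hkv, ← sub_add_cancel (algebraMap K (v.adicCompletion K) k) x]
    exact (Valuation.map_add _ _ _).trans (max_le (hk.trans hm1) hx)
  obtain ⟨r, hr⟩ := v.exists_valuation_sub_lt_of_integer hk1
    (Units.mk0 (WithZero.exp (-(m : ℤ))) WithZero.exp_ne_zero)
  refine ⟨r, ?_⟩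
  have h4 : algebraMap K (v.adicCompletion K) r - x =
      algebraMap K (v.adicCompletion K) (r - k) + (algebraMap K (v.adicCompletion K) k - x) := by
    rw [map_sub]; ring
  rw [h4]
  refine (Valuation.map_add _ _ _).trans (max_le ?_ hk)
  rw [hkv]
  exact hr.le

/-- The approximations at the separate primes are combined by the Chinese remainder theorem modulo
the `m`-th powers of the primes in `S`. -/
theorem exists_integer_forall_sub_le (S : Finset (HeightOneSpectrum (𝓞 K)))
    (x : ∀ v : S, (v : HeightOneSpectrum (𝓞 K)).adicCompletion K)
    (hx : ∀ v, Valued.v (x v) ≤ 1) (m : ℕ) :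
    ∃ r : 𝓞 K, ∀ v : S, Valued.v (algebraMap K ((v : HeightOneSpectrum (𝓞 K)).adicCompletion K) r
      - x v) ≤ WithZero.exp (-(m : ℤ)) := by
  choose r hr using fun v : S => exists_integer_sub_le v.1 (hx v) m
  obtain ⟨y, hy⟩ := exists_forall_sub_mem_ideal (s := S)
    (fun v : HeightOneSpectrum (𝓞 K) => v.asIdeal) (fun _ => m) (fun v _ => v.prime)
    (fun v _ w _ hvw h => hvw (HeightOneSpectrum.ext h)) r
  refine ⟨y, fun v => ?_⟩
  have h1 : algebraMap K (v.1.adicCompletion K) y - x v =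
      algebraMap K (v.1.adicCompletion K) (y - r v : 𝓞 K) +
        (algebraMap K (v.1.adicCompletion K) (r v) - x v) := by
    have h0 : ((y - r v : 𝓞 K) : K) = y - r v := map_sub _ _ _
    rw [h0, map_sub]; ring
  rw [h1]
  refine (Valuation.map_add _ _ _).trans (max_le ?_ (hr v))
  have h2 : Valued.v (algebraMap K (v.1.adicCompletion K) (y - r v : 𝓞 K)) =
      v.1.valuation K (y - r v : 𝓞 K) :=
    HeightOneSpectrum.valuedAdicCompletion_eq_valuation' v.1 _
  rw [h2, HeightOneSpectrum.valuation_of_algebraMap, HeightOneSpectrum.intValuation_le_pow_iff_mem]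
  exact hy v.1 v.2

/-- The vectors all of whose coordinates have valuation at most `exp (-m)`. -/
def congruenceSubgroup (m : ℕ) : AddSubgroup (Fin (n + 1) → v.adicCompletion K) where
  carrier := {x | ∀ i, Valued.v (x i) ≤ WithZero.exp (-(m : ℤ))}
  zero_mem' i := by simp
  add_mem' hx hy i := (Valuation.map_add _ _ _).trans (max_le (hx i) (hy i))
  neg_mem' hx i := by
    rw [Pi.neg_apply, Valuation.map_neg]
    exact hx i

variable {n} in
theorem mem_congruenceSubgroup {m : ℕ} {x : Fin (n + 1) → v.adicCompletion K} :
    x ∈ congruenceSubgroup v n m ↔ ∀ i, Valued.v (x i) ≤ WithZero.exp (-(m : ℤ)) := Iff.rfl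

variable {n} in
theorem mem_congruenceSubgroup_zero {x : Fin (n + 1) → v.adicCompletion K} :
    x ∈ congruenceSubgroup v n 0 ↔ ∀ i, x i ∈ v.adicCompletionIntegers K := by
  simp [mem_congruenceSubgroup, HeightOneSpectrum.mem_adicCompletionIntegers]

theorem congruenceSubgroup_antitone : Antitone (congruenceSubgroup v n) := fun m m' hmm x hx i =>
  (hx i).trans (by rw [WithZero.exp_le_exp]; lia)

theorem coe_congruenceSubgroup (m : ℕ) : (congruenceSubgroup v n m : Set (Fin (n + 1) → v.adicCompletion K)) =
    Set.univ.pi fun _ => {x : v.adicCompletion K | Valued.v x ≤ WithZero.exp (-(m : ℤ))} := by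
  ext x
  simp [mem_congruenceSubgroup]

theorem isOpen_congruenceSubgroup (m : ℕ) : IsOpen (congruenceSubgroup v n m : Set (Fin (n + 1) → v.adicCompletion K)) := by
  rw [coe_congruenceSubgroup]
  exact isOpen_set_pi Set.finite_univ fun _ _ => isOpen_valued_le v m

theorem padicMeasure_congruenceSubgroup_zero :
    padicMeasure K n v (congruenceSubgroup v n 0 : Set (Fin (n + 1) → v.adicCompletion K)) = 1 := by
  have h : {x : v.adicCompletion K | Valued.v x ≤ WithZero.exp (-((0 : ℕ) : ℤ))} =
      (v.adicCompletionIntegers K : Set (v.adicCompletion K)) := by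
    ext x
    simp [HeightOneSpectrum.mem_adicCompletionIntegers]
  rw [coe_congruenceSubgroup, padicMeasure, Measure.pi_pi, h]
  refine Finset.prod_eq_one fun _ _ => ?_
  unfold padicHaar
  exact Measure.addHaarMeasure_self

/-- A product of neighbourhood bases of zero indexed by a common sequence is such a basis. -/
theorem exists_pi_subset {ι : Type*} [Finite ι] {X : ι → Type*} [∀ i, TopologicalSpace (X i)]
    [∀ i, Zero (X i)] {V : ∀ i, ℕ → Set (X i)} (hV : ∀ i, Antitone (V i))
    (hb : ∀ i, ∀ U ∈ 𝓝 (0 : X i), ∃ m, V i m ⊆ U) {U : Set (∀ i, X i)} (hU : U ∈ 𝓝 0) :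
    ∃ m, (Set.univ.pi fun i => V i m) ⊆ U := by
  have := Fintype.ofFinite ι
  rw [nhds_pi, Filter.mem_pi] at hU
  obtain ⟨I, -, t, ht, htU⟩ := hU
  choose m hm using fun i => hb i (t i) (ht i)
  refine ⟨Finset.univ.sup m, fun x hx => htU fun i _ => hm i (hV i ?_ (hx i trivial))⟩
  exact Finset.le_sup (Finset.mem_univ i)

theorem exists_congruenceSubgroup_subset {U : Set (Fin (n + 1) → v.adicCompletion K)}
    (hU : U ∈ 𝓝 0) : ∃ m, (congruenceSubgroup v n m : Set (Fin (n + 1) → v.adicCompletion K)) ⊆ U := by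
  simp_rw [coe_congruenceSubgroup]
  refine exists_pi_subset (fun _ m m' hmm x hx => ?_) (fun _ => fun U hU =>
    exists_valued_le_subset v hU) hU
  exact le_trans (show Valued.v x ≤ _ from hx) (by rw [WithZero.exp_le_exp]; lia)

theorem frontier_pi_subset {ι : Type*} [Finite ι] {X : ι → Type*} [∀ i, TopologicalSpace (X i)]
    (s : ∀ i, Set (X i)) : frontier (Set.univ.pi s) ⊆ ⋃ i, Function.eval i ⁻¹' frontier (s i) := by
  intro x hx
  rw [frontier, closure_pi_set, interior_pi_set Set.finite_univ] at hx
  obtain ⟨h1, h2⟩ := hx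
  simp only [Set.mem_pi, mem_univ, true_imp_iff, not_forall] at h1 h2
  obtain ⟨i, hi⟩ := h2
  exact mem_iUnion.2 ⟨i, h1 i, hi⟩

theorem measure_frontier_pi {ι : Type*} [Fintype ι] {X : ι → Type*} [∀ i, TopologicalSpace (X i)]
    [∀ i, MeasurableSpace (X i)] (μ : ∀ i, Measure (X i)) [∀ i, SigmaFinite (μ i)]
    (s : ∀ i, Set (X i)) (hs : ∀ i, μ i (frontier (s i)) = 0) :
    Measure.pi μ (frontier (Set.univ.pi s)) = 0 :=
  measure_mono_null (frontier_pi_subset s)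
    (measure_iUnion_null fun i => Measure.pi_eval_preimage_null _ (hs i))

end Local

/-! ### Integral vectors: density at finitely many primes and the lattice at infinity -/

section Global

open scoped Classical

variable (K : Type*) [Field K] [NumberField K] (n : ℕ)

/-- The diagonal embedding of `𝔬^(n+1)` in `∏_{v ∈ S} k_v^(n+1)`. -/
def finiteEmbedding (S : Finset (HeightOneSpectrum (𝓞 K))) :
    (Fin (n + 1) → 𝓞 K) →+
      (∀ v : S, Fin (n + 1) → (v : HeightOneSpectrum (𝓞 K)).adicCompletion K) where
  toFun x v k := algebraMap K _ (x k : K)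
  map_zero' := by ext; simp
  map_add' x y := by
    ext v k
    have h0 : ((x k + y k : 𝓞 K) : K) = x k + y k := map_add _ _ _
    simp only [Pi.add_apply, h0, map_add]

theorem isDenseEmbedding_finiteEmbedding (S : Finset (HeightOneSpectrum (𝓞 K))) :
    IsDenseEmbedding (Measure.pi fun v : S => padicMeasure K n v) (finiteEmbedding K n S)
      (AddSubgroup.pi Set.univ fun v : S => congruenceSubgroup v.1 n 0)
      (fun m => AddSubgroup.pi Set.univ fun v : S => congruenceSubgroup v.1 n m) where
  isOpen := isOpen_set_pi Set.finite_univ fun v _ => isOpen_congruenceSubgroup v.1 n 0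
  measure_eq := by
    rw [AddSubgroup.coe_pi, Measure.pi_pi]
    exact Finset.prod_eq_one fun v _ => padicMeasure_congruenceSubgroup_zero v.1 n
  antitone m m' hmm x hx v hv := congruenceSubgroup_antitone v.1 n hmm (hx v hv)
  le m x hx v hv := congruenceSubgroup_antitone v.1 n (Nat.zero_le m) (hx v hv)
  isOpen_basis m := isOpen_set_pi Set.finite_univ fun v _ => isOpen_congruenceSubgroup v.1 n m
  basis U hU := exists_pi_subset (fun v => fun m m' hmm x hx =>
    congruenceSubgroup_antitone v.1 n hmm hx)
    (fun v U hU => exists_congruenceSubgroup_subset v.1 n hU) hU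
  mem a v _ := (mem_congruenceSubgroup_zero v.1).2 fun i =>
    v.1.coe_mem_adicCompletionIntegers (K := K) (a i)
  dense g hg m := by
    choose r hr using fun k => exists_integer_forall_sub_le S (fun v => g v k)
      (fun v => (mem_congruenceSubgroup_zero v.1).1 (hg v trivial) k) m
    exact ⟨r, fun v _ k => hr k v⟩

/-- The embedding of `𝔬^(n+1)` in `k_∞^(n+1)`. -/
def archEmbedding : (Fin (n + 1) → 𝓞 K) →+ (Fin (n + 1) → mixedEmbedding.mixedSpace K) where
  toFun x k := mixedEmbedding K (x k : K)
  map_zero' := funext fun _ => map_zero (mixedEmbedding K)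
  map_add' x y := by
    funext k
    have h0 : ((x k + y k : 𝓞 K) : K) = x k + y k := map_add _ _ _
    simp only [Pi.add_apply, h0, map_add]

/-- A fundamental domain for the translations of `k_∞^(n+1)` by `𝔬^(n+1)`. -/
def archTile : Set (Fin (n + 1) → mixedEmbedding.mixedSpace K) :=
  Set.univ.pi fun _ => ZSpan.fundamentalDomain (mixedEmbedding.latticeBasis K)

set_option synthInstance.maxSize 1000 in
instance : (volume : Measure (Fin (n + 1) → mixedEmbedding.mixedSpace K)).IsAddHaarMeasure := by
  rw [volume_pi]
  infer_instance

instance : BorelSpace (Fin (n + 1) → mixedEmbedding.mixedSpace K) := Pi.borelSpace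

theorem finrank_pi_mixedSpace :
    Module.finrank ℝ (Fin (n + 1) → mixedEmbedding.mixedSpace K) =
      Module.finrank ℚ K * (n + 1) := by
  rw [Module.finrank_pi_fintype, Finset.sum_const, Finset.card_univ, Fintype.card_fin,
    mixedEmbedding.finrank, smul_eq_mul, mul_comm]

theorem isFundamentalTile_archTile :
    IsFundamentalTile (volume : Measure (Fin (n + 1) → mixedEmbedding.mixedSpace K))
      (archEmbedding K n) (archTile K n) where
  measurable := MeasurableSet.univ_pi fun _ => ZSpan.fundamentalDomain_measurableSet _
  existsUnique x := by
    have key : ∀ y : mixedEmbedding.mixedSpace K, ∃! a : 𝓞 K,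
        y - mixedEmbedding K (a : K) ∈ ZSpan.fundamentalDomain (mixedEmbedding.latticeBasis K) := by
      intro y
      obtain ⟨⟨w, hw⟩, hwm, huniq⟩ :=
        ZSpan.exist_unique_vadd_mem_fundamentalDomain (mixedEmbedding.latticeBasis K) y
      -- The fundamental domain lemma adds the lattice vector `w`, whereas here one is subtracted;
      -- hence the sign.
      obtain ⟨a, ha⟩ := (mixedEmbedding.mem_span_latticeBasis K).1 (neg_mem hw)
      have ha' : mixedEmbedding K (a : K) = -w := ha
      have hmem : ∀ b : 𝓞 K, -mixedEmbedding K (b : K) ∈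
          Submodule.span ℤ (Set.range (mixedEmbedding.latticeBasis K)) := fun b =>
        neg_mem ((mixedEmbedding.mem_span_latticeBasis K).2 ⟨b, rfl⟩)
      refine ⟨a, ?_, fun b hb => ?_⟩
      · simp only [ha', sub_neg_eq_add, add_comm y]
        exact hwm
      · have := huniq ⟨_, hmem b⟩ (by
          change -mixedEmbedding K (b : K) + y ∈ _
          rwa [neg_add_eq_sub])
        refine RingOfIntegers.coe_injective (mixedEmbedding_injective K ?_)
        have hw' : -mixedEmbedding K (b : K) = w := congrArg Subtype.val this
        exact neg_injective (by rw [hw', ha', neg_neg])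
    choose a ha huniq using key
    refine ⟨fun k => a (x k), fun k _ => ha (x k), fun b hb => ?_⟩
    funext k
    exact huniq (x k) (b k) (hb k trivial)
  bounded := Bornology.IsBounded.pi fun _ => ZSpan.fundamentalDomain_isBounded _
  ne_zero := by
    rw [volume_pi, archTile, Measure.pi_pi]
    exact Finset.prod_ne_zero_iff.2 fun _ _ => ZSpan.measure_fundamentalDomain_ne_zero _

/-- The density of the integral points satisfying local conditions at finitely many primes. -/
theorem tendsto_ncard_finite (S : Finset (HeightOneSpectrum (𝓞 K)))
    {Ψ : Set (Fin (n + 1) → mixedEmbedding.mixedSpace K)} (hΨ : Bornology.IsBounded Ψ)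
    (hΨ' : volume (frontier Ψ) = 0)
    (U : ∀ v : HeightOneSpectrum (𝓞 K), Set (Fin (n + 1) → v.adicCompletion K))
    (hU : ∀ v, U v ⊆ congruenceSubgroup v n 0) (hU' : ∀ v, padicMeasure K n v (frontier (U v)) = 0) :
    Tendsto (fun T : ℝ => ({x : Fin (n + 1) → 𝓞 K | (∀ v ∈ S, (fun i => algebraMap K
      (v.adicCompletion K) (x i : K)) ∈ U v) ∧ archEmbedding K n x ∈ T • Ψ}.ncard : ℝ) /
        T ^ (Module.finrank ℚ K * (n + 1))) atTop
      (𝓝 (volume.real Ψ / volume.real (archTile K n) * ∏ v ∈ S, (padicMeasure K n v).real (U v))) := by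
  have hK : Countable K := (Module.finBasis ℚ K).equivFun.injective.countable
  have hO : Countable (𝓞 K) := RingOfIntegers.coe_injective.countable
  have := (isDenseEmbedding_finiteEmbedding K n S).tendsto_ncard (isFundamentalTile_archTile K n)
    hΨ hΨ' (U := Set.univ.pi fun v : S => U v) (fun x hx v hv => hU v.1 (hx v hv))
    (measure_frontier_pi _ _ fun v => hU' v.1)
  rw [finrank_pi_mixedSpace, Measure.real, Measure.real, Measure.real, Measure.pi_pi,
    ENNReal.toReal_prod, Finset.prod_coe_sort S fun v => (padicMeasure K n v (U v)).toReal] at this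
  refine this.congr fun T => ?_
  congr 3
  ext x
  simp [finiteEmbedding]

end Global

end EkedahlSieve
end

noncomputable section
namespace EkedahlSieve

/-! ### Products of factors in the unit interval -/

section Products

variable {ι : Type*} {f : ι → ℝ}

theorem hasProd_iInf_of_le_one (h0 : ∀ i, 0 ≤ f i) (h1 : ∀ i, f i ≤ 1) :
    HasProd f (⨅ s : Finset ι, ∏ i ∈ s, f i) := by
  refine tendsto_atTop_ciInf (fun s t hst => ?_) ⟨0, ?_⟩
  · exact Finset.prod_le_prod_of_subset_of_le_one hst (fun i _ => h0 i) fun i _ _ => h1 i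
  · rintro _ ⟨s, rfl⟩
    exact Finset.prod_nonneg fun i _ => h0 i

/-- The finite products decrease. `Multipliable` allows the limit `0`, so convergence is free here
and nonvanishing of a product has to be proved separately. -/
theorem multipliable_of_le_one (h0 : ∀ i, 0 ≤ f i) (h1 : ∀ i, f i ≤ 1) : Multipliable f :=
  ⟨_, hasProd_iInf_of_le_one h0 h1⟩

end Products

/-! ### The sieve: from finitely many primes to all primes -/

section Sieve

variable {K : Type*} [Field K] [NumberField K] {n : ℕ}

open scoped Classical

instance : Countable (𝓞 K) :=
  have : Countable K := (Module.finBasis ℚ K).equivFun.injective.countable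
  RingOfIntegers.coe_injective.countable

theorem finite_absNorm_le (M : ℕ) :
    {v : HeightOneSpectrum (𝓞 K) | Ideal.absNorm v.asIdeal ≤ M}.Finite :=
  (Ideal.finite_setOfPred_absNorm_le (S := 𝓞 K) M).preimage
    (f := fun v : HeightOneSpectrum (𝓞 K) => v.asIdeal) fun _ _ _ _ h => HeightOneSpectrum.ext h

variable (K) in
/-- The primes of norm at most `M`. -/
def primesLE (M : ℕ) : Finset (HeightOneSpectrum (𝓞 K)) := (finite_absNorm_le M).toFinset

theorem mem_primesLE {M : ℕ} {v : HeightOneSpectrum (𝓞 K)} :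
    v ∈ primesLE K M ↔ Ideal.absNorm v.asIdeal ≤ M := by
  rw [primesLE, Set.Finite.mem_toFinset]
  rfl

theorem primesLE_mono : Monotone (primesLE K) := fun _ _ h _ hv =>
  mem_primesLE.2 ((mem_primesLE.1 hv).trans h)

theorem tendsto_primesLE : Tendsto (primesLE K) atTop atTop :=
  tendsto_atTop_finset_of_monotone primesLE_mono fun _ => ⟨_, mem_primesLE.2 le_rfl⟩

/-- The diagonal embedding of `𝔬^(n+1)` in `k_v^(n+1)`. -/
def toCompletion (v : HeightOneSpectrum (𝓞 K)) (x : Fin (n + 1) → 𝓞 K) :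
    Fin (n + 1) → v.adicCompletion K := fun i => algebraMap K (v.adicCompletion K) (x i : K)

/-- Few integral points fail the local conditions `U v` at some large prime. -/
def SmallTail (U : ∀ v : HeightOneSpectrum (𝓞 K), Set (Fin (n + 1) → v.adicCompletion K)) : Prop :=
  ∀ R ε : ℝ, 0 < ε → ∃ M : ℕ, ∀ᶠ T : ℝ in atTop,
    ({x : Fin (n + 1) → 𝓞 K | (∃ v : HeightOneSpectrum (𝓞 K), M < Ideal.absNorm v.asIdeal ∧
      toCompletion v x ∉ U v) ∧ archEmbedding K n x ∈ T • Metric.closedBall 0 R}.ncard : ℝ) /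
        T ^ (Module.finrank ℚ K * (n + 1)) ≤ ε

variable {U : ∀ v : HeightOneSpectrum (𝓞 K), Set (Fin (n + 1) → v.adicCompletion K)}
  {Ψ : Set (Fin (n + 1) → mixedEmbedding.mixedSpace K)}

theorem SmallTail.exists_forall_ge (h : SmallTail U) (R ε : ℝ) (hε : 0 < ε) :
    ∃ M₀ : ℕ, ∀ M ≥ M₀, ∀ᶠ T : ℝ in atTop,
    ({x : Fin (n + 1) → 𝓞 K | (∃ v : HeightOneSpectrum (𝓞 K), M < Ideal.absNorm v.asIdeal ∧
      toCompletion v x ∉ U v) ∧ archEmbedding K n x ∈ T • Metric.closedBall 0 R}.ncard : ℝ) /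
        T ^ (Module.finrank ℚ K * (n + 1)) ≤ ε := by
  obtain ⟨M₀, hM₀⟩ := h R ε hε
  refine ⟨M₀, fun M hM => ?_⟩
  filter_upwards [hM₀, eventually_ge_atTop 0] with T hT hT0
  refine le_trans ?_ hT
  have hfin := ((isFundamentalTile_archTile K n).finite
    (Metric.isBounded_closedBall (x := 0) (r := R)) T).subset
      (fun x (hx : x ∈ {x : Fin (n + 1) → 𝓞 K | (∃ v : HeightOneSpectrum (𝓞 K),
        M₀ < Ideal.absNorm v.asIdeal ∧ toCompletion v x ∉ U v) ∧
          archEmbedding K n x ∈ T • Metric.closedBall 0 R}) => hx.2)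
  gcongr

theorem ncard_le_ncard_add_tail (hΨ : Bornology.IsBounded Ψ) {R : ℝ}
    (hR : Ψ ⊆ Metric.closedBall 0 R) (M : ℕ) (P : (Fin (n + 1) → 𝓞 K) → Prop) (T : ℝ) :
    {x : Fin (n + 1) → 𝓞 K | P x ∧ archEmbedding K n x ∈ T • Ψ}.ncard ≤
    {x : Fin (n + 1) → 𝓞 K | (P x ∧ ∀ v : HeightOneSpectrum (𝓞 K), M < Ideal.absNorm v.asIdeal →
      toCompletion v x ∈ U v) ∧ archEmbedding K n x ∈ T • Ψ}.ncard +
    {x : Fin (n + 1) → 𝓞 K | (∃ v : HeightOneSpectrum (𝓞 K), M < Ideal.absNorm v.asIdeal ∧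
      toCompletion v x ∉ U v) ∧ archEmbedding K n x ∈ T • Metric.closedBall 0 R}.ncard := by
  refine (Set.ncard_le_ncard ?_ ?_).trans (Set.ncard_union_le _ _)
  · rintro x ⟨hP, hx⟩
    by_cases h : ∀ v : HeightOneSpectrum (𝓞 K), M < Ideal.absNorm v.asIdeal → toCompletion v x ∈ U v
    · exact Or.inl ⟨⟨hP, h⟩, hx⟩
    · push Not at h
      exact Or.inr ⟨h, Set.smul_set_mono hR hx⟩
  · exact (((isFundamentalTile_archTile K n).finite hΨ T).subset fun x hx => hx.2).union
      (((isFundamentalTile_archTile K n).finite Metric.isBounded_closedBall T).subset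
      fun x hx => hx.2)

variable (hU : ∀ v, U v ⊆ congruenceSubgroup v n 0)

include hU in
theorem padicMeasure_real_le_one (v : HeightOneSpectrum (𝓞 K)) :
    (padicMeasure K n v).real (U v) ≤ 1 := by
  refine ENNReal.toReal_le_of_le_ofReal zero_le_one ?_
  rw [ENNReal.ofReal_one, ← padicMeasure_congruenceSubgroup_zero v n]
  exact measure_mono (hU v)

include hU in
theorem multipliable_padicMeasure : Multipliable fun v => (padicMeasure K n v).real (U v) :=
  multipliable_of_le_one (fun _ => measureReal_nonneg) (padicMeasure_real_le_one hU)

include hU in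
/-- Ekedahl's sieve: the density of the integral points satisfying local conditions at all primes
is the product of the local densities, if few points fail the condition at a large prime. -/
theorem tendsto_ncard_infinite (hΨ : Bornology.IsBounded Ψ) (hΨ' : volume (frontier Ψ) = 0)
    (hU' : ∀ v, padicMeasure K n v (frontier (U v)) = 0) (htail : SmallTail U) :
    Tendsto (fun T : ℝ => ({x : Fin (n + 1) → 𝓞 K | (∀ v, toCompletion v x ∈ U v) ∧
      archEmbedding K n x ∈ T • Ψ}.ncard : ℝ) / T ^ (Module.finrank ℚ K * (n + 1))) atTop
      (𝓝 (volume.real Ψ / volume.real (archTile K n) * ∏' v, (padicMeasure K n v).real (U v))) := by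
  set κ := volume.real Ψ / volume.real (archTile K n) with hκ
  obtain ⟨R, hR⟩ := hΨ.subset_closedBall 0
  have hprod : Tendsto (fun M => κ * ∏ v ∈ primesLE K M, (padicMeasure K n v).real (U v)) atTop
      (𝓝 (κ * ∏' v, (padicMeasure K n v).real (U v))) :=
    ((multipliable_padicMeasure hU).hasProd.comp tendsto_primesLE).const_mul κ
  rw [Metric.tendsto_nhds]
  intro ε hε
  -- The three thirds of `ε` pay for the tail beyond `M`, for truncating the product at `M`, and for
  -- the error in the finite density theorem.
  obtain ⟨M₀, hM₀⟩ := htail.exists_forall_ge R (ε / 3) (by positivity)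
  obtain ⟨M, hM, hMd⟩ := ((eventually_ge_atTop M₀).and
    (Metric.tendsto_nhds.1 hprod (ε / 3) (by positivity))).exists
  filter_upwards [hM₀ M hM, eventually_gt_atTop 0, Metric.tendsto_nhds.1
    (tendsto_ncard_finite K n (primesLE K M) hΨ hΨ' U hU hU') (ε / 3) (by positivity)]
    with T hT hT0 hTd
  have hle := ncard_le_ncard_add_tail (U := U) hΨ hR M
    (fun x => ∀ v ∈ primesLE K M, toCompletion v x ∈ U v) T
  have heq : {x : Fin (n + 1) → 𝓞 K | ((∀ v ∈ primesLE K M, toCompletion v x ∈ U v) ∧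
      ∀ v : HeightOneSpectrum (𝓞 K), M < Ideal.absNorm v.asIdeal → toCompletion v x ∈ U v) ∧
      archEmbedding K n x ∈ T • Ψ} =
      {x | (∀ v, toCompletion v x ∈ U v) ∧ archEmbedding K n x ∈ T • Ψ} := by
    ext x
    refine and_congr_left fun _ => ⟨fun h v => ?_, fun h => ⟨fun v _ => h v, fun v _ => h v⟩⟩
    rcases le_or_gt (Ideal.absNorm v.asIdeal) M with hv | hv
    · exact h.1 v (mem_primesLE.2 hv)
    · exact h.2 v hv
  rw [heq] at hle
  have hle2 : {x : Fin (n + 1) → 𝓞 K | (∀ v, toCompletion v x ∈ U v) ∧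
      archEmbedding K n x ∈ T • Ψ}.ncard ≤ {x : Fin (n + 1) → 𝓞 K | (∀ v ∈ primesLE K M,
      toCompletion v x ∈ U v) ∧ archEmbedding K n x ∈ T • Ψ}.ncard :=
    Set.ncard_le_ncard (fun x hx => ⟨fun v _ => hx.1 v, hx.2⟩)
      (((isFundamentalTile_archTile K n).finite hΨ T).subset fun x hx => hx.2)
  have hpos : (0 : ℝ) < T ^ (Module.finrank ℚ K * (n + 1)) := by positivity
  have e1 := div_le_div_of_nonneg_right (Nat.cast_le (α := ℝ).2 hle) hpos.le
  have e2 := div_le_div_of_nonneg_right (Nat.cast_le (α := ℝ).2 hle2) hpos.le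
  rw [Nat.cast_add, add_div] at e1
  rw [Real.dist_eq, abs_lt] at hMd hTd ⊢
  change - (ε / 3) < ({x : Fin (n + 1) → 𝓞 K | (∀ v ∈ primesLE K M,
      toCompletion v x ∈ U v) ∧ archEmbedding K n x ∈ T • Ψ}.ncard : ℝ) /
      T ^ (Module.finrank ℚ K * (n + 1)) - _ ∧ ({x : Fin (n + 1) → 𝓞 K | (∀ v ∈ primesLE K M,
      toCompletion v x ∈ U v) ∧ archEmbedding K n x ∈ T • Ψ}.ncard : ℝ) /
      T ^ (Module.finrank ℚ K * (n + 1)) - _ < ε / 3 at hTd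
  constructor <;> linarith [hMd.1, hMd.2, hTd.1, hTd.2]

include hU in
-- A vector failing some condition at primes of norm between `M` and `M'` belongs to the tail beyond
-- `M`. A tail of relative density at most `1/4` thus forces the product over those primes to be at
-- least `3/4`, uniformly in `M'`; the remaining finitely many factors are positive.
theorem tprod_padicMeasure_pos (hU' : ∀ v, padicMeasure K n v (frontier (U v)) = 0)
    (htail : SmallTail U) (hpos : ∀ v, 0 < (padicMeasure K n v).real (U v)) :
    0 < ∏' v, (padicMeasure K n v).real (U v) := by
  set Ψ : Set (Fin (n + 1) → mixedEmbedding.mixedSpace K) := Metric.closedBall 0 1 with hΨdef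
  have hΨ : Bornology.IsBounded Ψ := Metric.isBounded_closedBall
  have hΨ' : volume (frontier Ψ) = 0 := (convex_closedBall _ _).addHaar_frontier _
  set κ := volume.real Ψ / volume.real (archTile K n) with hκ
  have hκ0 : 0 < κ := by
    have htile := isFundamentalTile_archTile K n
    refine div_pos ?_ (ENNReal.toReal_pos htile.ne_zero htile.bounded.measure_lt_top.ne)
    exact ENNReal.toReal_pos (Metric.measure_closedBall_pos _ _ one_pos).ne' hΨ.measure_lt_top.ne
  -- `κ` is the density of all integral vectors in the dilates of the unit ball, so `κ / 4` is a
  -- quarter of them.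
  obtain ⟨M, hM⟩ := htail 1 (κ / 4) (by positivity)
  have key : ∀ M' ≥ M, 3 / 4 ≤ ∏ v ∈ primesLE K M' \ primesLE K M,
      (padicMeasure K n v).real (U v) := by
    intro M' hM'
    have h1 := tendsto_ncard_finite K n (primesLE K M' \ primesLE K M) hΨ hΨ' U hU hU'
    have h2 := tendsto_ncard_finite K n ∅ hΨ hΨ' U hU hU'
    rw [Finset.prod_empty, mul_one] at h2
    have h3 := le_of_tendsto (h2.sub h1) (b := κ / 4) (by
      filter_upwards [hM, eventually_gt_atTop 0] with T hT hT0
      refine le_trans ?_ hT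
      rw [← sub_div]
      gcongr
      rw [sub_le_iff_le_add']
      norm_cast
      refine (ncard_le_ncard_add_tail (U := U) hΨ (R := 1) subset_rfl M _ T).trans ?_
      refine Nat.add_le_add_right (Set.ncard_le_ncard ?_
        (((isFundamentalTile_archTile K n).finite hΨ T).subset fun x hx => hx.2)) _
      rintro x ⟨⟨-, hx⟩, hx'⟩
      refine ⟨fun v hv => hx v ?_, hx'⟩
      rw [Finset.mem_sdiff, mem_primesLE, mem_primesLE] at hv
      exact not_le.1 hv.2)
    have h4 : 0 ≤ κ * (∏ v ∈ primesLE K M' \ primesLE K M, (padicMeasure K n v).real (U v) - 3 / 4) := by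
      linarith
    have := nonneg_of_mul_nonneg_right h4 hκ0
    linarith
  have hP : 0 < ∏ v ∈ primesLE K M, (padicMeasure K n v).real (U v) :=
    Finset.prod_pos fun v _ => hpos v
  refine lt_of_lt_of_le (by positivity : 0 < 3 / 4 * ∏ v ∈ primesLE K M,
    (padicMeasure K n v).real (U v)) ?_
  refine ge_of_tendsto ((multipliable_padicMeasure hU).hasProd.comp tendsto_primesLE) ?_
  filter_upwards [eventually_ge_atTop M] with M' hM'
  rw [Function.comp_apply, ← Finset.prod_sdiff (primesLE_mono hM')]
  gcongr
  exact key M' hM'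

end Sieve
end EkedahlSieve
end

noncomputable section
namespace EkedahlSieve

/-! ### Convergence of the sum of inverse powers of prime norms -/

section PrimeSum

variable {K : Type*} [Field K] [NumberField K]

theorem exists_prime_dvd_absNorm (v : HeightOneSpectrum (𝓞 K)) :
    ∃ p : ℕ, p.Prime ∧ p ∣ Ideal.absNorm v.asIdeal ∧ (p : 𝓞 K) ∈ v.asIdeal := by
  have h0 : Ideal.absNorm v.asIdeal ≠ 0 := Ideal.absNorm_eq_zero_iff.not.2 v.ne_bot
  have hmem : ((Ideal.absNorm v.asIdeal : ℕ) : 𝓞 K) ∈ v.asIdeal := Ideal.absNorm_mem _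
  rw [← Nat.prod_primeFactorsList h0, Nat.cast_list_prod, ← Multiset.prod_coe] at hmem
  obtain ⟨q, hq, hqv⟩ := (v.isPrime.multiset_prod_mem_iff_exists_mem _).1 hmem
  obtain ⟨p, hp, rfl⟩ := List.mem_map.1 (Multiset.mem_coe.1 hq)
  exact ⟨p, Nat.prime_of_mem_primeFactorsList hp, Nat.dvd_of_mem_primeFactorsList hp, hqv⟩

/-- The product of the distinct primes containing `p` divides `(p)`, which has norm `p ^ d`, while
each prime contributes at least `p` to the norm. -/
theorem card_le_finrank_of_natCast_mem {p : ℕ} (hp : p.Prime) (s : Finset (HeightOneSpectrum (𝓞 K)))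
    (hs : ∀ v ∈ s, (p : 𝓞 K) ∈ v.asIdeal) (hs' : ∀ v ∈ s, p ∣ Ideal.absNorm v.asIdeal) :
    s.card ≤ Module.finrank ℚ K := by
  have hdvd : ∏ v ∈ s, v.asIdeal ∣ Ideal.span {(p : 𝓞 K)} := by
    have hinj : Set.InjOn (fun v : HeightOneSpectrum (𝓞 K) => v.asIdeal) s :=
      fun v _ w _ h => HeightOneSpectrum.ext h
    classical
    rw [← Finset.prod_image (f := fun I : Ideal (𝓞 K) => I) hinj]
    refine Finset.prod_primes_dvd _ (fun I hI => ?_) fun I hI => ?_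
    · obtain ⟨v, -, rfl⟩ := Finset.mem_image.1 hI
      exact v.prime
    · obtain ⟨v, hv, rfl⟩ := Finset.mem_image.1 hI
      exact Ideal.dvd_span_singleton.2 (hs v hv)
  have h1 := map_dvd Ideal.absNorm hdvd
  rw [Ideal.absNorm_span_natCast, map_prod] at h1
  have hpos : 0 < p ^ Module.finrank ℤ (𝓞 K) := pow_pos hp.pos _
  have h2 : p ^ s.card ≤ p ^ Module.finrank ℤ (𝓞 K) := by
    refine le_trans ?_ (Nat.le_of_dvd hpos h1)
    rw [← Finset.prod_const]
    refine Finset.prod_le_prod' fun v hv => Nat.le_of_dvd ?_ (hs' v hv)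
    exact Nat.pos_of_ne_zero (Ideal.absNorm_eq_zero_iff.not.2 v.ne_bot)
  rw [← RingOfIntegers.rank K]
  exact (Nat.pow_le_pow_iff_right hp.one_lt).1 h2

/-- Replace each norm by the rational prime below it: every rational prime is hit at most `d` times,
and the sum over all natural numbers converges. -/
theorem summable_absNorm_inv_pow {k : ℕ} (hk : 2 ≤ k) :
    Summable fun v : HeightOneSpectrum (𝓞 K) => ((Ideal.absNorm v.asIdeal : ℝ) ^ k)⁻¹ := by
  classical
  choose p hp hpd hpm using exists_prime_dvd_absNorm (K := K)
  have hsum : Summable fun m : ℕ => ((m : ℝ) ^ k)⁻¹ := Real.summable_nat_pow_inv.2 hk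
  refine summable_of_sum_le (c := Module.finrank ℚ K * ∑' m : ℕ, ((m : ℝ) ^ k)⁻¹)
    (fun v => by positivity) fun s => ?_
  calc ∑ v ∈ s, ((Ideal.absNorm v.asIdeal : ℝ) ^ k)⁻¹ ≤ ∑ v ∈ s, ((p v : ℝ) ^ k)⁻¹ := by
        refine Finset.sum_le_sum fun v _ => ?_
        have := (hp v).pos
        gcongr
        exact Nat.le_of_dvd (Nat.pos_of_ne_zero (Ideal.absNorm_eq_zero_iff.not.2 v.ne_bot)) (hpd v)
    _ = ∑ q ∈ s.image p, (s.filter fun v => p v = q).card • ((q : ℝ) ^ k)⁻¹ :=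
        Finset.sum_comp (fun q : ℕ => ((q : ℝ) ^ k)⁻¹) p
    _ ≤ ∑ q ∈ s.image p, Module.finrank ℚ K * ((q : ℝ) ^ k)⁻¹ := by
        refine Finset.sum_le_sum fun q hq => ?_
        obtain ⟨v, -, rfl⟩ := Finset.mem_image.1 hq
        rw [nsmul_eq_mul]
        gcongr
        refine card_le_finrank_of_natCast_mem (hp v) _ (fun w hw => ?_) fun w hw => ?_
        · rw [← (Finset.mem_filter.1 hw).2]
          exact hpm w
        · rw [← (Finset.mem_filter.1 hw).2]
          exact hpd w
    _ ≤ Module.finrank ℚ K * ∑' m : ℕ, ((m : ℝ) ^ k)⁻¹ := by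
        rw [← Finset.mul_sum]
        gcongr
        exact hsum.sum_le_tsum _ fun _ _ => by positivity

end PrimeSum

/-! ### A packing bound -/

section Packing

open Module

variable {E : Type*} [NormedAddCommGroup E] [NormedSpace ℝ E] [FiniteDimensional ℝ E]

/-- A `ρ`-separated subset of a ball of radius `r ≥ ρ` has at most `(3r/ρ)^dim` elements. -/
theorem card_le_of_separated {s : Finset E} {r ρ : ℝ} (hρ : 0 < ρ) (hr : ρ ≤ r)
    (hs : ∀ x ∈ s, ‖x‖ ≤ r) (hsep : ∀ x ∈ s, ∀ y ∈ s, x ≠ y → ρ ≤ dist x y) :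
    (s.card : ℝ) ≤ (3 * r / ρ) ^ finrank ℝ E := by
  borelize E
  have hr0 : 0 < r := hρ.trans_le hr
  let μ : Measure E := Measure.addHaar
  -- Compare volumes: the disjoint balls of radius `ρ / 2` fit in the ball of radius `r + ρ / 2`,
  -- which is at most `3 * r / 2` since `ρ ≤ r`.
  have hd : (s : Set E).PairwiseDisjoint fun x => Metric.ball x (ρ / 2) := fun x hx y hy hxy =>
    Metric.ball_disjoint_ball (by rw [add_halves]; exact hsep x hx y hy hxy)
  have h1 : μ (⋃ x ∈ s, Metric.ball x (ρ / 2)) ≤ μ (Metric.ball 0 (r + ρ / 2)) := by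
    refine measure_mono (iUnion₂_subset fun x hx => Metric.ball_subset_ball' ?_)
    rw [dist_zero_right, add_comm]
    gcongr
    exact hs x hx
  rw [measure_biUnion_finset hd fun _ _ => measurableSet_ball] at h1
  simp_rw [Measure.addHaar_ball_of_pos μ _ (by positivity : 0 < ρ / 2)] at h1
  rw [Measure.addHaar_ball_of_pos μ _ (by linarith : 0 < r + ρ / 2), Finset.sum_const, nsmul_eq_mul,
    ← mul_assoc] at h1
  have h2 := (ENNReal.mul_le_mul_iff_left (Metric.measure_ball_pos μ 0 one_pos).ne'
    measure_ball_lt_top.ne).1 h1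
  rw [← ENNReal.ofReal_natCast, ← ENNReal.ofReal_mul (Nat.cast_nonneg _),
    ENNReal.ofReal_le_ofReal_iff (by positivity)] at h2
  have h3 : (r + ρ / 2) ^ finrank ℝ E ≤ (3 * r / 2) ^ finrank ℝ E := by
    refine pow_le_pow_left₀ (by positivity) (by linarith) _
  have h4 : (3 * r / ρ) = (3 * r / 2) / (ρ / 2) := by field_simp
  rw [h4, div_pow, le_div_iff₀ (by positivity)]
  exact h2.trans h3

end Packing

/-! ### Vectors divisible by a large prime -/

section PrimitiveTail

variable {K : Type*} [Field K] [NumberField K] {n : ℕ}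

open scoped Classical

/-- `N I` divides the norm of `a`, and the absolute value of that norm is a product of `d`
archimedean absolute values (counted with multiplicity), each bounded by the sup norm. -/
theorem absNorm_le_norm_mixedEmbedding_pow {I : Ideal (𝓞 K)} {a : 𝓞 K} (ha : a ∈ I) (ha0 : a ≠ 0) :
    (Ideal.absNorm I : ℝ) ≤ ‖mixedEmbedding K (a : K)‖ ^ Module.finrank ℚ K := by
  have h1 : (Ideal.absNorm I : ℤ) ∣ Algebra.norm ℤ a := Ideal.absNorm_dvd_norm_of_mem ha
  have h2 : (Ideal.absNorm I : ℤ) ≤ |Algebra.norm ℤ a| :=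
    Int.le_of_dvd (abs_pos.2 (Algebra.norm_ne_zero_iff.2 ha0)) ((dvd_abs _ _).2 h1)
  have h3 : (Ideal.absNorm I : ℝ) ≤ |(Algebra.norm ℤ a : ℝ)| := by exact_mod_cast h2
  have h4 : mixedEmbedding.norm (mixedEmbedding K (a : K)) = |(Algebra.norm ℤ a : ℝ)| := by
    rw [mixedEmbedding.norm_eq_norm, ← Algebra.coe_norm_int]
    push_cast
    rfl
  rw [← h4, mixedEmbedding.norm_apply] at h3
  refine h3.trans ?_
  rw [← InfinitePlace.sum_mult_eq, ← Finset.prod_pow_eq_pow_sum]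
  refine Finset.prod_le_prod (fun w _ => pow_nonneg (mixedEmbedding.normAtPlace_nonneg _ _) _)
    fun w _ => pow_le_pow_left₀ (mixedEmbedding.normAtPlace_nonneg _ _) ?_ _
  rw [mixedEmbedding.norm_eq_sup'_normAtPlace]
  exact Finset.le_sup' (fun w => mixedEmbedding.normAtPlace w (mixedEmbedding K (a : K)))
    (Finset.mem_univ w)

theorem absNorm_le_norm_archEmbedding_pow {I : Ideal (𝓞 K)} {x : Fin (n + 1) → 𝓞 K}
    (hx : ∀ i, x i ∈ I) (hx0 : x ≠ 0) :
    (Ideal.absNorm I : ℝ) ≤ ‖archEmbedding K n x‖ ^ Module.finrank ℚ K := by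
  obtain ⟨i, hi⟩ := Function.ne_iff.1 hx0
  refine (absNorm_le_norm_mixedEmbedding_pow (hx i) hi).trans ?_
  gcongr
  exact norm_le_pi_norm (archEmbedding K n x) i

/-- Distinct vectors with coordinates in `I` are at distance at least `(N I)^(1/d)`, so the packing
bound applies. The hypothesis `hr` says that this separation does not exceed the radius. The bound
is uniform in `I`, which permits summation over primes. -/
theorem ncard_mem_ideal_le {I : Ideal (𝓞 K)} (hI : I ≠ ⊥) {r : ℝ} (hr0 : 0 ≤ r)
    (hr : (Ideal.absNorm I : ℝ) ≤ r ^ Module.finrank ℚ K) :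
    ({x : Fin (n + 1) → 𝓞 K | (∀ i, x i ∈ I) ∧
      archEmbedding K n x ∈ Metric.closedBall 0 r}.ncard : ℝ) ≤
      (3 * r) ^ (Module.finrank ℚ K * (n + 1)) * ((Ideal.absNorm I : ℝ) ^ (n + 1))⁻¹ := by
  have hd : 0 < Module.finrank ℚ K := Module.finrank_pos
  have hN : 0 < (Ideal.absNorm I : ℝ) :=
    Nat.cast_pos.2 (Nat.pos_of_ne_zero (Ideal.absNorm_eq_zero_iff.not.2 hI))
  set ρ : ℝ := (Ideal.absNorm I : ℝ) ^ ((Module.finrank ℚ K : ℝ)⁻¹) with hρ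
  have hρ0 : 0 < ρ := Real.rpow_pos_of_pos hN _
  have hρd : ρ ^ Module.finrank ℚ K = Ideal.absNorm I := Real.rpow_inv_natCast_pow hN.le hd.ne'
  have hρr : ρ ≤ r := by
    rw [← hρd] at hr
    exact le_of_pow_le_pow_left₀ hd.ne' hr0 hr
  have hinj : Function.Injective (archEmbedding K n) := fun x y h => funext fun i =>
    RingOfIntegers.coe_injective (mixedEmbedding_injective K (congrFun h i))
  set S := {x : Fin (n + 1) → 𝓞 K | (∀ i, x i ∈ I) ∧ archEmbedding K n x ∈ Metric.closedBall 0 r}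
  have hS : S.Finite := by
    have := (isFundamentalTile_archTile K n).finite
      (Metric.isBounded_closedBall (x := (0 : Fin (n + 1) → mixedEmbedding.mixedSpace K)) (r := r)) 1
    rw [one_smul] at this
    exact this.subset fun x hx => hx.2
  have h := card_le_of_separated (s := hS.toFinset.image (archEmbedding K n)) hρ0 hρr
    (fun y hy => by
      obtain ⟨x, hx, rfl⟩ := Finset.mem_image.1 hy
      exact mem_closedBall_zero_iff.1 (hS.mem_toFinset.1 hx).2)
    (fun y hy z hz hyz => by
      obtain ⟨x, hx, rfl⟩ := Finset.mem_image.1 hy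
      obtain ⟨x', hx', rfl⟩ := Finset.mem_image.1 hz
      rw [dist_eq_norm, ← map_sub]
      refine le_of_pow_le_pow_left₀ hd.ne' (norm_nonneg _) ?_
      rw [hρd]
      refine absNorm_le_norm_archEmbedding_pow (fun i => I.sub_mem ((hS.mem_toFinset.1 hx).1 i)
        ((hS.mem_toFinset.1 hx').1 i)) fun h0 => hyz ?_
      rw [sub_eq_zero.1 h0])
  rw [Finset.card_image_of_injective _ hinj, finrank_pi_mixedSpace, div_pow, pow_mul ρ, hρd,
    div_eq_mul_inv, ← Set.ncard_eq_toFinset_card S hS] at h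
  exact h

/-- Few integral points have all their coordinates in a common prime of large norm. -/
theorem exists_primitive_tail_le (hn : 0 < n) (R : ℝ) {ε : ℝ} (hε : 0 < ε) :
    ∃ M₀ : ℕ, ∀ M ≥ M₀, ∀ᶠ T : ℝ in atTop,
    ({x : Fin (n + 1) → 𝓞 K | (∃ v : HeightOneSpectrum (𝓞 K), M < Ideal.absNorm v.asIdeal ∧
      ∀ i, x i ∈ v.asIdeal) ∧ archEmbedding K n x ∈ T • Metric.closedBall 0 R}.ncard : ℝ) /
        T ^ (Module.finrank ℚ K * (n + 1)) ≤ ε := by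
  set D := Module.finrank ℚ K * (n + 1) with hD
  have hD0 : D ≠ 0 := (Nat.mul_pos Module.finrank_pos n.succ_pos).ne'
  set R' := max R 1 with hR'
  have hR'0 : 0 < R' := lt_max_of_lt_right one_pos
  set f : HeightOneSpectrum (𝓞 K) → ℝ := fun v => ((Ideal.absNorm v.asIdeal : ℝ) ^ (n + 1))⁻¹ with hf
  -- The exponent `n + 1` is at least `2`; this is where `n > 0` matters.
  have hsum : Summable f := summable_absNorm_inv_pow (by lia)
  have hlim : Tendsto (fun M => (3 * R') ^ D * ∑' v : {v // v ∉ primesLE K M}, f v) atTop (𝓝 0) := by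
    have := ((tendsto_tsum_compl_atTop_zero f).comp tendsto_primesLE).const_mul ((3 * R') ^ D)
    rwa [mul_zero] at this
  obtain ⟨M₀, hM₀⟩ := eventually_atTop.1 ((tendsto_order.1 hlim).2 (ε / 2) (by positivity))
  refine ⟨M₀, fun M hM => ?_⟩
  -- The zero vector lies in every prime. It is counted once, on its own, at cost `1 / T ^ D`.
  have hinv : Tendsto (fun T : ℝ => 1 / T ^ D) atTop (𝓝 0) :=
    tendsto_const_nhds.div_atTop (tendsto_pow_atTop hD0)
  filter_upwards [(tendsto_order.1 hinv).2 (ε / 2) (by positivity), eventually_gt_atTop 0]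
    with T hT hT0
  -- Only these finitely many primes matter: a nonzero vector of norm at most `T * R'` cannot have
  -- all its coordinates in a prime of norm exceeding `(T * R') ^ d`.
  set F := primesLE K ⌊(T * R') ^ Module.finrank ℚ K⌋₊ \ primesLE K M with hF
  set S : HeightOneSpectrum (𝓞 K) → Set (Fin (n + 1) → 𝓞 K) := fun v =>
    {x | (∀ i, x i ∈ v.asIdeal) ∧ archEmbedding K n x ∈ Metric.closedBall 0 (T * R')} with hS
  have hsub : {x : Fin (n + 1) → 𝓞 K | (∃ v : HeightOneSpectrum (𝓞 K),
      M < Ideal.absNorm v.asIdeal ∧ ∀ i, x i ∈ v.asIdeal) ∧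
      archEmbedding K n x ∈ T • Metric.closedBall 0 R} ⊆ {0} ∪ ⋃ v ∈ F, S v := by
    rintro x ⟨⟨v, hvM, hv⟩, hx⟩
    by_cases hx0 : x = 0
    · exact Or.inl hx0
    have hx' : archEmbedding K n x ∈ Metric.closedBall 0 (T * R') := by
      obtain ⟨y, hy, hyx⟩ := hx
      rw [← hyx, mem_closedBall_zero_iff]
      change ‖T • y‖ ≤ _
      rw [norm_smul, Real.norm_of_nonneg hT0.le]
      have := (mem_closedBall_zero_iff.1 hy).trans (le_max_left R 1)
      gcongr
    refine Or.inr (mem_biUnion (Finset.mem_coe.2 (Finset.mem_sdiff.2 ⟨?_, ?_⟩)) ⟨hv, hx'⟩)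
    · rw [mem_primesLE]
      refine Nat.le_floor ((absNorm_le_norm_archEmbedding_pow hv hx0).trans ?_)
      gcongr
      exact mem_closedBall_zero_iff.1 hx'
    · rw [mem_primesLE]
      exact not_le.2 hvM
  have hfinS : ∀ v, (S v).Finite := fun v => by
    have := (isFundamentalTile_archTile K n).finite (Metric.isBounded_closedBall
      (x := (0 : Fin (n + 1) → mixedEmbedding.mixedSpace K)) (r := T * R')) 1
    rw [one_smul] at this
    exact this.subset fun x hx => hx.2
  have hfinU : (⋃ v ∈ F, S v).Finite := F.finite_toSet.biUnion fun v _ => hfinS v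
  have hcard : ({x : Fin (n + 1) → 𝓞 K | (∃ v : HeightOneSpectrum (𝓞 K),
      M < Ideal.absNorm v.asIdeal ∧ ∀ i, x i ∈ v.asIdeal) ∧
      archEmbedding K n x ∈ T • Metric.closedBall 0 R}.ncard : ℝ) ≤
      1 + ∑ v ∈ F, (3 * (T * R')) ^ D * f v := by
    have h1 := (Set.ncard_le_ncard hsub ((Set.finite_singleton 0).union hfinU)).trans
      ((Set.ncard_union_le _ _).trans (Nat.add_le_add_left (F.set_ncard_biUnion_le S) _))
    rw [Set.ncard_singleton] at h1
    refine (Nat.cast_le.2 h1).trans ?_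
    push_cast
    gcongr with v hv
    refine ncard_mem_ideal_le v.ne_bot (by positivity) ?_
    rw [Finset.mem_sdiff, mem_primesLE] at hv
    exact (Nat.le_floor_iff (by positivity)).1 hv.1
  have hsumF : ∑ v ∈ F, f v ≤ ∑' v : {v // v ∉ primesLE K M}, f v := by
    have hs : Summable fun v : {v // v ∉ primesLE K M} => f v := hsum.subtype _
    have := hs.sum_le_tsum (F.subtype fun v => v ∉ primesLE K M) fun v _ => by positivity
    refine le_trans (le_of_eq ?_) this
    rw [Finset.sum_subtype_of_mem (f := f)]
    exact fun v hv => (Finset.mem_sdiff.1 hv).2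
  rw [div_le_iff₀ (by positivity)]
  have hTD : 0 < T ^ D := by positivity
  rw [div_lt_iff₀ hTD] at hT
  have h5 := hM₀ M hM
  have e : ∑ v ∈ F, (3 * (T * R')) ^ D * f v = (3 * R') ^ D * (∑ v ∈ F, f v) * T ^ D := by
    rw [← Finset.mul_sum, show 3 * (T * R') = (3 * R') * T by ring, mul_pow]
    ring
  rw [e] at hcard
  have h6 : (3 * R') ^ D * (∑ v ∈ F, f v) ≤ ε / 2 :=
    (mul_le_mul_of_nonneg_left hsumF (by positivity)).trans h5.le
  have h7 := mul_le_mul_of_nonneg_right h6 hTD.le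
  linarith

end PrimitiveTail
end EkedahlSieve
end

noncomputable section
namespace EkedahlSieve

/-! ### Invariance of affine cones under scaling -/

section Cone

variable {F : Type*} [Field F] {n : ℕ} {Ω : Set (PSpace F n)}

theorem smul_mem_affineCone_iff {t : F} (ht : t ≠ 0) {x : Fin (n + 1) → F} :
    t • x ∈ affineCone Ω ↔ x ∈ affineCone Ω := by
  have key : ∀ {s : F} (_ : s ≠ 0) {y : Fin (n + 1) → F}, y ∈ affineCone Ω → s • y ∈ affineCone Ω := by
    rintro s hs y ⟨hy, h⟩
    refine ⟨smul_ne_zero hs hy, ?_⟩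
    rwa [(Projectivization.mk_eq_mk_iff' F (s • y) y (smul_ne_zero hs hy) hy).2 ⟨s, rfl⟩]
  refine ⟨fun h => ?_, key ht⟩
  simpa [smul_smul, ht] using key (inv_ne_zero ht) h

theorem units_smul_affineCone (u : Fˣ) : u • affineCone Ω = affineCone Ω := by
  ext x
  rw [Set.mem_smul_set_iff_inv_smul_mem, Units.smul_def, smul_mem_affineCone_iff (Units.ne_zero _)]

theorem affineCone_univ : affineCone (univ : Set (PSpace F n)) = {0}ᶜ := by
  ext x
  exact ⟨fun ⟨hx, _⟩ => hx, fun hx => ⟨hx, mem_univ _⟩⟩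

theorem frontier_affineCone_univ_subset [TopologicalSpace F] [T1Space F] :
    frontier (affineCone (univ : Set (PSpace F n))) ⊆ {0} := by
  rw [affineCone_univ, frontier_compl]
  exact isClosed_singleton.frontier_subset

theorem mem_affineCone_mk {x : Fin (n + 1) → F} (hx : x ≠ 0) :
    x ∈ affineCone Ω ↔ Projectivization.mk F x hx ∈ Ω :=
  ⟨fun ⟨_, h⟩ => h, fun h => ⟨hx, h⟩⟩

end Cone

/-! ### Densities of cones at a prime -/

section Local

variable {K : Type*} [Field K] [NumberField K] (v : HeightOneSpectrum (𝓞 K)) {n : ℕ}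
  {Ω : Set (PSpace (v.adicCompletion K) n)}

theorem exists_unit_valued_eq (k : ℕ) :
    ∃ u : (v.adicCompletion K)ˣ, Valued.v (u : v.adicCompletion K) = WithZero.exp (-(k : ℤ)) := by
  obtain ⟨π, hπ⟩ := v.valuation_exists_uniformizer K
  have h : Valued.v (algebraMap K (v.adicCompletion K) π) = v.valuation K π :=
    HeightOneSpectrum.valuedAdicCompletion_eq_valuation' v π
  have h' : Valued.v (algebraMap K (v.adicCompletion K) π ^ k) = WithZero.exp (-(k : ℤ)) := by
    rw [map_pow, h, hπ, ← WithZero.exp_nsmul]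
    simp
  refine ⟨Units.mk0 _ fun h0 => ?_, h'⟩
  rw [h0, map_zero] at h'
  exact WithZero.exp_ne_zero h'.symm

theorem units_smul_congruenceSubgroup {k : ℕ} {u : (v.adicCompletion K)ˣ}
    (hu : Valued.v (u : v.adicCompletion K) = WithZero.exp (-(k : ℤ))) :
    u • (congruenceSubgroup v n 0 : Set (Fin (n + 1) → v.adicCompletion K)) =
      congruenceSubgroup v n k := by
  ext x
  rw [Set.mem_smul_set_iff_inv_smul_mem, SetLike.mem_coe, SetLike.mem_coe, mem_congruenceSubgroup,
    mem_congruenceSubgroup]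
  refine forall_congr' fun i => ?_
  rw [Pi.smul_apply, Units.smul_def, smul_eq_mul, map_mul, Units.val_inv_eq_inv_val, map_inv₀, hu,
    inv_mul_le_iff₀ (by simp)]
  simp

theorem padicMeasure_units_smul_eq_zero {u : (v.adicCompletion K)ˣ}
    {s : Set (Fin (n + 1) → v.adicCompletion K)} (hs : padicMeasure K n v s = 0) :
    padicMeasure K n v (u • s) = 0 := by
  rw [← distribHaarChar_mul, hs, mul_zero]

/-- Multiplication by an element of valuation `k` carries the integral vectors to the vectors of
level `k`, preserves the cone, and multiplies all measures by the same factor. -/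
theorem padicMeasure_affineCone_inter (Ω : Set (PSpace (v.adicCompletion K) n)) (k : ℕ) :
    padicMeasure K n v (affineCone Ω ∩ congruenceSubgroup v n k) =
      padicMeasure K n v (congruenceSubgroup v n k) *
        padicMeasure K n v (affineCone Ω ∩ congruenceSubgroup v n 0) := by
  obtain ⟨u, hu⟩ := exists_unit_valued_eq v k
  rw [← units_smul_congruenceSubgroup v hu, ← units_smul_affineCone (Ω := Ω) u,
    ← Set.smul_set_inter, units_smul_affineCone, ← distribHaarChar_mul, ← distribHaarChar_mul,
    padicMeasure_congruenceSubgroup_zero, mul_one]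

/-- The points of the cone over `Ω` whose coordinates generate the `k`-th power of the maximal
ideal. -/
def primitiveCone (Ω : Set (PSpace (v.adicCompletion K) n)) (k : ℕ) :
    Set (Fin (n + 1) → v.adicCompletion K) :=
  affineCone Ω ∩ ((congruenceSubgroup v n k : Set (Fin (n + 1) → v.adicCompletion K)) \
    congruenceSubgroup v n (k + 1))

theorem primitiveCone_subset (k : ℕ) : primitiveCone v Ω k ⊆ congruenceSubgroup v n 0 :=
  fun _ hx => congruenceSubgroup_antitone v n (Nat.zero_le k) hx.2.1

theorem isClopen_congruenceSubgroup (k : ℕ) :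
    IsClopen (congruenceSubgroup v n k : Set (Fin (n + 1) → v.adicCompletion K)) :=
  ⟨AddSubgroup.isClosed_of_isOpen _ (isOpen_congruenceSubgroup v n k), isOpen_congruenceSubgroup v n k⟩

/-- The shell is clopen, so intersecting with it creates no new boundary. -/
theorem padicMeasure_frontier_primitiveCone
    (h : padicMeasure K n v (frontier (affineCone Ω)) = 0) (k : ℕ) :
    padicMeasure K n v (frontier (primitiveCone v Ω k)) = 0 := by
  refine measure_mono_null ?_ h
  have hc := ((isClopen_congruenceSubgroup v k).diff (isClopen_congruenceSubgroup (n := n) v (k + 1)))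
  refine (frontier_inter_subset _ _).trans ?_
  rw [hc.frontier_eq, inter_empty, union_empty]
  exact inter_subset_left

variable (n) in
/-- The measure of the vectors whose coordinates generate the `k`-th power of the maximal ideal. -/
def shellMeasure (k : ℕ) : ℝ :=
  (padicMeasure K n v).real ((congruenceSubgroup v n k : Set (Fin (n + 1) → v.adicCompletion K)) \
    congruenceSubgroup v n (k + 1))

theorem padicMeasure_congruenceSubgroup_ne_top (k : ℕ) :
    padicMeasure K n v (congruenceSubgroup v n k) ≠ ∞ :=
  ne_top_of_le_ne_top ENNReal.one_ne_top ((measure_mono (congruenceSubgroup_antitone v n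
    (Nat.zero_le k))).trans_eq (padicMeasure_congruenceSubgroup_zero v n))

variable (n) in
theorem shellMeasure_pos (k : ℕ) : 0 < shellMeasure v n k := by
  refine ENNReal.toReal_pos (IsOpen.measure_ne_zero _ ((isClopen_congruenceSubgroup v k).diff
    (isClopen_congruenceSubgroup v (k + 1))).isOpen ?_)
    (measure_ne_top_of_subset sdiff_subset (padicMeasure_congruenceSubgroup_ne_top v k))
  obtain ⟨u, hu⟩ := exists_unit_valued_eq v k
  refine ⟨fun _ => u, fun _ => hu.le, fun h => ?_⟩
  have := (h 0)
  rw [hu, WithZero.exp_le_exp] at this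
  lia

theorem padicDensity_eq : padicDensity v Ω =
    (padicMeasure K n v).real (affineCone Ω ∩ congruenceSubgroup v n 0) := by
  have h : {x | x ∈ affineCone Ω ∧ ∀ i, x i ∈ v.adicCompletionIntegers K} =
      affineCone Ω ∩ congruenceSubgroup v n 0 :=
    Set.ext fun x => and_congr_right fun _ => (mem_congruenceSubgroup_zero v).symm
  rw [padicDensity, h]

/-- The cone has the same proportion in every congruence subgroup, hence in the difference of two
consecutive ones. The density of the cone thereby separates from the factor depending on the ideal.
-/
theorem padicMeasure_real_primitiveCone (Ω : Set (PSpace (v.adicCompletion K) n)) (k : ℕ) :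
    (padicMeasure K n v).real (primitiveCone v Ω k) = shellMeasure v n k * padicDensity v Ω := by
  have h : ∀ k, (padicMeasure K n v).real (affineCone Ω ∩ congruenceSubgroup v n k) =
      (padicMeasure K n v).real (congruenceSubgroup v n k) * padicDensity v Ω := fun k => by
    rw [padicDensity_eq, measureReal_def, padicMeasure_affineCone_inter, ENNReal.toReal_mul]
    rfl
  have hm := (isOpen_congruenceSubgroup v n (k + 1)).measurableSet
  have hs := congruenceSubgroup_antitone v n (Nat.le_succ k)
  have htop : padicMeasure K n v (affineCone Ω ∩ congruenceSubgroup v n k) ≠ ∞ :=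
    measure_ne_top_of_subset inter_subset_right (padicMeasure_congruenceSubgroup_ne_top v k)
  have h2 := measureReal_inter_add_sdiff (μ := padicMeasure K n v)
    (s := affineCone Ω ∩ congruenceSubgroup v n k) hm htop
  rw [Set.inter_assoc, Set.inter_eq_right.2 hs, inter_sdiff_assoc, h, h] at h2
  rw [primitiveCone, shellMeasure, measureReal_sdiff hs hm (padicMeasure_congruenceSubgroup_ne_top v k),
    sub_mul, ← h2, add_sub_cancel_left]

theorem padicDensity_nonneg : 0 ≤ padicDensity v Ω := measureReal_nonneg

theorem padicDensity_le_one : padicDensity v Ω ≤ 1 := by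
  rw [padicDensity_eq]
  exact padicMeasure_real_le_one (U := fun v => congruenceSubgroup v n 0) (fun _ => le_rfl) v |>.trans' (measureReal_mono inter_subset_right (padicMeasure_congruenceSubgroup_ne_top v 0))

/-- Clearing denominators writes the cone as a countable union of scalar multiples of its integral
part. Were that part null, the whole cone would be null. -/
theorem padicDensity_pos (h : 0 < padicMeasure K n v (affineCone Ω)) : 0 < padicDensity v Ω := by
  rw [padicDensity_eq]
  refine ENNReal.toReal_pos (fun h0 => h.ne' ?_)
    (measure_ne_top_of_subset inter_subset_right (padicMeasure_congruenceSubgroup_ne_top v 0))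
  choose u hu using exists_unit_valued_eq v
  refine measure_mono_null (t := ⋃ k, (u k)⁻¹ • (affineCone Ω ∩ congruenceSubgroup v n 0)) ?_
    (measure_iUnion_null fun k => padicMeasure_units_smul_eq_zero v h0)
  intro x hx
  obtain ⟨k, hk⟩ : ∃ k : ℕ, ∀ i, Valued.v (x i) ≤ WithZero.exp (k : ℤ) := by
    have hi : ∀ i, ∃ k : ℕ, Valued.v (x i) ≤ WithZero.exp (k : ℤ) := fun i => by
      by_cases h0 : x i = 0
      · exact ⟨0, by simp [h0]⟩
      · refine ⟨(WithZero.log (Valued.v (x i))).toNat, ?_⟩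
        rw [← WithZero.log_le_iff_le_exp ((Valuation.ne_zero_iff _).2 h0)]
        exact Int.self_le_toNat _
    choose k hk using hi
    refine ⟨Finset.univ.sup k, fun i => (hk i).trans ?_⟩
    rw [WithZero.exp_le_exp]
    exact_mod_cast Finset.le_sup (f := k) (Finset.mem_univ i)
  refine mem_iUnion.2 ⟨k, Set.mem_smul_set_iff_inv_smul_mem.2 ⟨?_, ?_⟩⟩
  · rw [inv_inv, Units.smul_def, smul_mem_affineCone_iff (Units.ne_zero _)]
    exact hx
  · intro i
    rw [inv_inv, Pi.smul_apply, Units.smul_def, smul_eq_mul, map_mul, hu]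
    refine (mul_le_mul_right (hk i) _).trans ?_
    rw [← WithZero.exp_add]
    simp

/-- Since the space is not discrete, its Haar measure has no atoms, so the missing vertex of a cone
is negligible. -/
instance : (𝓝[≠] (0 : Fin (n + 1) → v.adicCompletion K)).NeBot := by
  refine mem_closure_iff_nhdsWithin_neBot.1 (mem_closure_iff_nhds.2 fun t ht => ?_)
  obtain ⟨k, hk⟩ := exists_congruenceSubgroup_subset v n ht
  obtain ⟨u, hu⟩ := exists_unit_valued_eq v k
  exact ⟨fun _ => u, hk fun _ => hu.le, fun h => u.ne_zero (congrFun h 0)⟩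

theorem padicDensity_univ : padicDensity v (univ : Set (PSpace (v.adicCompletion K) n)) = 1 := by
  rw [padicDensity_eq, affineCone_univ, ← Set.sdiff_eq_compl_inter, measureReal_def,
    measure_sdiff_null (measure_singleton _), padicMeasure_congruenceSubgroup_zero, ENNReal.toReal_one]

end Local

/-! ### Prescribing the ideal generated by the coordinates -/

section Global

variable {K : Type*} [Field K] [NumberField K] {n : ℕ}
  {Ω : ∀ v : HeightOneSpectrum (𝓞 K), Set (PSpace (v.adicCompletion K) n)}

theorem toCompletion_mem_congruenceSubgroup {v : HeightOneSpectrum (𝓞 K)} {x : Fin (n + 1) → 𝓞 K}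
    {k : ℕ} : toCompletion v x ∈ congruenceSubgroup v n k ↔
      v.asIdeal ^ k ∣ Ideal.span (range x) := by
  rw [mem_congruenceSubgroup, Ideal.dvd_iff_le, Ideal.span_le, range_subset_iff]
  refine forall_congr' fun i => ?_
  have h : Valued.v (toCompletion v x i) = v.valuation K (x i : K) :=
    HeightOneSpectrum.valuedAdicCompletion_eq_valuation' v _
  rw [h, SetLike.mem_coe, ← HeightOneSpectrum.intValuation_le_pow_iff_mem,
    ← HeightOneSpectrum.valuation_of_algebraMap (K := K)]

theorem ideal_eq_iff_forall_pow_dvd {I J : Ideal (𝓞 K)} (hJ : J ≠ ⊥) :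
    I = J ↔ ∀ v : HeightOneSpectrum (𝓞 K), v.asIdeal ^ multiplicity v.asIdeal J ∣ I ∧
      ¬ v.asIdeal ^ (multiplicity v.asIdeal J + 1) ∣ I := by
  have hfin : ∀ v : HeightOneSpectrum (𝓞 K), FiniteMultiplicity v.asIdeal J := fun v =>
    FiniteMultiplicity.of_prime_left v.prime hJ
  constructor
  · rintro rfl v
    exact ⟨pow_multiplicity_dvd _ _, (hfin v).not_pow_dvd_of_multiplicity_lt (Nat.lt_succ_self _)⟩
  · intro h
    -- Some prime must exist: the zero ideal is divisible by every power, and is excluded by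
    -- non-divisibility at one prime.
    obtain ⟨v₀⟩ : Nonempty (HeightOneSpectrum (𝓞 K)) := by
      obtain ⟨P, hP⟩ := Ideal.exists_maximal (𝓞 K)
      exact ⟨⟨P, hP.isPrime, Ring.ne_bot_of_isMaximal_of_not_isField hP
        (RingOfIntegers.not_isField K)⟩⟩
    have hI : I ≠ ⊥ := fun h0 => (h v₀).2 (h0 ▸ dvd_zero _)
    refine associated_iff_eq.1
      ((UniqueFactorizationMonoid.associated_iff_normalizedFactors_eq_normalizedFactors hI hJ).2
        (Multiset.ext.2 fun P => ?_))
    by_cases hP : P ∈ UniqueFactorizationMonoid.normalizedFactors I ∨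
        P ∈ UniqueFactorizationMonoid.normalizedFactors J
    · have hP' : Prime P := hP.elim (UniqueFactorizationMonoid.prime_of_normalized_factor P)
        (UniqueFactorizationMonoid.prime_of_normalized_factor P)
      let v : HeightOneSpectrum (𝓞 K) := ⟨P, Ideal.isPrime_of_prime hP', hP'.ne_zero⟩
      have hn := normalize_eq P
      rw [← Nat.cast_inj (R := ℕ∞)]
      have h1 := UniqueFactorizationMonoid.emultiplicity_eq_count_normalizedFactors hP'.irreducible hI
      have h2 := UniqueFactorizationMonoid.emultiplicity_eq_count_normalizedFactors hP'.irreducible hJ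
      rw [hn] at h1 h2
      rw [← h1, ← h2, (hfin v).emultiplicity_eq_multiplicity]
      exact emultiplicity_eq_coe.2 (h v)
    · rw [not_or] at hP
      rw [Multiset.count_eq_zero.2 hP.1, Multiset.count_eq_zero.2 hP.2]

/-- By unique factorization, generating `J` is a condition on the exact exponent at each prime
separately. A global normalisation is thereby put in the form that the sieve accepts. -/
theorem forall_mem_primitiveCone_iff {x : Fin (n + 1) → 𝓞 K} {J : Ideal (𝓞 K)} (hJ : J ≠ ⊥) :
    (∀ v, toCompletion v x ∈ primitiveCone v (Ω v) (multiplicity v.asIdeal J)) ↔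
      Ideal.span (range x) = J ∧ ∀ v, toCompletion v x ∈ affineCone (Ω v) := by
  rw [ideal_eq_iff_forall_pow_dvd hJ, and_comm, ← forall_and]
  refine forall_congr' fun v => and_congr_right fun _ => ?_
  rw [← toCompletion_mem_congruenceSubgroup, ← toCompletion_mem_congruenceSubgroup]
  rfl

theorem multiplicity_eq_zero_of_absNorm_lt {v : HeightOneSpectrum (𝓞 K)} {J : Ideal (𝓞 K)}
    (hJ : J ≠ ⊥) (h : Ideal.absNorm J < Ideal.absNorm v.asIdeal) : multiplicity v.asIdeal J = 0 := by
  refine multiplicity_eq_zero.2 fun hd => h.not_ge (Nat.le_of_dvd ?_ (map_dvd Ideal.absNorm hd))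
  exact Nat.pos_of_ne_zero (Ideal.absNorm_eq_zero_iff.not.2 hJ)

theorem TailCondition.smallTail (h : TailCondition Ω) :
    SmallTail fun v => affineCone (Ω v) := by
  classical
  intro R ε hε
  -- The tail condition concerns sets of positive measure, so the ball is enlarged to have positive
  -- radius.
  set R' := max R 1 with hR'
  have hR'0 : 0 < R' := lt_max_of_lt_right one_pos
  have hlim := h (Metric.closedBall 0 R') Metric.isBounded_closedBall
    (Metric.measure_closedBall_pos _ _ hR'0) ((convex_closedBall _ _).addHaar_frontier _)
  obtain ⟨M, hM⟩ := ((tendsto_order.1 hlim).2 (ENNReal.ofReal ε) (ENNReal.ofReal_pos.2 hε)).exists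
  refine ⟨M, ?_⟩
  filter_upwards [eventually_lt_of_limsup_lt hM, eventually_gt_atTop 0] with T hT hT0
  have hfin : (tailPoints Ω (Metric.closedBall 0 R') M T).Finite :=
    ((isFundamentalTile_archTile K n).finite
      (Metric.isBounded_closedBall (x := 0) (r := R')) T).subset fun x hx => hx.1
  have hsub : {x : Fin (n + 1) → 𝓞 K | (∃ v : HeightOneSpectrum (𝓞 K), M < Ideal.absNorm v.asIdeal ∧
      toCompletion v x ∉ affineCone (Ω v)) ∧ archEmbedding K n x ∈ T • Metric.closedBall 0 R} ⊆
      tailPoints Ω (Metric.closedBall 0 R') M T := fun x hx =>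
    ⟨Set.smul_set_mono (Metric.closedBall_subset_closedBall (le_max_left _ _)) hx.2, hx.1⟩
  have h1 := Set.ncard_le_ncard hsub hfin
  refine (div_le_div_of_nonneg_right (Nat.cast_le.2 h1) (by positivity)).trans ?_
  rw [← hfin.cast_ncard_eq, ENat.toENNReal_coe, ← ENNReal.ofReal_natCast,
    ← ENNReal.ofReal_div_of_pos (by positivity), ENNReal.ofReal_lt_ofReal_iff hε] at hT
  exact hT.le

open scoped Classical in
/-- Except for points with a common factor, the tail condition for the cones passes to primitive
cones. -/
theorem SmallTail.primitiveCone (hn : 0 < n) {J : Ideal (𝓞 K)} (hJ : J ≠ ⊥)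
    (h : SmallTail fun v => affineCone (Ω v)) :
    SmallTail fun v => primitiveCone v (Ω v) (multiplicity v.asIdeal J) := by
  intro R ε hε
  obtain ⟨M₁, hM₁⟩ := h.exists_forall_ge R (ε / 2) (by positivity)
  obtain ⟨M₂, hM₂⟩ := exists_primitive_tail_le (K := K) hn R (ε := ε / 2) (by positivity)
  -- Beyond `N J` the ideal `J` has exponent zero. Failing the condition there means leaving the
  -- cone or having all coordinates in the prime, and each of the two tails gets half of `ε`.
  set M := max (max M₁ M₂) (Ideal.absNorm J) with hM
  have hMJ : Ideal.absNorm J ≤ M := le_max_right _ _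
  refine ⟨M, ?_⟩
  filter_upwards [hM₁ M ((le_max_left _ _).trans (le_max_left _ _)),
    hM₂ M ((le_max_right _ _).trans (le_max_left _ _)), eventually_gt_atTop 0] with T h1 h2 hT0
  have hfin := (isFundamentalTile_archTile K n).finite
    (Metric.isBounded_closedBall (x := 0) (r := R)) T
  have hsub : {x : Fin (n + 1) → 𝓞 K | (∃ v : HeightOneSpectrum (𝓞 K), M < Ideal.absNorm v.asIdeal ∧
      toCompletion v x ∉ EkedahlSieve.primitiveCone v (Ω v) (multiplicity v.asIdeal J)) ∧
        archEmbedding K n x ∈ T • Metric.closedBall 0 R} ⊆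
      {x : Fin (n + 1) → 𝓞 K | (∃ v : HeightOneSpectrum (𝓞 K), M < Ideal.absNorm v.asIdeal ∧
        toCompletion v x ∉ affineCone (Ω v)) ∧ archEmbedding K n x ∈ T • Metric.closedBall 0 R} ∪
      {x : Fin (n + 1) → 𝓞 K | (∃ v : HeightOneSpectrum (𝓞 K), M < Ideal.absNorm v.asIdeal ∧
        ∀ i, x i ∈ v.asIdeal) ∧ archEmbedding K n x ∈ T • Metric.closedBall 0 R} := by
    rintro x ⟨⟨v, hv, hxv⟩, hx⟩
    by_cases hxA : toCompletion v x ∈ affineCone (Ω v)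
    · refine Or.inr ⟨⟨v, hv, ?_⟩, hx⟩
      rw [multiplicity_eq_zero_of_absNorm_lt hJ (hMJ.trans_lt hv)] at hxv
      by_contra hi
      refine hxv ⟨hxA, toCompletion_mem_congruenceSubgroup.2 (by simp), fun h1 => hi ?_⟩
      rw [SetLike.mem_coe, toCompletion_mem_congruenceSubgroup, zero_add, pow_one,
        Ideal.dvd_iff_le, Ideal.span_le, range_subset_iff] at h1
      exact h1
    · exact Or.inl ⟨⟨v, hv, hxA⟩, hx⟩
  have h3 := (Set.ncard_le_ncard hsub ((hfin.subset fun x hx => hx.2).union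
    (hfin.subset fun x hx => hx.2))).trans (Set.ncard_union_le _ _)
  refine (div_le_div_of_nonneg_right (Nat.cast_le.2 h3) (by positivity)).trans ?_
  push_cast
  rw [add_div]
  linarith

open scoped Classical in
-- Only the zero vector fails, and one point has density zero.
theorem smallTail_affineCone_univ :
    SmallTail fun v : HeightOneSpectrum (𝓞 K) =>
      affineCone (univ : Set (PSpace (v.adicCompletion K) n)) := by
  intro R ε hε
  refine ⟨0, ?_⟩
  have hD0 : Module.finrank ℚ K * (n + 1) ≠ 0 := (Nat.mul_pos Module.finrank_pos n.succ_pos).ne'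
  have hinv : Tendsto (fun T : ℝ => 1 / T ^ (Module.finrank ℚ K * (n + 1))) atTop (𝓝 0) :=
    tendsto_const_nhds.div_atTop (tendsto_pow_atTop hD0)
  filter_upwards [(tendsto_order.1 hinv).2 ε hε, eventually_gt_atTop 0] with T hT hT0
  refine le_trans (div_le_div_of_nonneg_right ?_ (by positivity)) hT.le
  refine (Nat.cast_le.2 (Set.ncard_le_ncard (t := {0}) ?_ (Set.finite_singleton _))).trans_eq
    (by rw [Set.ncard_singleton, Nat.cast_one])
  rintro x ⟨⟨v, -, hv⟩, -⟩
  rw [affineCone_univ, Set.mem_compl_iff, not_not] at hv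
  refine funext fun i => ?_
  have h1 := congrFun hv i
  exact RingOfIntegers.coe_injective
    ((algebraMap K (v.adicCompletion K)).injective (h1.trans (by simp)))

end Global

end EkedahlSieve
end

noncomputable section
namespace EkedahlSieve

/-! ### The distribution of the norm on a cone -/

section ConeMeasure

open Module

theorem measure_ext_of_Iic_ne_top {ρ σ : Measure ℝ} (hfin : ∀ r, σ (Iic r) ≠ ∞)
    (h : ∀ r, ρ (Iic r) = σ (Iic r)) : ρ = σ := by
  refine Measure.ext_of_Ioc' ρ σ (fun a b _ => ?_) fun a b hab => ?_
  · exact measure_ne_top_of_subset Ioc_subset_Iic_self (h b ▸ hfin b)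
  · rw [← Iic_sdiff_Iic, measure_sdiff (Iic_subset_Iic.2 hab.le) nullMeasurableSet_Iic (h a ▸ hfin a),
      measure_sdiff (Iic_subset_Iic.2 hab.le) nullMeasurableSet_Iic (hfin a), h a, h b]

theorem sigmaFinite_smul {α : Type*} [MeasurableSpace α] {μ : Measure α} [SigmaFinite μ] {c : ℝ≥0∞}
    (hc : c ≠ ∞) : SigmaFinite (c • μ) := by
  rw [← ENNReal.coe_toNNReal hc]
  exact inferInstanceAs (SigmaFinite (c.toNNReal • μ))

set_option linter.unusedSectionVars false

variable {V : Type*} [NormedAddCommGroup V] [NormedSpace ℝ V] [FiniteDimensional ℝ V]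
  [Nontrivial V] [MeasurableSpace V] [BorelSpace V] (μ : Measure V) [μ.IsAddHaarMeasure]

theorem measure_cone_inter_closedBall {A : Set V} (hA : ∀ r : ℝ, 0 < r → r • A = A) (r : ℝ) :
    μ (A ∩ Metric.closedBall 0 r) =
      ENNReal.ofReal r ^ finrank ℝ V * μ (A ∩ Metric.closedBall 0 1) := by
  have hk : finrank ℝ V ≠ 0 := finrank_pos.ne'
  rcases lt_trichotomy r 0 with hr | rfl | hr
  · rw [Metric.closedBall_eq_empty.2 hr, inter_empty, measure_empty, ENNReal.ofReal_of_nonpos hr.le,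
      zero_pow hk, zero_mul]
  · rw [Metric.closedBall_zero, measure_mono_null inter_subset_right (measure_singleton _),
      ENNReal.ofReal_zero, zero_pow hk, zero_mul]
  · have h : A ∩ Metric.closedBall 0 r = r • (A ∩ Metric.closedBall 0 1) := by
      rw [Set.smul_set_inter₀ hr.ne', hA r hr, smul_closedBall' hr.ne', smul_zero, mul_one,
        Real.norm_of_nonneg hr.le]
    rw [h, Measure.addHaar_smul_of_nonneg _ hr.le, ENNReal.ofReal_pow hr.le]

/-- The proportion of the unit ball that lies in `A`. -/
def coneDensity (A : Set V) : ℝ≥0∞ := μ (A ∩ Metric.closedBall 0 1) / μ (Metric.closedBall 0 1)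

theorem coneDensity_ne_top (A : Set V) : coneDensity μ A ≠ ∞ :=
  ENNReal.div_ne_top (measure_ne_top_of_subset inter_subset_right measure_closedBall_lt_top.ne)
    (Metric.measure_closedBall_pos μ _ one_pos).ne'

/-- By homogeneity a cone fills the same proportion of every centred ball, and these balls determine
the distribution of the norm. -/
theorem map_norm_restrict_cone {A : Set V} (hA : ∀ r : ℝ, 0 < r → r • A = A) :
    (μ.restrict A).map norm = coneDensity μ A • μ.map norm := by
  have hm : Measurable (norm : V → ℝ) := measurable_norm
  have hpre : ∀ r : ℝ, norm ⁻¹' Iic r = Metric.closedBall (0 : V) r := fun r => by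
    ext x; simp
  refine measure_ext_of_Iic_ne_top (fun r => ?_) fun r => ?_
  · rw [Measure.smul_apply, Measure.map_apply hm measurableSet_Iic, hpre, smul_eq_mul]
    exact ENNReal.mul_ne_top (coneDensity_ne_top μ A) measure_closedBall_lt_top.ne
  · have h1 := measure_cone_inter_closedBall μ (A := univ)
      (fun r hr => Set.smul_set_univ₀ hr.ne') r
    rw [univ_inter, univ_inter] at h1
    rw [Measure.smul_apply, Measure.map_apply hm measurableSet_Iic,
      Measure.map_apply hm measurableSet_Iic, hpre, smul_eq_mul, h1, coneDensity,
      Measure.restrict_apply measurableSet_closedBall, inter_comm,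
      measure_cone_inter_closedBall μ hA r, mul_left_comm,
      ENNReal.div_mul_cancel (Metric.measure_closedBall_pos μ _ one_pos).ne'
        measure_closedBall_lt_top.ne]

/-- The ball of radius `s` has measure proportional to `s ^ finrank ℝ V`, so this power of the norm
is uniformly distributed on the half-line. -/
theorem map_norm_pow :
    μ.map (fun x => ‖x‖ ^ finrank ℝ V) =
      μ (Metric.closedBall 0 1) • (volume : Measure ℝ).restrict (Ici 0) := by
  have hk : finrank ℝ V ≠ 0 := finrank_pos.ne'
  have hm : Measurable fun x : V => ‖x‖ ^ finrank ℝ V := by fun_prop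
  have hv : ∀ r : ℝ, (volume.restrict (Ici 0)) (Iic r) = ENNReal.ofReal r := fun r => by
    rw [Measure.restrict_apply measurableSet_Iic, inter_comm, Ici_inter_Iic, Real.volume_Icc, sub_zero]
  refine measure_ext_of_Iic_ne_top (fun r => ?_) fun r => ?_
  · rw [Measure.smul_apply, hv, smul_eq_mul]
    exact ENNReal.mul_ne_top measure_closedBall_lt_top.ne ENNReal.ofReal_ne_top
  · rw [Measure.smul_apply, hv, smul_eq_mul, Measure.map_apply hm measurableSet_Iic]
    rcases lt_or_ge r 0 with hr | hr
    · rw [ENNReal.ofReal_of_nonpos hr.le, mul_zero]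
      convert! measure_empty (μ := μ)
      exact Set.eq_empty_of_forall_notMem fun x hx => (lt_of_lt_of_le hr (by positivity)).not_ge hx
    · obtain ⟨s, hs, rfl⟩ : ∃ s : ℝ, 0 ≤ s ∧ s ^ finrank ℝ V = r :=
        ⟨r ^ ((finrank ℝ V : ℝ)⁻¹), Real.rpow_nonneg hr _, Real.rpow_inv_natCast_pow hr hk⟩
      have hpre : (fun x : V => ‖x‖ ^ finrank ℝ V) ⁻¹' Iic (s ^ finrank ℝ V) =
          Metric.closedBall (0 : V) s := by
        ext x
        rw [mem_closedBall_zero_iff]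
        exact pow_le_pow_iff_left₀ (norm_nonneg _) hs hk
      have h1 := measure_cone_inter_closedBall μ (A := univ)
        (fun r hr => Set.smul_set_univ₀ hr.ne') s
      rw [univ_inter, univ_inter] at h1
      rw [hpre, h1, ENNReal.ofReal_pow hs, mul_comm]

end ConeMeasure

/-! ### The distribution of the vector of norms on a product of cones -/

section ConeProduct

set_option linter.unusedSectionVars false

open Module

variable {ι : Type*} [Fintype ι] {V : ι → Type*} [∀ i, NormedAddCommGroup (V i)]
  [∀ i, NormedSpace ℝ (V i)] [∀ i, FiniteDimensional ℝ (V i)] [∀ i, Nontrivial (V i)]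
  [∀ i, MeasurableSpace (V i)] [∀ i, BorelSpace (V i)] (μ : ∀ i, Measure (V i))
  [∀ i, (μ i).IsAddHaarMeasure]

/-- The vector of the norms of the components. -/
def norms (x : ∀ i, V i) : ι → ℝ := fun i => ‖x i‖

theorem continuous_norms : Continuous (norms (V := V)) :=
  continuous_pi fun i => (continuous_apply i).norm

instance sigmaFinite_map_norm {W : Type*} [NormedAddCommGroup W] [NormedSpace ℝ W]
    [FiniteDimensional ℝ W] [MeasurableSpace W] [BorelSpace W] (μ : Measure W)
    [μ.IsAddHaarMeasure] : SigmaFinite (μ.map norm) := by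
  have : IsFiniteMeasureOnCompacts (μ.map norm) := ⟨fun s hs => by
    obtain ⟨r, hr⟩ := hs.bddAbove
    refine (measure_mono (t := Iic r) fun x hx => hr hx).trans_lt ?_
    rw [Measure.map_apply measurable_norm measurableSet_Iic]
    refine (measure_mono (t := Metric.closedBall 0 r) fun x hx => ?_).trans_lt
      measure_closedBall_lt_top
    exact mem_closedBall_zero_iff.2 hx⟩
  infer_instance

/-- Norms in different factors are independent, so the proportions multiply. Consequently, in any
measurable region described by norms alone, a product of cones has the product of their densities.
-/
theorem map_norms_restrict_cone {A : ∀ i, Set (V i)} (hA : ∀ i, ∀ r : ℝ, 0 < r → r • A i = A i) :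
    ((Measure.pi μ).restrict (univ.pi A)).map norms =
      (∏ i, coneDensity (μ i) (A i)) • (Measure.pi μ).map norms := by
  have h1 : ∀ i, SigmaFinite (((μ i).restrict (A i)).map norm) := fun i => by
    rw [map_norm_restrict_cone (μ i) (hA i)]
    exact sigmaFinite_smul (coneDensity_ne_top _ _)
  have h2 := Measure.pi_map_pi (μ := fun i => (μ i).restrict (A i)) (f := fun i (x : V i) => ‖x‖)
    fun i => measurable_norm.aemeasurable
  have h3 := Measure.pi_map_pi (μ := μ) (f := fun i (x : V i) => ‖x‖)
    fun i => measurable_norm.aemeasurable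
  rw [Measure.restrict_pi_pi]
  refine h2.trans (Eq.trans ?_ (congrArg _ h3.symm))
  refine Measure.pi_eq fun s hs => ?_
  rw [Measure.smul_apply, Measure.pi_pi, smul_eq_mul, ← Finset.prod_mul_distrib]
  refine Finset.prod_congr rfl fun i _ => ?_
  rw [map_norm_restrict_cone (μ i) (hA i)]
  rfl

/-- Suitable powers of the norms are distributed as a multiple of Lebesgue measure on the orthant,
and taking powers is a differentiable map, which sends null sets to null sets. -/
theorem measure_preimage_norms_eq_zero {S : Set (ι → ℝ)} (hS : volume S = 0) :
    Measure.pi μ (norms ⁻¹' S) = 0 := by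
  set P : (ι → ℝ) → ι → ℝ := fun p i => p i ^ finrank ℝ (V i) with hP
  have hPd : Differentiable ℝ P := differentiable_pi.2 fun i => by fun_prop
  have hPS : volume (P '' S) = 0 :=
    addHaar_image_eq_zero_of_differentiableOn_of_addHaar_eq_zero volume hPd.differentiableOn hS
  have hsig : ∀ i, SigmaFinite ((μ i).map fun x => ‖x‖ ^ finrank ℝ (V i)) := fun i => by
    rw [map_norm_pow]
    exact sigmaFinite_smul measure_closedBall_lt_top.ne
  have h3 := Measure.pi_map_pi (μ := μ) (f := fun i (x : V i) => ‖x‖ ^ finrank ℝ (V i))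
    fun i => by fun_prop
  have h4 : Measure.pi (fun i => (μ i).map fun x => ‖x‖ ^ finrank ℝ (V i)) =
      (∏ i, μ i (Metric.closedBall 0 1)) • (volume : Measure (ι → ℝ)).restrict (univ.pi fun _ => Ici 0) := by
    rw [volume_pi, Measure.restrict_pi_pi]
    refine Measure.pi_eq fun s hs => ?_
    rw [Measure.smul_apply, Measure.pi_pi, smul_eq_mul, ← Finset.prod_mul_distrib]
    refine Finset.prod_congr rfl fun i _ => ?_
    rw [map_norm_pow]
    rfl
  have hm : Measurable fun (x : ∀ i, V i) i => ‖x i‖ ^ finrank ℝ (V i) := by fun_prop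
  refine measure_mono_null (fun x (hx : norms x ∈ S) => ?_)
    (le_antisymm ((Measure.le_map_apply hm.aemeasurable (P '' S)).trans_eq ?_) zero_le)
  · exact ⟨norms x, hx, rfl⟩
  · rw [h3, h4, Measure.smul_apply, smul_eq_mul]
    rw [le_antisymm ((Measure.restrict_le_self _).trans_eq hPS) zero_le, mul_zero]

theorem measure_preimage_norms_pos {S : Set (ι → ℝ)} (hS : IsOpen S)
    (hS' : ∃ p ∈ S, ∀ i, 0 ≤ p i) : 0 < Measure.pi μ (norms ⁻¹' S) := by
  refine (hS.preimage continuous_norms).measure_pos _ ?_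
  obtain ⟨p, hp, hp0⟩ := hS'
  choose x hx using fun i => exists_norm_eq (V i) (hp0 i)
  exact ⟨x, by rwa [mem_preimage, show norms x = p from funext hx]⟩

end ConeProduct

end EkedahlSieve
end

noncomputable section
namespace EkedahlSieve

/-! ### Archimedean completions as real normed spaces -/

section RealStructure

open InfinitePlace InfinitePlace.Completion

variable {K : Type*} [Field K] (w : InfinitePlace K)

open scoped Classical in
/-- The embedding of `ℝ` in an archimedean completion. -/
def realEmbedding : ℝ →+* w.Completion :=
  if hw : w.IsReal then (ringEquivRealOfIsReal hw).symm.toRingHom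
  else (ringEquivComplexOfIsComplex (not_isReal_iff_isComplex.1 hw)).symm.toRingHom.comp
    Complex.ofRealHom

variable {w} in
theorem extensionEmbeddingOfIsReal_realEmbedding (hw : w.IsReal) (r : ℝ) :
    extensionEmbeddingOfIsReal hw (realEmbedding w r) = r := by
  rw [realEmbedding, dif_pos hw]
  exact (ringEquivRealOfIsReal hw).apply_symm_apply r

variable {w} in
theorem extensionEmbedding_realEmbedding (hw : w.IsComplex) (r : ℝ) :
    extensionEmbedding w (realEmbedding w r) = r := by
  rw [realEmbedding, dif_neg (not_isReal_iff_isComplex.2 hw)]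
  exact (ringEquivComplexOfIsComplex hw).apply_symm_apply (r : ℂ)

theorem norm_realEmbedding (r : ℝ) : ‖realEmbedding w r‖ = |r| := by
  by_cases hw : w.IsReal
  · rw [← (isometry_extensionEmbeddingOfIsReal hw).norm_map_of_map_zero (map_zero _),
      extensionEmbeddingOfIsReal_realEmbedding, Real.norm_eq_abs]
  · rw [not_isReal_iff_isComplex] at hw
    rw [← (isometry_extensionEmbedding w).norm_map_of_map_zero (map_zero _),
      extensionEmbedding_realEmbedding hw, Complex.norm_real, Real.norm_eq_abs]

instance : NormedSpace ℝ w.Completion where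
  __ := Module.compHom w.Completion (realEmbedding w)
  norm_smul_le r x := by
    change ‖realEmbedding w r * x‖ ≤ _
    rw [norm_mul, norm_realEmbedding, Real.norm_eq_abs]

end RealStructure

/-! ### Haar measure and densities at archimedean places -/

section ArchHaar

open InfinitePlace InfinitePlace.Completion

set_option linter.unusedSectionVars false

variable {K : Type*} [Field K] [NumberField K] (w : InfinitePlace K) {n : ℕ}

instance : FiniteDimensional ℝ w.Completion := FiniteDimensional.of_locallyCompactSpace ℝ

instance : SecondCountableTopology w.Completion := by
  have := FiniteDimensional.proper ℝ w.Completion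
  infer_instance

instance : (archHaar K w).IsAddHaarMeasure := by
  rw [archHaar]
  split_ifs with hw
  · exact (ringEquivRealOfIsReal hw).symm.toAddEquiv.isAddHaarMeasure_map volume
      (isometryEquivRealOfIsReal hw).symm.continuous (isometryEquivRealOfIsReal hw).continuous
  · rw [not_isReal_iff_isComplex] at hw
    have : ((volume : Measure ℂ).map (isometryEquivComplexOfIsComplex hw).symm).IsAddHaarMeasure :=
      (ringEquivComplexOfIsComplex hw).symm.toAddEquiv.isAddHaarMeasure_map volume
        (isometryEquivComplexOfIsComplex hw).symm.continuous
        (isometryEquivComplexOfIsComplex hw).continuous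
    exact Measure.IsAddHaarMeasure.smul _ two_ne_zero ENNReal.ofNat_ne_top

instance : (archMeasure K n w).IsAddHaarMeasure := by
  unfold archMeasure; infer_instance

variable {w} in
theorem real_smul_affineCone {Ω : Set (PSpace w.Completion n)} {r : ℝ} (hr : 0 < r) :
    r • affineCone Ω = affineCone Ω := by
  have h0 : realEmbedding w r ≠ 0 := (map_ne_zero _).2 hr.ne'
  ext x
  rw [Set.mem_smul_set_iff_inv_smul_mem₀ hr.ne', ← smul_mem_affineCone_iff h0]
  have : realEmbedding w r • r⁻¹ • x = r • r⁻¹ • x := rfl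
  rw [this, smul_inv_smul₀ hr.ne']

theorem archHeight_le_one_iff {x : Fin (n + 1) → w.Completion} :
    archHeight w x ≤ 1 ↔ x ∈ Metric.closedBall 0 1 := by
  rw [mem_closedBall_zero_iff, pi_norm_le_iff_of_nonneg zero_le_one, archHeight,
    ciSup_le_iff (Set.finite_range _).bddAbove]
  exact forall_congr' fun i => pow_le_one_iff_of_nonneg (norm_nonneg _) mult_ne_zero

theorem archDensity_eq (Ω : Set (PSpace w.Completion n)) :
    archDensity w Ω = (coneDensity (archMeasure K n w) (affineCone Ω)).toReal := by
  rw [archDensity, coneDensity, ENNReal.toReal_div]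
  have h1 : {x : Fin (n + 1) → w.Completion | archHeight w x ≤ 1} = Metric.closedBall 0 1 :=
    Set.ext fun x => archHeight_le_one_iff w
  have h2 : {x | x ∈ affineCone Ω ∧ archHeight w x ≤ 1} = affineCone Ω ∩ Metric.closedBall 0 1 :=
    Set.ext fun x => and_congr_right fun _ => archHeight_le_one_iff w
  rw [h1, h2]
  rfl

theorem archDensity_pos {Ω : Set (PSpace w.Completion n)}
    (h : 0 < archMeasure K n w (affineCone Ω)) : 0 < archDensity w Ω := by
  rw [archDensity_eq]
  refine ENNReal.toReal_pos (fun h0 => h.ne' ?_) (coneDensity_ne_top _ _)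
  have h1 : archMeasure K n w (affineCone Ω ∩ Metric.closedBall 0 1) = 0 :=
    (ENNReal.div_eq_zero_iff.1 h0).resolve_right measure_closedBall_lt_top.ne
  refine measure_mono_null (t := ⋃ m : ℕ, affineCone Ω ∩ Metric.closedBall 0 (m : ℝ)) (fun x hx => ?_)
    (measure_iUnion_null fun m => ?_)
  · obtain ⟨m, hm⟩ := exists_nat_ge ‖x‖
    exact mem_iUnion.2 ⟨m, hx, mem_closedBall_zero_iff.2 hm⟩
  · rw [measure_cone_inter_closedBall _ fun r hr => real_smul_affineCone hr, h1, mul_zero]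

theorem archDensity_univ : archDensity w (univ : Set (PSpace w.Completion n)) = 1 := by
  rw [archDensity_eq, coneDensity, affineCone_univ, ← Set.sdiff_eq_compl_inter,
    measure_sdiff_null (measure_singleton _), ENNReal.div_self
      (Metric.measure_closedBall_pos _ _ one_pos).ne' measure_closedBall_lt_top.ne, ENNReal.toReal_one]

end ArchHaar

/-! ### Comparison of `k_∞` with the product of the archimedean completions -/

section Comparison

open InfinitePlace InfinitePlace.Completion

variable (K : Type*) [Field K] [NumberField K] (n : ℕ)

open scoped Classical in
/-- The identification of `∏ k_w^(n+1)` with `k_∞^(n+1)`. -/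
def archEquiv : (∀ w : InfinitePlace K, Fin (n + 1) → w.Completion) ≃L[ℝ]
    (Fin (n + 1) → mixedEmbedding.mixedSpace K) :=
  LinearEquiv.toContinuousLinearEquiv
    { toFun := fun x i => InfiniteAdeleRing.ringEquiv_mixedSpace K fun w => x w i
      invFun := fun e w i => (InfiniteAdeleRing.ringEquiv_mixedSpace K).symm (e i) w
      left_inv := fun x => by
        funext w i
        exact congrFun ((InfiniteAdeleRing.ringEquiv_mixedSpace K).symm_apply_apply _) w
      right_inv := fun e => by
        funext i
        exact (InfiniteAdeleRing.ringEquiv_mixedSpace K).apply_symm_apply (e i)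
      map_add' := fun x y => by
        funext i
        exact map_add (InfiniteAdeleRing.ringEquiv_mixedSpace K) _ _
      map_smul' := fun r x => by
        funext i
        refine Prod.ext (funext fun w => ?_) (funext fun w => ?_)
        · exact (map_mul (extensionEmbeddingOfIsReal w.2) _ _).trans
            (congrArg (· * _) (extensionEmbeddingOfIsReal_realEmbedding w.2 r))
        · exact (map_mul (extensionEmbedding w.1) _ _).trans
            (congrArg (· * _) (extensionEmbedding_realEmbedding w.2 r)) }

/-- The image of `x ∈ 𝔬^(n+1)` in `∏ k_w^(n+1)`. -/
def toArch (x : Fin (n + 1) → 𝓞 K) (w : InfinitePlace K) : Fin (n + 1) → w.Completion :=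
  fun i => algebraMap K w.Completion (x i : K)

theorem archEquiv_toArch (x : Fin (n + 1) → 𝓞 K) :
    archEquiv K n (toArch K n x) = archEmbedding K n x := by
  funext i
  exact (InfiniteAdeleRing.mixedEmbedding_eq_algebraMap_comp K).symm

open scoped Classical in
-- Uniqueness of Haar measure. The value of `c` is irrelevant, because only ratios of volumes
-- survive in the limit.
theorem exists_volume_eq_smul_map_archEquiv : ∃ c : ℝ≥0∞, c ≠ 0 ∧ c ≠ ∞ ∧
    ∀ s : Set (Fin (n + 1) → mixedEmbedding.mixedSpace K),
      volume s = c * Measure.pi (archMeasure K n) (archEquiv K n ⁻¹' s) := by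
  have h := (archEquiv K n).toLinearEquiv.toAddEquiv.isAddHaarMeasure_map
    (Measure.pi (archMeasure K n)) (archEquiv K n).continuous (archEquiv K n).symm.continuous
  let μ := (Measure.pi (archMeasure K n)).map (archEquiv K n)
  have hμ : μ.IsAddHaarMeasure := h
  refine ⟨Measure.addHaarScalarFactor volume μ, ?_, ENNReal.coe_ne_top, fun s => ?_⟩
  · rw [ENNReal.coe_ne_zero]
    exact (Measure.addHaarScalarFactor_pos_of_isAddHaarMeasure _ _).ne'
  · have h1 := congrArg (· s) (Measure.isAddLeftInvariant_eq_smul volume μ)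
    have h2 : μ s = Measure.pi (archMeasure K n) (archEquiv K n ⁻¹' s) :=
      (archEquiv K n).toHomeomorph.toMeasurableEquiv.map_apply s
    rw [← h2]
    exact h1

end Comparison

end EkedahlSieve
end

noncomputable section
namespace EkedahlSieve

/-! ### The region at infinity cut out by the units and the height -/

section ArchRegion

open mixedEmbedding mixedEmbedding.fundamentalCone

variable (K : Type*) [Field K] [NumberField K]

/-- The norms at the infinite places of the points of norm at most one in the fundamental cone. -/
def normVectors : Set (InfinitePlace K → ℝ) := expMapBasis '' paramSet K

theorem measurableSet_normVectors : MeasurableSet (normVectors K) :=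
  (measurableSet_paramSet K).image_of_continuousOn_injOn (continuous_expMapBasis K).continuousOn
    (injective_expMapBasis K).injOn

theorem isBounded_normVectors : Bornology.IsBounded (normVectors K) :=
  (isCompact_compactSet K).isBounded.subset
    ((image_mono subset_closure).trans (expMapBasis_closure_subset_compactSet K))

/-- Inside the open positive orthant, `expMapBasis` is a homeomorphism, so the frontier there is the
differentiable image of the null frontier of `paramSet`. Any other frontier point lies on a
coordinate hyperplane. -/
theorem volume_frontier_normVectors : volume (frontier (normVectors K)) = 0 := by
  have h1 : volume (expMapBasis '' frontier (paramSet K)) = 0 := by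
    refine addHaar_image_eq_zero_of_differentiableOn_of_addHaar_eq_zero volume
      (fun x _ => (hasFDerivAt_expMapBasis K x).differentiableAt.differentiableWithinAt) ?_
    exact ae_le_set.1 (closure_paramSet_ae_interior K).le
  have h2 : ∀ w : InfinitePlace K, volume {p : InfinitePlace K → ℝ | p w = 0} = 0 := fun w => by
    rw [volume_pi]
    exact Measure.pi_hyperplane _ w 0
  refine measure_mono_null (fun p hp => ?_) (measure_union_null h1 (measure_iUnion_null h2))
  by_cases hpos : ∀ w, 0 < p w
  · refine Or.inl ⟨expMapBasis.symm p, ?_, expMapBasis.right_inv (Set.mem_univ_pi.2 hpos)⟩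
    have h3 := expMapBasis.preimage_frontier (normVectors K)
    rw [expMapBasis_source, univ_inter, univ_inter, normVectors,
      Set.preimage_image_eq _ (injective_expMapBasis K)] at h3
    rw [← h3, mem_preimage, expMapBasis.right_inv (Set.mem_univ_pi.2 hpos)]
    exact hp
  · push Not at hpos
    obtain ⟨w, hw⟩ := hpos
    refine Or.inr (mem_iUnion.2 ⟨w, le_antisymm hw ?_⟩)
    have hcl : IsClosed {p : InfinitePlace K → ℝ | 0 ≤ p w} :=
      isClosed_le continuous_const (continuous_apply w)
    refine closure_minimal ?_ hcl (frontier_subset_closure hp)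
    rintro _ ⟨q, -, rfl⟩
    exact expMapBasis_nonneg q w

theorem exists_mem_interior_normVectors : ∃ p ∈ interior (normVectors K), ∀ w, 0 ≤ p w := by
  classical
  obtain ⟨q, hq⟩ : (interior (paramSet K)).Nonempty := by
    rw [interior_paramSet]
    refine Set.univ_pi_nonempty_iff.2 fun w => ?_
    split_ifs
    · exact nonempty_Iio
    · exact nonempty_Ioo.2 one_pos
  refine ⟨expMapBasis q, ?_, expMapBasis_nonneg q⟩
  have : IsOpen (expMapBasis '' (interior (paramSet K))) :=
    expMapBasis.isOpen_image_of_subset_source isOpen_interior (by simp [expMapBasis_source])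
  exact interior_maximal (Set.image_mono interior_subset) this ⟨q, hq, rfl⟩

variable {K} in
theorem mem_normVectors_iff {p : InfinitePlace K → ℝ} (hp : ∀ w, 0 ≤ p w) :
    p ∈ normVectors K ↔ mixedSpaceOfRealSpace p ∈ normLeOne K := by
  rw [normLeOne_eq_preimage, mem_preimage, normAtAllPlaces_mixedSpaceOfRealSpace hp]
  rfl

variable (n : ℕ)

/-- The points of `k_∞^(n+1)` whose vector of norms lies in the fundamental domain for the units and
has norm at most one. -/
def normRegion : Set (Fin (n + 1) → mixedSpace K) :=
  (archEquiv K n).symm ⁻¹' (norms ⁻¹' normVectors K)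

variable {K n} in
/-- The part of `normRegion K n` that lies over the given sets at the infinite places. -/
def archRegion (Ω : ∀ w : InfinitePlace K, Set (PSpace w.Completion n)) :
    Set (Fin (n + 1) → mixedSpace K) :=
  (archEquiv K n).symm ⁻¹' (norms ⁻¹' normVectors K ∩ univ.pi fun w => affineCone (Ω w))

open scoped Classical in
theorem isBounded_normRegion : Bornology.IsBounded (normRegion K n) := by
  have h : Bornology.IsBounded (norms ⁻¹' normVectors K :
      Set (∀ w : InfinitePlace K, Fin (n + 1) → w.Completion)) := by
    obtain ⟨R, hR⟩ := (isBounded_normVectors K).exists_norm_le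
    refine isBounded_iff_forall_norm_le.2 ⟨R, fun x hx => ?_⟩
    have h1 := hR _ hx
    have hR0 := (norm_nonneg _).trans h1
    rw [pi_norm_le_iff_of_nonneg hR0] at h1 ⊢
    exact fun w => (Real.le_norm_self _).trans (h1 w)
  have h2 : normRegion K n = archEquiv K n '' (norms ⁻¹' normVectors K) :=
    ((archEquiv K n).toEquiv.image_eq_preimage_symm _).symm
  rw [h2]
  exact (archEquiv K n).lipschitz.isBounded_image h

variable {K n} {Ω : ∀ w : InfinitePlace K, Set (PSpace w.Completion n)}

theorem isBounded_archRegion : Bornology.IsBounded (archRegion Ω) :=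
  (isBounded_normRegion K n).subset (preimage_mono inter_subset_left)

open scoped Classical in
theorem volume_frontier_archRegion (hΩ : ∀ w, archMeasure K n w (frontier (affineCone (Ω w))) = 0) :
    volume (frontier (archRegion Ω)) = 0 := by
  obtain ⟨c, -, -, hc⟩ := exists_volume_eq_smul_map_archEquiv K n
  have h1 : frontier (archRegion Ω) = (archEquiv K n).symm ⁻¹'
      frontier (norms ⁻¹' normVectors K ∩ univ.pi fun w => affineCone (Ω w)) :=
    ((archEquiv K n).symm.toHomeomorph.preimage_frontier _).symm
  have h2 : archEquiv K n ⁻¹' ((archEquiv K n).symm ⁻¹'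
      frontier (norms ⁻¹' normVectors K ∩ univ.pi fun w => affineCone (Ω w))) =
      frontier (norms ⁻¹' normVectors K ∩ univ.pi fun w => affineCone (Ω w)) := by
    ext x
    simp
  rw [hc, h1, h2]
  refine mul_eq_zero_of_right _ (measure_mono_null (frontier_inter_subset _ _) ?_)
  refine measure_union_null (measure_mono_null inter_subset_left ?_)
    (measure_mono_null inter_subset_right (measure_frontier_pi _ _ hΩ))
  exact measure_mono_null (continuous_norms.frontier_preimage_subset _)
    (measure_preimage_norms_eq_zero _ (volume_frontier_normVectors K))

open scoped Classical in
-- Without the cones the region depends only on the vector of norms, so restricting to the cones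
-- multiplies the volume by the product of their densities.
theorem volume_real_archRegion : volume.real (archRegion Ω) =
      (∏ w, archDensity w (Ω w)) * volume.real (normRegion K n) := by
  obtain ⟨c, -, -, hc⟩ := exists_volume_eq_smul_map_archEquiv K n
  have h2 : ∀ s : Set (∀ w : InfinitePlace K, Fin (n + 1) → w.Completion),
      archEquiv K n ⁻¹' ((archEquiv K n).symm ⁻¹' s) = s := fun s => by
    ext x
    simp
  have key : Measure.pi (archMeasure K n)
      (norms ⁻¹' normVectors K ∩ univ.pi fun w => affineCone (Ω w)) =
      (∏ w, coneDensity (archMeasure K n w) (affineCone (Ω w))) *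
        Measure.pi (archMeasure K n) (norms ⁻¹' normVectors K) := by
    have h3 := congrArg (· (normVectors K)) (map_norms_restrict_cone (archMeasure K n)
      (A := fun w => affineCone (Ω w)) fun w r hr => real_smul_affineCone hr)
    change _ = ((∏ w, coneDensity (archMeasure K n w) (affineCone (Ω w))) •
      (Measure.pi (archMeasure K n)).map norms) (normVectors K) at h3
    have hm := (continuous_norms (V := fun w : InfinitePlace K => Fin (n + 1) → w.Completion)).measurable
      (measurableSet_normVectors K)
    rwa [Measure.smul_apply, Measure.map_apply continuous_norms.measurable
      (measurableSet_normVectors K), Measure.map_apply continuous_norms.measurable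
      (measurableSet_normVectors K), smul_eq_mul, Measure.restrict_apply hm] at h3
  simp_rw [archDensity_eq]
  rw [measureReal_def, measureReal_def, hc, hc, archRegion, normRegion, h2, h2, key,
    ← ENNReal.toReal_prod, ← ENNReal.toReal_mul, mul_left_comm]

open scoped Classical in
theorem volume_real_normRegion_pos : 0 < volume.real (normRegion K n) := by
  obtain ⟨c, hc0, -, hc⟩ := exists_volume_eq_smul_map_archEquiv K n
  refine ENNReal.toReal_pos ?_ (isBounded_normRegion K n).measure_lt_top.ne
  have h2 : archEquiv K n ⁻¹' normRegion K n = norms ⁻¹' normVectors K := by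
    ext x
    simp [normRegion]
  rw [hc, h2]
  refine mul_ne_zero hc0 (ne_of_gt (lt_of_lt_of_le (measure_preimage_norms_pos _ isOpen_interior
    (exists_mem_interior_normVectors K)) (measure_mono (preimage_mono interior_subset))))

/-- The vector of the norms of `x` at the infinite places, as an element of `k_∞`. -/
def normPoint (x : Fin (n + 1) → 𝓞 K) : mixedSpace K :=
  mixedSpaceOfRealSpace (norms (toArch K n x))

/-- Dilation by `T` preserves the fundamental cone and the affine cones and multiplies
`mixedEmbedding.norm` by `T ^ d`. -/
theorem archEmbedding_mem_smul_archRegion {T : ℝ} (hT : 0 < T) {x : Fin (n + 1) → 𝓞 K} :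
    archEmbedding K n x ∈ T • archRegion Ω ↔
      (normPoint x ∈ fundamentalCone K ∧
        mixedEmbedding.norm (normPoint x) ≤ T ^ Module.finrank ℚ K) ∧
      ∀ w, toArch K n x w ∈ affineCone (Ω w) := by
  rw [Set.mem_smul_set_iff_inv_smul_mem₀ hT.ne', archRegion, mem_preimage, map_smul,
    ← archEquiv_toArch, ContinuousLinearEquiv.symm_apply_apply]
  refine and_congr ?_ ?_
  · have h1 : norms (T⁻¹ • toArch K n x) = T⁻¹ • norms (toArch K n x) := funext fun w => by
      change ‖T⁻¹ • toArch K n x w‖ = T⁻¹ * ‖toArch K n x w‖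
      rw [_root_.norm_smul, Real.norm_of_nonneg (inv_nonneg.2 hT.le)]
    rw [mem_preimage, mem_normVectors_iff (p := norms (T⁻¹ • toArch K n x)) fun w => norm_nonneg (_ : Fin (n + 1) → w.Completion), h1, map_smul, mem_normLeOne,
      smul_mem_iff_mem (inv_ne_zero hT.ne'), mixedEmbedding.norm_smul, abs_of_pos (inv_pos.2 hT),
      inv_pow, inv_mul_le_iff₀ (pow_pos hT _), mul_one]
    rfl
  · rw [mem_univ_pi]
    refine forall_congr' fun w => ?_
    have h2 : T⁻¹ • toArch K n x w ∈ T⁻¹ • affineCone (Ω w) ↔ toArch K n x w ∈ affineCone (Ω w) :=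
      Set.smul_mem_smul_set_iff₀ (inv_ne_zero hT.ne') _ _
    rw [real_smul_affineCone (inv_pos.2 hT)] at h2
    exact h2

end ArchRegion

end EkedahlSieve
end

noncomputable section
namespace EkedahlSieve

/-! ### Integral coordinates of projective points -/

section IntegralPoint

variable {K : Type*} [Field K] {n : ℕ}

theorem coe_ne_zero {y : Fin (n + 1) → 𝓞 K} (hy : y ≠ 0) : (fun i => (y i : K)) ≠ 0 := fun h =>
  hy (funext fun i => RingOfIntegers.coe_injective ((congrFun h i).trans (map_zero _).symm))

open scoped Classical in
/-- The point of projective space with the given integral coordinates. -/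
def integralPoint (y : Fin (n + 1) → 𝓞 K) : PSpace K n :=
  if hy : y ≠ 0 then Projectivization.mk K (fun i => (y i : K)) (coe_ne_zero hy)
  -- An arbitrary value for the zero vector.
  else Projectivization.mk K 1 one_ne_zero

theorem integralPoint_of_ne_zero {y : Fin (n + 1) → 𝓞 K} (hy : y ≠ 0) :
    integralPoint y = Projectivization.mk K (fun i => (y i : K)) (coe_ne_zero hy) := dif_pos hy

theorem integralPoint_eq_iff [NumberField K] {y z : Fin (n + 1) → 𝓞 K} (hy : y ≠ 0) (hz : z ≠ 0) :
    integralPoint y = integralPoint z ↔ ∃ a b : 𝓞 K, a ≠ 0 ∧ b ≠ 0 ∧ a • y = b • z := by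
  rw [integralPoint_of_ne_zero hy, integralPoint_of_ne_zero hz, Projectivization.mk_eq_mk_iff']
  constructor
  · rintro ⟨t, ht⟩
    obtain ⟨b, a, ha, rfl⟩ := IsFractionRing.div_surjective (A := 𝓞 K) t
    have ha0 : a ≠ 0 := nonZeroDivisors.ne_zero ha
    have ha0' : algebraMap (𝓞 K) K a ≠ 0 := by simpa using ha0
    refine ⟨a, b, ha0, fun hb => ?_, funext fun i => RingOfIntegers.coe_injective ?_⟩
    · rw [hb, map_zero, zero_div, zero_smul] at ht
      exact coe_ne_zero hy ht.symm
    · have h1 := congrFun ht i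
      rw [Pi.smul_apply, smul_eq_mul, div_mul_eq_mul_div, div_eq_iff ha0'] at h1
      change algebraMap (𝓞 K) K (a * y i) = algebraMap (𝓞 K) K (b * z i)
      rw [map_mul, map_mul, mul_comm]
      exact h1.symm
  · rintro ⟨a, b, ha, hb, h⟩
    have ha0' : algebraMap (𝓞 K) K a ≠ 0 := by simpa using ha
    refine ⟨algebraMap (𝓞 K) K b / algebraMap (𝓞 K) K a, funext fun i => ?_⟩
    have h1 : algebraMap (𝓞 K) K (a * y i) = algebraMap (𝓞 K) K (b * z i) :=
      congrArg _ (congrFun h i)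
    rw [map_mul, map_mul] at h1
    rw [Pi.smul_apply, smul_eq_mul, div_mul_eq_mul_div, div_eq_iff ha0', mul_comm _ (algebraMap _ _ a)]
    exact h1.symm

theorem exists_integralPoint_eq [NumberField K] (x : PSpace K n) :
    ∃ y : Fin (n + 1) → 𝓞 K, y ≠ 0 ∧ integralPoint y = x := by
  obtain ⟨z, hz, rfl⟩ : ∃ z, ∃ hz : z ≠ 0, Projectivization.mk K z hz = x :=
    ⟨x.rep, x.rep_nonzero, x.mk_rep⟩
  obtain ⟨b, hb⟩ := IsLocalization.exist_integer_multiples_of_finite (nonZeroDivisors (𝓞 K)) z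
  choose y hy using hb
  have hb0 : algebraMap (𝓞 K) K b ≠ 0 := by simp
  have hy' : (fun i => (y i : K)) = algebraMap (𝓞 K) K b • z := funext fun i => by
    rw [Pi.smul_apply, smul_eq_mul, ← Algebra.smul_def]
    exact hy i
  have hy0 : y ≠ 0 := fun h => smul_ne_zero hb0 hz <| by
    rw [← hy', h]
    exact funext fun i => map_zero _
  refine ⟨y, hy0, ?_⟩
  rw [integralPoint_of_ne_zero hy0, Projectivization.mk_eq_mk_iff']
  exact ⟨_, hy'.symm⟩

theorem toPSpace_integralPoint_mem_iff {F : Type*} [Field F] [Algebra K F] {Ω : Set (PSpace F n)}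
    {y : Fin (n + 1) → 𝓞 K} (hy : y ≠ 0) :
    toPSpace F (integralPoint y) ∈ Ω ↔ (fun i => algebraMap K F (y i : K)) ∈ affineCone Ω := by
  have h0 : (coordMap F n fun i => (y i : K)) ≠ 0 :=
    (map_ne_zero_iff _ (coordMap_injective F n)).2 (coe_ne_zero hy)
  rw [integralPoint_of_ne_zero hy, toPSpace, Projectivization.map_mk]
  exact (mem_affineCone_mk h0).symm

end IntegralPoint

/-! ### Height and the action of units -/

section Height

variable {K : Type*} [Field K] [NumberField K] {n : ℕ}

omit [NumberField K] in
theorem norm_toArch (y : Fin (n + 1) → 𝓞 K) (w : InfinitePlace K) :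
    ‖toArch K n y w‖ = ⨆ i, w (y i : K) := by
  have h : ∀ i, ‖toArch K n y w i‖ = w (y i : K) := fun i => InfinitePlace.Completion.norm_coe _ _
  refine le_antisymm ?_ (ciSup_le fun i => ?_)
  · refine (pi_norm_le_iff_of_nonneg (Real.iSup_nonneg fun i => apply_nonneg w _)).2 fun i => ?_
    rw [h]
    exact le_ciSup (f := fun i => w (y i : K)) (Set.finite_range _).bddAbove i
  · rw [← h]
    exact norm_le_pi_norm _ i

omit [NumberField K] in
theorem normAtPlace_normPoint (y : Fin (n + 1) → 𝓞 K) (w : InfinitePlace K) :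
    mixedEmbedding.normAtPlace w (normPoint y) = ⨆ i, w (y i : K) := by
  rw [normPoint, mixedEmbedding.normAtPlace_mixedSpaceOfRealSpace (norm_nonneg (toArch K n y w))]
  exact norm_toArch y w

/-- The finite places contribute to the height exactly the inverse norm of the ideal generated by
the coordinates. -/
theorem norm_normPoint {y : Fin (n + 1) → 𝓞 K} (hy : y ≠ 0) :
    mixedEmbedding.norm (normPoint y) =
      Projectivization.mulHeight (integralPoint y) * Ideal.absNorm (Ideal.span (range y)) := by
  have h1 := absNorm_mul_finprod_finitePlace_eq_one hy
  rw [integralPoint_of_ne_zero hy, Projectivization.mulHeight_mk, mulHeight_eq (coe_ne_zero hy),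
    mixedEmbedding.norm_apply, mul_assoc, mul_comm (∏ᶠ _, _), h1, mul_one]
  simp_rw [normAtPlace_normPoint]

omit [NumberField K] in
theorem normAtPlace_normPoint_unit_smul (u : (𝓞 K)ˣ) (y : Fin (n + 1) → 𝓞 K) (w : InfinitePlace K) :
    mixedEmbedding.normAtPlace w (normPoint (u • y)) =
      mixedEmbedding.normAtPlace w (u • normPoint y) := by
  rw [mixedEmbedding.unitSMul_smul, map_mul, normAtPlace_normPoint, normAtPlace_normPoint,
    mixedEmbedding.normAtPlace_apply, Real.mul_iSup_of_nonneg (apply_nonneg w _)]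
  refine iSup_congr fun i => ?_
  rw [← map_mul, ← map_mul]
  rfl

/-- The two points have equal norms at every place, and membership in the fundamental cone depends
on nothing else. A fundamental domain for units acting on `k_∞` thus serves for vectors as well. -/
theorem normPoint_unit_smul_mem_iff (u : (𝓞 K)ˣ) (y : Fin (n + 1) → 𝓞 K) :
    normPoint (u • y) ∈ mixedEmbedding.fundamentalCone K ↔
      u • normPoint y ∈ mixedEmbedding.fundamentalCone K :=
  ⟨fun h => mixedEmbedding.fundamentalCone.mem_of_normAtPlace_eq h fun w =>
    (normAtPlace_normPoint_unit_smul u y w).symm, fun h =>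
    mixedEmbedding.fundamentalCone.mem_of_normAtPlace_eq h (normAtPlace_normPoint_unit_smul u y)⟩

theorem norm_normPoint_ne_zero {y : Fin (n + 1) → 𝓞 K} (hy : y ≠ 0) :
    mixedEmbedding.norm (normPoint y) ≠ 0 := by
  rw [norm_normPoint hy]
  refine mul_ne_zero (Projectivization.mulHeight_ne_zero _) (Nat.cast_ne_zero.2 ?_)
  rw [Ne, Ideal.absNorm_eq_zero_iff, Ideal.span_eq_bot]
  exact fun h => hy (funext fun i => h _ (mem_range_self i))

end Height

section Span

variable {R : Type*} [CommRing R] [IsDomain R] {ι : Type*}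

omit [IsDomain R] in
theorem span_range_smul (a : R) (y : ι → R) :
    Ideal.span (range (a • y)) = Ideal.span {a} * Ideal.span (range y) := by
  rw [Ideal.span_mul_span', Set.singleton_mul, ← Set.range_comp]
  rfl

omit [IsDomain R] in
theorem span_range_unit_smul (u : Rˣ) (y : ι → R) :
    Ideal.span (range (u • y)) = Ideal.span (range y) := by
  have h : u • y = (u : R) • y := rfl
  rw [h, span_range_smul, Ideal.span_singleton_eq_top.2 u.isUnit, Ideal.top_mul]

end Span

/-! ### Normalised representatives and their multiplicity -/

section Representatives

variable (K : Type*) [Field K] [NumberField K]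

/-- An integral ideal in a given ideal class. -/
def classRep (C : ClassGroup (𝓞 K)) : nonZeroDivisors (Ideal (𝓞 K)) :=
  (ClassGroup.mk0_surjective C).choose

variable {K} in
theorem mk0_classRep (C : ClassGroup (𝓞 K)) : ClassGroup.mk0 (classRep K C) = C :=
  (ClassGroup.mk0_surjective C).choose_spec

variable {K} in
theorem classRep_ne_bot (C : ClassGroup (𝓞 K)) : (classRep K C : Ideal (𝓞 K)) ≠ ⊥ :=
  nonZeroDivisors.coe_ne_zero _

variable {K} {n : ℕ}

/-- The normalised integral representatives in an ideal class of the points of height at most `B`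
that satisfy the local conditions. -/
def sievedReps (Ωinf : ∀ w : InfinitePlace K, Set (PSpace w.Completion n))
    (Ωfin : ∀ v : HeightOneSpectrum (𝓞 K), Set (PSpace (v.adicCompletion K) n)) (B : ℝ)
    (C : ClassGroup (𝓞 K)) : Set (Fin (n + 1) → 𝓞 K) :=
  {y | Ideal.span (range y) = classRep K C ∧
    normPoint y ∈ mixedEmbedding.fundamentalCone K ∧ integralPoint y ∈ sievedPoints Ωinf Ωfin B}

variable {Ωinf : ∀ w : InfinitePlace K, Set (PSpace w.Completion n)}
  {Ωfin : ∀ v : HeightOneSpectrum (𝓞 K), Set (PSpace (v.adicCompletion K) n)} {B : ℝ}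

theorem ne_zero_of_span_eq {C : ClassGroup (𝓞 K)} {y : Fin (n + 1) → 𝓞 K}
    (h : Ideal.span (range y) = classRep K C) : y ≠ 0 := by
  rintro rfl
  refine classRep_ne_bot C (h.symm.trans (Ideal.span_eq_bot.2 ?_))
  rintro _ ⟨i, rfl⟩
  rfl

/-- A scalar moves the ideal of the coordinates to the chosen ideal of its class; a unit then moves
the norms into the fundamental cone without changing that ideal. -/
theorem exists_sievedReps {x : PSpace K n} (hx : x ∈ sievedPoints Ωinf Ωfin B) :
    ∃ C, ∃ y ∈ sievedReps Ωinf Ωfin B C, integralPoint y = x := by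
  obtain ⟨z, hz, rfl⟩ := exists_integralPoint_eq x
  have hI : Ideal.span (range z) ≠ ⊥ := fun h =>
    hz (funext fun i => Ideal.span_eq_bot.1 h _ (mem_range_self i))
  let I : nonZeroDivisors (Ideal (𝓞 K)) := ⟨_, mem_nonZeroDivisors_of_ne_zero hI⟩
  set C := ClassGroup.mk0 I with hC
  obtain ⟨a, b, ha, hb, hab⟩ := ClassGroup.mk0_eq_mk0_iff.1 (hC.symm.trans (mk0_classRep C).symm)
  have hmem : ∀ i, ∃ t, b * t = a * z i := fun i => by
    have h1 : a * z i ∈ Ideal.span {b} * (classRep K C : Ideal (𝓞 K)) := by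
      rw [← hab]
      exact Ideal.mul_mem_mul (Ideal.mem_span_singleton_self a) (Ideal.subset_span (mem_range_self i))
    obtain ⟨t, -, ht⟩ := Ideal.mem_span_singleton_mul.1 h1
    exact ⟨t, ht⟩
  choose y hy using hmem
  have hby : b • y = a • z := funext hy
  have hspan : Ideal.span (range y) = classRep K C := by
    rw [← Ideal.span_singleton_mul_right_inj hb, ← span_range_smul, hby, span_range_smul, ← hab]
  have hy0 := ne_zero_of_span_eq hspan
  obtain ⟨u, hu⟩ := mixedEmbedding.fundamentalCone.exists_unit_smul_mem (norm_normPoint_ne_zero hy0)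
  have hspan' : Ideal.span (range (u • y)) = classRep K C := by rw [span_range_unit_smul, hspan]
  have hp : integralPoint (u • y) = integralPoint z := by
    refine (integralPoint_eq_iff (ne_zero_of_span_eq hspan') hz).2 ⟨b, u * a, hb,
      mul_ne_zero u.ne_zero ha, ?_⟩
    rw [mul_smul, ← hby, smul_comm]
    rfl
  exact ⟨C, u • y, ⟨hspan', (normPoint_unit_smul_mem_iff u y).2 hu, hp ▸ hx⟩, hp⟩

theorem integralPoint_unit_smul (u : (𝓞 K)ˣ) {y : Fin (n + 1) → 𝓞 K} (hy : y ≠ 0) :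
    integralPoint (u • y) = integralPoint y := by
  have hy' : u • y ≠ 0 := by rwa [Ne, smul_eq_zero_iff_eq]
  exact (integralPoint_eq_iff hy' hy).2 ⟨1, u, one_ne_zero, u.ne_zero, one_smul _ _⟩

/-- Proportional vectors generate ideals in the same class. If these ideals are equal, the ratio
generates the unit ideal. -/
theorem exists_unit_smul_eq {C C' : ClassGroup (𝓞 K)} {y z : Fin (n + 1) → 𝓞 K}
    (hy : Ideal.span (range y) = classRep K C) (hz : Ideal.span (range z) = classRep K C')
    (h : integralPoint y = integralPoint z) : C = C' ∧ ∃ u : (𝓞 K)ˣ, u • y = z := by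
  obtain ⟨a, b, ha, hb, hab⟩ :=
    (integralPoint_eq_iff (ne_zero_of_span_eq hy) (ne_zero_of_span_eq hz)).1 h
  have h1 : Ideal.span {a} * (classRep K C : Ideal (𝓞 K)) = Ideal.span {b} * classRep K C' := by
    rw [← hy, ← hz, ← span_range_smul, hab, span_range_smul]
  have hC : C = C' := by
    rw [← mk0_classRep C, ← mk0_classRep C']
    exact ClassGroup.mk0_eq_mk0_iff.2 ⟨a, b, ha, hb, h1⟩
  subst hC
  refine ⟨rfl, ?_⟩
  have h2 : Ideal.span {a} = Ideal.span {b} :=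
    mul_right_cancel₀ (classRep_ne_bot C) h1
  obtain ⟨u, hu⟩ := (Ideal.span_singleton_eq_span_singleton.1 h2).symm
  refine ⟨u, smul_right_injective _ hb ?_⟩
  change b • u • y = b • z
  rw [← hab, ← hu, mul_smul]
  rfl

/-- Two representatives differ by a unit, and the units keeping a point in the fundamental cone are
the roots of unity. -/
theorem fiber_sievedReps {C : ClassGroup (𝓞 K)} {y : Fin (n + 1) → 𝓞 K}
    (hy : y ∈ sievedReps Ωinf Ωfin B C) :
    {z | (∃ C', z ∈ sievedReps Ωinf Ωfin B C') ∧ integralPoint z = integralPoint y} =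
      range fun u : Units.torsion K => (u : (𝓞 K)ˣ) • y := by
  have hy0 := ne_zero_of_span_eq hy.1
  ext z
  constructor
  · rintro ⟨⟨C', hz⟩, h⟩
    obtain ⟨rfl, u, rfl⟩ := exists_unit_smul_eq hy.1 hz.1 h.symm
    exact ⟨⟨u, (mixedEmbedding.fundamentalCone.unit_smul_mem_iff_mem_torsion hy.2.1 u).1
      ((normPoint_unit_smul_mem_iff u y).1 hz.2.1)⟩, rfl⟩
  · rintro ⟨⟨u, hu⟩, rfl⟩
    have h1 := integralPoint_unit_smul u hy0
    exact ⟨⟨C, (span_range_unit_smul u y).trans hy.1, (normPoint_unit_smul_mem_iff u y).2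
      ((mixedEmbedding.fundamentalCone.unit_smul_mem_iff_mem_torsion hy.2.1 u).2 hu),
      h1.symm ▸ hy.2.2⟩, h1⟩

theorem ncard_fiber_sievedReps {C : ClassGroup (𝓞 K)} {y : Fin (n + 1) → 𝓞 K}
    (hy : y ∈ sievedReps Ωinf Ωfin B C) :
    {z | (∃ C', z ∈ sievedReps Ωinf Ωfin B C') ∧ integralPoint z = integralPoint y}.ncard =
      Units.torsionOrder K := by
  rw [fiber_sievedReps hy, Units.torsionOrder, ← Set.image_univ, Set.ncard_image_of_injective,
    Set.ncard_univ]
  intro u u' h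
  have hy0 := ne_zero_of_span_eq hy.1
  obtain ⟨i, hi⟩ := Function.ne_iff.1 hy0
  refine Subtype.ext (Units.ext ?_)
  exact mul_right_cancel₀ hi (congrFun h i)

/-- The points of projective space are the orbits of the roots of unity on the normalised integral
representatives. -/
theorem sum_ncard_sievedReps (hfin : ∀ C, (sievedReps Ωinf Ωfin B C).Finite) :
    ∑ C, (sievedReps Ωinf Ωfin B C).ncard =
      Units.torsionOrder K * (sievedPoints Ωinf Ωfin B).ncard := by
  classical
  set S : Finset (Fin (n + 1) → 𝓞 K) := Finset.univ.biUnion fun C => (hfin C).toFinset with hS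
  have hmemS : ∀ y, y ∈ S ↔ ∃ C, y ∈ sievedReps Ωinf Ωfin B C := fun y => by simp [hS]
  have hcard : S.card = ∑ C, (sievedReps Ωinf Ωfin B C).ncard := by
    rw [hS, Finset.card_biUnion]
    · exact Finset.sum_congr rfl fun C _ => (Set.ncard_eq_toFinset_card _ (hfin C)).symm
    · intro C _ C' _ hCC
      rw [Function.onFun, Finset.disjoint_left]
      intro y hy hy'
      rw [Set.Finite.mem_toFinset] at hy hy'
      exact hCC (exists_unit_smul_eq hy.1 hy'.1 rfl).1
  have himage : sievedPoints Ωinf Ωfin B = S.image integralPoint := by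
    ext x
    rw [Finset.coe_image]
    constructor
    · intro hx
      obtain ⟨C, y, hy, rfl⟩ := exists_sievedReps hx
      exact ⟨y, (hmemS y).2 ⟨C, hy⟩, rfl⟩
    · rintro ⟨y, hy, rfl⟩
      obtain ⟨C, hC⟩ := (hmemS y).1 hy
      exact hC.2.2
  rw [← hcard, himage, Set.ncard_coe_finset, Finset.card_eq_sum_card_image integralPoint S,
    mul_comm, ← smul_eq_mul, ← Finset.sum_const]
  refine Finset.sum_congr rfl fun x hx => ?_
  obtain ⟨y, hy, rfl⟩ := Finset.mem_image.1 hx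
  obtain ⟨C, hC⟩ := (hmemS y).1 hy
  rw [← ncard_fiber_sievedReps hC, ← Set.ncard_coe_finset]
  congr 1
  ext z
  rw [Finset.coe_filter]
  exact and_congr_left fun _ => hmemS z

end Representatives

end EkedahlSieve
end

noncomputable section
namespace EkedahlSieve

/-! ### Asymptotic counts -/

section Asymptotics

variable {K : Type*} [Field K] [NumberField K] {n : ℕ}
  {Ωinf : ∀ w : InfinitePlace K, Set (PSpace w.Completion n)}
  {Ωfin : ∀ v : HeightOneSpectrum (𝓞 K), Set (PSpace (v.adicCompletion K) n)}

theorem mem_sievedPoints_integralPoint_iff {B : ℝ} {y : Fin (n + 1) → 𝓞 K} (hy : y ≠ 0) :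
    integralPoint y ∈ sievedPoints Ωinf Ωfin B ↔
      mixedEmbedding.norm (normPoint y) ≤ B * Ideal.absNorm (Ideal.span (range y)) ∧
      (∀ w, toArch K n y w ∈ affineCone (Ωinf w)) ∧
      ∀ v, toCompletion v y ∈ affineCone (Ωfin v) := by
  refine and_congr ?_ (and_congr (forall_congr' fun w => toPSpace_integralPoint_mem_iff hy)
    (forall_congr' fun v => toPSpace_integralPoint_mem_iff hy))
  rw [norm_normPoint hy, mul_le_mul_iff_left₀]
  · rfl
  rw [Nat.cast_pos, Nat.pos_iff_ne_zero, Ne, Ideal.absNorm_eq_zero_iff, Ideal.span_eq_bot]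
  exact fun h => hy (funext fun i => h _ (mem_range_self i))

/-- This puts the normalised representatives into the shape of the sieve: one condition per prime
and a dilated region at infinity. -/
theorem sievedReps_eq {B T : ℝ} (hT : 0 < T) {C : ClassGroup (𝓞 K)}
    (hTB : T ^ Module.finrank ℚ K = B * Ideal.absNorm (classRep K C : Ideal (𝓞 K))) :
    sievedReps Ωinf Ωfin B C =
      {y | (∀ v, toCompletion v y ∈ primitiveCone v (Ωfin v)
        (multiplicity v.asIdeal (classRep K C : Ideal (𝓞 K)))) ∧
        archEmbedding K n y ∈ T • archRegion Ωinf} := by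
  ext y
  have h1 : y ∈ sievedReps Ωinf Ωfin B C ↔ Ideal.span (range y) = classRep K C ∧
    normPoint y ∈ mixedEmbedding.fundamentalCone K ∧ integralPoint y ∈ sievedPoints Ωinf Ωfin B :=
    Iff.rfl
  have h2 := forall_mem_primitiveCone_iff (Ω := Ωfin) (x := y) (classRep_ne_bot C)
  have h3 := archEmbedding_mem_smul_archRegion (Ω := Ωinf) hT (x := y)
  rw [h1]
  refine Iff.trans ?_ (and_congr h2 h3).symm
  rw [and_assoc (a := Ideal.span (range y) = classRep K C)]
  refine and_congr_right fun hC => ?_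
  rw [mem_sievedPoints_integralPoint_iff (ne_zero_of_span_eq hC), hC, ← hTB]
  tauto

variable (K n) in
/-- The number of normalised integral representatives of height at most `B` in an ideal class, divided
by `B ^ (n + 1)`, tends to this constant. -/
def classConst (C : ClassGroup (𝓞 K)) : ℝ := open scoped Classical in
  (Ideal.absNorm (classRep K C : Ideal (𝓞 K)) : ℝ) ^ (n + 1) *
    (volume.real (normRegion K n) / volume.real (archTile K n) *
      ∏' v : HeightOneSpectrum (𝓞 K),
        shellMeasure v n (multiplicity v.asIdeal (classRep K C : Ideal (𝓞 K))))

theorem padicMeasure_frontier_affineCone_univ (v : HeightOneSpectrum (𝓞 K)) :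
    padicMeasure K n v (frontier (affineCone (univ : Set (PSpace (v.adicCompletion K) n)))) = 0 :=
  measure_mono_null frontier_affineCone_univ_subset (measure_singleton _)

theorem classConst_pos (hn : 0 < n) (C : ClassGroup (𝓞 K)) : 0 < classConst K n C := by
  classical
  have h1 : 0 < (Ideal.absNorm (classRep K C : Ideal (𝓞 K)) : ℝ) :=
    Nat.cast_pos.2 (Nat.pos_of_ne_zero (Ideal.absNorm_eq_zero_iff.not.2 (classRep_ne_bot C)))
  have h2 : 0 < volume.real (archTile K n) :=
    ENNReal.toReal_pos (isFundamentalTile_archTile K n).ne_zero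
      (isFundamentalTile_archTile K n).bounded.measure_lt_top.ne
  have h3 := tprod_padicMeasure_pos (K := K) (n := n) (U := fun v => primitiveCone v univ
    (multiplicity v.asIdeal (classRep K C : Ideal (𝓞 K)))) (fun v => primitiveCone_subset v _)
    (fun v => padicMeasure_frontier_primitiveCone v (padicMeasure_frontier_affineCone_univ v) _)
    (smallTail_affineCone_univ.primitiveCone hn (classRep_ne_bot C)) fun v => by
      rw [padicMeasure_real_primitiveCone, padicDensity_univ, mul_one]
      exact shellMeasure_pos v n _
  simp_rw [padicMeasure_real_primitiveCone, padicDensity_univ, mul_one] at h3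
  exact mul_pos (pow_pos h1 _) (mul_pos (div_pos volume_real_normRegion_pos h2) h3)

theorem multipliable_padicDensity : Multipliable fun v => padicDensity v (Ωfin v) :=
  multipliable_of_le_one (fun v => padicDensity_nonneg v) fun v => padicDensity_le_one v

theorem multipliable_shellMeasure (k : HeightOneSpectrum (𝓞 K) → ℕ) :
    Multipliable fun v => shellMeasure v n (k v) :=
  multipliable_of_le_one (fun v => (shellMeasure_pos v n _).le) fun v => by
    have h := padicMeasure_real_le_one (K := K) (n := n) (U := fun v => primitiveCone v univ (k v))
      (fun v => primitiveCone_subset v _) v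
    rwa [padicMeasure_real_primitiveCone, padicDensity_univ, mul_one] at h

/-- The sieve bounds away from zero the product of densities with shell measures for the unit ideal;
if the product of the densities vanished, so would this one. -/
theorem tprod_padicDensity_pos (hn : 0 < n)
    (hbdry : ∀ v, padicMeasure K n v (frontier (affineCone (Ωfin v))) = 0)
    (hpos : ∀ v, 0 < padicMeasure K n v (affineCone (Ωfin v)))
    (htail : SmallTail fun v => affineCone (Ωfin v)) : 0 < ∏' v, padicDensity v (Ωfin v) := by
  have hJ : (⊤ : Ideal (𝓞 K)) ≠ ⊥ := top_ne_bot
  have h := tprod_padicMeasure_pos (K := K) (n := n) (U := fun v => primitiveCone v (Ωfin v)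
    (multiplicity v.asIdeal ⊤)) (fun v => primitiveCone_subset v _)
    (fun v => padicMeasure_frontier_primitiveCone v (hbdry v) _)
    (htail.primitiveCone hn hJ) fun v => by
      rw [padicMeasure_real_primitiveCone]
      exact mul_pos (shellMeasure_pos v n _) (padicDensity_pos v (hpos v))
  simp_rw [padicMeasure_real_primitiveCone] at h
  rw [(multipliable_shellMeasure _).tprod_mul multipliable_padicDensity] at h
  exact lt_of_le_of_ne (tprod_nonneg fun v => padicDensity_nonneg v) fun h0 => by simp [← h0] at h

theorem tendsto_ncard_sievedReps (hn : 0 < n)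
    (hinf : ∀ w, archMeasure K n w (frontier (affineCone (Ωinf w))) = 0)
    (hfin : ∀ v, padicMeasure K n v (frontier (affineCone (Ωfin v))) = 0)
    (htail : SmallTail fun v => affineCone (Ωfin v)) (C : ClassGroup (𝓞 K)) :
    Tendsto (fun B : ℝ => ((sievedReps Ωinf Ωfin B C).ncard : ℝ) / B ^ (n + 1)) atTop
      (𝓝 (classConst K n C *
        ((∏ w, archDensity w (Ωinf w)) * ∏' v, padicDensity v (Ωfin v)))) := by
  classical
  set J : Ideal (𝓞 K) := (classRep K C : Ideal (𝓞 K)) with hJ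
  have hN : 0 < (Ideal.absNorm J : ℝ) :=
    Nat.cast_pos.2 (Nat.pos_of_ne_zero (Ideal.absNorm_eq_zero_iff.not.2 (classRep_ne_bot C)))
  have hd : Module.finrank ℚ K ≠ 0 := Module.finrank_pos.ne'
  have h1 := tendsto_ncard_infinite (K := K) (n := n) (U := fun v => primitiveCone v (Ωfin v)
    (multiplicity v.asIdeal J)) (fun v => primitiveCone_subset v _) isBounded_archRegion
    (volume_frontier_archRegion hinf)
    (fun v => padicMeasure_frontier_primitiveCone v (hfin v) _)
    (htail.primitiveCone hn (classRep_ne_bot C))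
  simp_rw [padicMeasure_real_primitiveCone] at h1
  rw [(multipliable_shellMeasure _).tprod_mul multipliable_padicDensity, volume_real_archRegion] at h1
  -- The scale is `T = (B * N J) ^ (1 / d)`, so `T ^ (d * (n + 1)) = (B * N J) ^ (n + 1)`. This is
  -- the source of the power of `N J` in `classConst`.
  have hT : Tendsto (fun B : ℝ => (B * Ideal.absNorm J) ^ ((Module.finrank ℚ K : ℝ)⁻¹)) atTop atTop :=
    (tendsto_rpow_atTop (by positivity)).comp (tendsto_id.atTop_mul_const hN)
  have h2 := (h1.comp hT).const_mul ((Ideal.absNorm J : ℝ) ^ (n + 1))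
  have e : classConst K n C * ((∏ w, archDensity w (Ωinf w)) * ∏' v, padicDensity v (Ωfin v)) =
      (Ideal.absNorm J : ℝ) ^ (n + 1) * ((∏ w, archDensity w (Ωinf w)) *
        volume.real (normRegion K n) / volume.real (archTile K n) *
        ((∏' v, shellMeasure v n (multiplicity v.asIdeal J)) * ∏' v, padicDensity v (Ωfin v))) := by
    rw [classConst]
    ring
  rw [e]
  refine h2.congr' ?_
  filter_upwards [eventually_gt_atTop 0] with B hB
  have hBN : 0 < B * Ideal.absNorm J := mul_pos hB hN
  have hTd := Real.rpow_inv_natCast_pow hBN.le hd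
  rw [Function.comp_apply, sievedReps_eq (Real.rpow_pos_of_pos hBN _) hTd, pow_mul, hTd, mul_pow]
  field_simp
  rfl

open scoped Classical in
theorem finite_sievedReps {B : ℝ} (hB : 0 < B) (C : ClassGroup (𝓞 K)) :
    (sievedReps Ωinf Ωfin B C).Finite := by
  have hN : 0 < (Ideal.absNorm (classRep K C : Ideal (𝓞 K)) : ℝ) :=
    Nat.cast_pos.2 (Nat.pos_of_ne_zero (Ideal.absNorm_eq_zero_iff.not.2 (classRep_ne_bot C)))
  have hBN := mul_pos hB hN
  rw [sievedReps_eq (Real.rpow_pos_of_pos hBN _)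
    (Real.rpow_inv_natCast_pow hBN.le Module.finrank_pos.ne')]
  exact ((isFundamentalTile_archTile K n).finite isBounded_archRegion _).subset fun y hy => hy.2

variable (K n) in
/-- The number of points of height at most `B`, divided by `B ^ (n + 1)`, tends to this constant. -/
def heightConst : ℝ := (∑ C, classConst K n C) / Units.torsionOrder K

theorem heightConst_pos (hn : 0 < n) : 0 < heightConst K n := by
  have : 0 < Units.torsionOrder K := Nat.pos_of_ne_zero (Units.torsionOrder_ne_zero K)
  exact div_pos (Finset.sum_pos (fun C _ => classConst_pos hn C) Finset.univ_nonempty)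
    (Nat.cast_pos.2 this)

theorem tendsto_ncard_sievedPoints (hn : 0 < n)
    (hinf : ∀ w, archMeasure K n w (frontier (affineCone (Ωinf w))) = 0)
    (hfin : ∀ v, padicMeasure K n v (frontier (affineCone (Ωfin v))) = 0)
    (htail : SmallTail fun v => affineCone (Ωfin v)) :
    Tendsto (fun B : ℝ => ((sievedPoints Ωinf Ωfin B).ncard : ℝ) / B ^ (n + 1)) atTop
      (𝓝 (heightConst K n *
        ((∏ w, archDensity w (Ωinf w)) * ∏' v, padicDensity v (Ωfin v)))) := by
  have h0 : (Units.torsionOrder K : ℝ) ≠ 0 := Nat.cast_ne_zero.2 (Units.torsionOrder_ne_zero K)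
  have h1 := (tendsto_finsetSum Finset.univ fun C _ =>
    tendsto_ncard_sievedReps hn hinf hfin htail C).div_const (Units.torsionOrder K : ℝ)
  rw [← Finset.sum_mul, mul_div_right_comm] at h1
  refine h1.congr' ?_
  filter_upwards [eventually_gt_atTop 0] with B hB
  rw [← Finset.sum_div, ← Nat.cast_sum, sum_ncard_sievedReps (finite_sievedReps hB), Nat.cast_mul]
  field_simp

theorem sievedPoints_univ (B : ℝ) : sievedPoints (fun _ : InfinitePlace K => univ)
    (fun _ : HeightOneSpectrum (𝓞 K) => univ) B = boundedHeight K n B := by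
  ext x
  exact ⟨fun h => h.1, fun h => ⟨h, fun _ => mem_univ _, fun _ => mem_univ _⟩⟩

/-- The denominator is the same count with no local restriction, so its constant is literally the
one in the numerator. -/
theorem tendsto_ncard_boundedHeight (hn : 0 < n) :
    Tendsto (fun B : ℝ => ((boundedHeight K n B).ncard : ℝ) / B ^ (n + 1)) atTop
      (𝓝 (heightConst K n)) := by
  have h := tendsto_ncard_sievedPoints (K := K) (Ωinf := fun _ => univ) (Ωfin := fun _ => univ) hn
    (fun w => measure_mono_null frontier_affineCone_univ_subset (measure_singleton _)) padicMeasure_frontier_affineCone_univ smallTail_affineCone_univ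
  simp_rw [sievedPoints_univ, archDensity_univ, padicDensity_univ] at h
  simpa using h

end Asymptotics

/-! ### The case of a single point -/

section DimensionZero

variable {K : Type*} [Field K] [NumberField K]

theorem subsingleton_pSpace_zero (F : Type*) [Field F] : Subsingleton (PSpace F 0) := by
  refine ⟨fun x y => ?_⟩
  rw [← x.mk_rep, ← y.mk_rep, Projectivization.mk_eq_mk_iff']
  have h : y.rep 0 ≠ 0 := fun h => y.rep_nonzero (funext fun i => by rw [Fin.fin_one_eq_zero i, h]; rfl)
  refine ⟨x.rep 0 / y.rep 0, funext fun i => ?_⟩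
  rw [Fin.fin_one_eq_zero i, Pi.smul_apply, smul_eq_mul, div_mul_cancel₀ _ h]

theorem eq_univ_of_affineCone_nonempty {F : Type*} [Field F] {Ω : Set (PSpace F 0)}
    (h : (affineCone Ω).Nonempty) : Ω = univ := by
  obtain ⟨x, hx, hxΩ⟩ := h
  have := subsingleton_pSpace_zero F
  exact eq_univ_of_forall fun y => Subsingleton.elim _ y ▸ hxΩ

end DimensionZero

end EkedahlSieve
end

open EkedahlSieve in
theorem mainTheorem10 (K : Type*) [Field K] [NumberField K] (n : ℕ)
    (Ωinf : ∀ v : InfinitePlace K, Set (PSpace v.Completion n))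
    (Ωfin : ∀ v : HeightOneSpectrum (𝓞 K), Set (PSpace (v.adicCompletion K) n))
    (hinf_bdry : ∀ v, archMeasure K n v (frontier (affineCone (Ωinf v))) = 0)
    (hinf_pos : ∀ v, 0 < archMeasure K n v (affineCone (Ωinf v)))
    (hfin_bdry : ∀ v, padicMeasure K n v (frontier (affineCone (Ωfin v))) = 0)
    (hfin_pos : ∀ v, 0 < padicMeasure K n v (affineCone (Ωfin v)))
    (htail : TailCondition Ωfin) :
    Multipliable (fun v => padicDensity v (Ωfin v)) ∧
    (∏ v, archDensity v (Ωinf v)) * ∏' v, padicDensity v (Ωfin v) ≠ 0 ∧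
    Tendsto
      (fun B : ℝ => ((sievedPoints Ωinf Ωfin B).ncard : ℝ) / ((boundedHeight K n B).ncard : ℝ))
      atTop
      (𝓝 ((∏ v, archDensity v (Ωinf v)) * ∏' v, padicDensity v (Ωfin v))) := by
  -- The bound for vectors divisible by a large prime needs `n > 0`. For `n = 0`, positivity of
  -- measure forces each local set to be everything.
  rcases Nat.eq_zero_or_pos n with rfl | hn
  · obtain rfl : Ωinf = fun _ => univ := funext fun w =>
      eq_univ_of_affineCone_nonempty (nonempty_of_measure_ne_zero (hinf_pos w).ne')
    obtain rfl : Ωfin = fun _ => univ := funext fun v =>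
      eq_univ_of_affineCone_nonempty (nonempty_of_measure_ne_zero (hfin_pos v).ne')
    simp_rw [archDensity_univ, padicDensity_univ, sievedPoints_univ, Finset.prod_const_one, tprod_one,
      mul_one]
    refine ⟨multipliable_one, one_ne_zero, tendsto_const_nhds.congr' ?_⟩
    -- The only point has height `1`, so both counts equal `1` from here on.
    filter_upwards [eventually_ge_atTop 1] with B hB
    have h1 := subsingleton_pSpace_zero K
    have h2 : Subsingleton (Fin (0 + 1)) := inferInstanceAs (Subsingleton (Fin 1))
    have hne : (boundedHeight K 0 B) = univ := eq_univ_of_forall fun x => by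
      change x.mulHeight ≤ B
      rw [← x.mk_rep, Projectivization.mulHeight_mk, Height.mulHeight_eq_one_of_subsingleton]
      exact hB
    have h3 : Nonempty (PSpace K 0) := ⟨Projectivization.mk K 1 one_ne_zero⟩
    rw [hne, Set.ncard_univ, Nat.card_eq_one_iff_unique.2 ⟨h1, h3⟩, Nat.cast_one, div_one]
  · have hden := tendsto_ncard_boundedHeight (K := K) hn
    have hnum := tendsto_ncard_sievedPoints hn hinf_bdry hfin_bdry htail.smallTail
    have hκ := heightConst_pos (K := K) hn
    refine ⟨multipliable_padicDensity, (mul_pos (Finset.prod_pos fun w _ => archDensity_pos w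
      (hinf_pos w)) (tprod_padicDensity_pos hn hfin_bdry hfin_pos htail.smallTail)).ne', ?_⟩
    have h := hnum.div hden hκ.ne'
    rw [mul_div_cancel_left₀ _ hκ.ne'] at h
    refine h.congr' ?_
    filter_upwards [eventually_gt_atTop 0] with B hB
    exact div_div_div_cancel_right₀ (pow_pos hB _).ne' _ _
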